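/- **Setting.** A discrete utility configuration instance $I$ consists of $n\ge 1$ actions; action $i$ has between $1$ and $m$ configurations; configuration $c$ of action $i$ is a joint distribution $F_{ic}$ of (agent utility, principal utility), given as a list of at most $K$ triples $(u^A,u^P,p)$ of rational numbers with $p>0$, $u^P\ge 0$ and probabilities summing to $1$; every number has at most $b$ bits. A configuration $\mathbf C=(C_1,\dots,C_n)$ chooses one configuration per action. The pairs $(u_i^A,u_i^P)\sim F_{iC_i}$ are drawn independently, and the agent picks the action $i^*$ with the largest $u_i^A$, breaking ties in favor of the principal. Write $u^A=u^A_{i^*}$, $u^P=u^P_{i^*}$. The value of $\mathbf C$ is $\mathbb E[u^P]$, and $\mathrm{OPT}$ is the largest value of a configuration. For $f:(0,1]\to\mathbb R$ non-increasing, the instance is $f$-utility aligned if, under an optimal configuration, every threshold $U$ with $q=\Pr[u^A\le U]>0$ satisfies $\mathbb E[u^P\mid u^A\le U]\le f(q)\,\mathbb E[u^P]$. **Algorithm with parameter $M$.** 1. *Preprocessing.* List all mass points of all configurations of all actions in non-decreasing order of $u^P$, and replace each mass point $(u^A,u^P,p)$, in this order, by $\lfloor pM^2\rfloor$ points of probability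 $1/M^2$ and one with the remaining probability $p-\lfloor pM^2\rfloor/M^2$, the $\ell$-th new point overall ($\ell=0,1,2,\dots$) having agent utility $u^A+\delta\ell$ and principal utility $u^P$. Here $\delta>0$ is the least distance between two different agent utilities ($1$ if there are no two) divided by $(M^2+1)$ times the number of original mass points. Call the new instance $\tilde I$; all that follows uses $\tilde I$. 2. *Guessing.* For all $\hat u_1\le\dots\le\hat u_M$ in the set of agent utilities of $\tilde I$, let $\hat u_0=-\infty$, $B_j=[\hat u_{j-1},\hat u_j)$ for $j<M$, $B_M=[\hat u_{M-1},\hat u_M]$ and $B_{\le j}=B_1\cup\dots\cup B_j$. For action $i$ in configuration $c$ let $$q_{ij}=\Pr[u_i^A\in B_j\mid u_i^A\in B_{\le j}],\qquad \bar q_{ij}=\frac{\lfloor M^2n\,q_{ij}\rfloor}{M^2n},\qquad \psi_i=\sum_{j=6}^M\frac{j-5}{M-1}\cdot\frac{\mathbb E[u_i^P\,\mathbf 1(u_i^A\in B_j)]}{\Pr[u_i^A\in B_{\le j}]}$$ (fractions and conditional probabilities with denominator $0$ count as $0$). 3. *Dynamic program.* For each guess, find a configuration maximizing $\sum_i\psi_i(C_i)$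 subject to $$\frac{1-1/M}{j}-\frac1{M^2}\le\sum_i\bar q_{ij}(C_i)\le\frac{1+1/M}{j-1}\qquad(1\le j\le M;\ \text{no upper bound for } j=1),$$ if there is one, by dynamic programming over the actions and over the vectors in $\{0,1,\dots,M^2n^2\}^M$ of accumulated multiples of $1/(M^2n)$. 4. Compute the expected principal utility of each configuration found and return the best one (an arbitrary fixed configuration if none was found). **Theorem 3.1.** Let $M\ge 5$ be an integer. (a) For every instance $I$ the algorithm returns a configuration of $I$. If the preprocessed instance $\tilde I$ is $f$-utility aligned for a non-increasing $f$, and $r_j=f(j/M)$, then the value (in $I$) of the returned configuration is at least $\alpha\cdot\mathrm{OPT}$, where $\mathrm{OPT}$ is the optimum of $I$ and $$\alpha=\frac{M-1}{M+1}\left(\frac{M-5}{M-1}-\frac56\cdot\frac{r_5}{M-1}-\frac5{M-1}\sum_{j=6}^M\frac{r_j}{j-1}\right).$$ (b) For fixed $M$ the number of bit operations of the algorithm is bounded by a polynomial in $n$, $m$, $K$ and $b$, for all instances. -/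

import Mathlib

/-!
Utility configuration with discrete distributions: the problem, its optimum, utility alignment,
a step-counting model of computation, and the approximation scheme written in that model.
-/

namespace UC

/-! ## Instances, configurations, expected utility -/

/-- A mass point of a joint distribution: agent utility, principal utility, probability. -/
structure Mass where
  uA : ℚ
  uP : ℚ
  prob : ℚ

/-- A finitely supported joint distribution of (agent utility, principal utility), as a list of
mass points. -/
abbrev Dist := List Mass

/-- A discrete instance: for each action, the list of its configurations, each of which is a
distribution. -/
abbrev Inst := List (List Dist)

/-- The well-formed instances: there is at least one action, every action has at least one
configuration, every configuration is a probability distribution with positive masses, and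
principal utilities are nonnegative. -/
def Valid (I : Inst) : Prop :=
  I ≠ [] ∧ ∀ cfgs ∈ I, cfgs ≠ [] ∧ ∀ d ∈ cfgs,
    (∀ w ∈ d, 0 < w.prob ∧ 0 ≤ w.uP) ∧ (d.map Mass.prob).sum = 1

/-- `C` chooses one configuration (numbered from `0`) for every action. -/
def IsConfig (I : Inst) (C : List ℕ) : Prop :=
  List.Forall₂ (fun cfgs c => c < cfgs.length) I C

/-- The distributions `F_{1,C_1}, …, F_{n,C_n}` chosen by the configuration `C`. -/
def chosen (I : Inst) (C : List ℕ) : List Dist :=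
  List.zipWith (fun cfgs c => cfgs.getD c []) I C

/-- The expectation of `g (w₁, …, wₙ)`, where the `wᵢ` are drawn independently from the given
distributions: an iterated weighted sum. -/
def expect : List Dist → (List Mass → ℚ) → ℚ
  | [], g => g []
  | d :: ds, g => (d.map fun w => w.prob * expect ds fun ω => g (w :: ω)).sum

/-- The agent's utility from the favorite action: the maximum of the realized agent utilities. -/
def agentUtil (ω : List Mass) : WithBot ℚ := (ω.map Mass.uA).maximum

/-- The principal's utility from the agent's favorite action, where the agent breaks ties
in favor of the principal (principal utilities are nonnegative). -/
def principalUtil (ω : List Mass) : ℚ :=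
  ((ω.filter fun w => (w.uA : WithBot ℚ) = agentUtil ω).map Mass.uP).foldr max 0

/-- The principal's expected utility under the configuration `C`. -/
def value (I : Inst) (C : List ℕ) : ℚ := expect (chosen I C) principalUtil

/-- `C` is an optimal configuration. -/
def IsOptimal (I : Inst) (C : List ℕ) : Prop :=
  IsConfig I C ∧ ∀ C', IsConfig I C' → value I C' ≤ value I C

/-- `Pr[u^A ≤ U]` under the configuration `C`. -/
def cdf (I : Inst) (C : List ℕ) (U : ℚ) : ℚ :=
  expect (chosen I C) fun ω => if agentUtil ω ≤ (U : WithBot ℚ) then 1 else 0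

/-- `E[u^P | u^A ≤ U]` under the configuration `C` (meaningful when `Pr[u^A ≤ U] > 0`). -/
def condValue (I : Inst) (C : List ℕ) (U : ℚ) : ℚ :=
  expect (chosen I C) (fun ω => if agentUtil ω ≤ (U : WithBot ℚ) then principalUtil ω else 0) /
    cdf I C U

/-- `f(q)`-utility alignment: in an optimal configuration, for every threshold `U`, with
`q = Pr[u^A ≤ U] > 0`, one has `E[u^P | u^A ≤ U] ≤ f(q) E[u^P]`. If there are several optimal
configurations, it is enough that one of them has this property. -/
def Aligned (I : Inst) (f : ℝ → ℝ) : Prop :=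
  ∃ C, IsOptimal I C ∧ ∀ U : ℚ, 0 < cdf I C U →
    (condValue I C U : ℝ) ≤ f (cdf I C U : ℝ) * (value I C : ℝ)

/-- The approximation ratio with `M` bins and alignment coefficients `r_j`. -/
noncomputable def ratio (M : ℕ) (r : ℕ → ℝ) : ℝ :=
  ((M : ℝ) - 1) / ((M : ℝ) + 1) *
    (((M : ℝ) - 5) / ((M : ℝ) - 1) - 5 / 6 * (r 5 / ((M : ℝ) - 1)) -
      5 / ((M : ℝ) - 1) * ∑ j ∈ Finset.Icc 6 M, r j / ((j : ℝ) - 1))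

/-! ## The model of computation

A computation carries its result and the number of its elementary (bit) steps. Arithmetic on
rationals and naturals in binary notation is charged for by bit length (linearly for addition and
comparison of naturals, quadratically for the rest: schoolbook arithmetic, including reduction to
lowest terms). Every call of a recursive list procedure is charged one step, which pays for taking
apart or building one list cell, one pair, or one record. -/

/-- A result together with the number of steps used to compute it. -/
structure Cost (α : Type) where
  val : α
  steps : ℕ

/-- Running computations one after the other adds up their steps. -/
instance : Monad Cost where
  pure a := ⟨a, 0⟩
  bind x k := ⟨(k x.val).val, x.steps + (k x.val).steps⟩

/-- One elementary step. -/
def tick : Cost Unit := ⟨(), 1⟩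

/-- The bit length of a rational number, written as a reduced fraction in binary. -/
def bits (q : ℚ) : ℕ := Nat.size q.num.natAbs + Nat.size q.den

def addQ (a b : ℚ) : Cost ℚ := ⟨a + b, (bits a + bits b) ^ 2⟩
def subQ (a b : ℚ) : Cost ℚ := ⟨a - b, (bits a + bits b) ^ 2⟩
def mulQ (a b : ℚ) : Cost ℚ := ⟨a * b, (bits a + bits b) ^ 2⟩
/-- Division, with the convention `a / 0 = 0`. -/
def divQ (a b : ℚ) : Cost ℚ := ⟨a / b, (bits a + bits b) ^ 2⟩
def leQ (a b : ℚ) : Cost Bool := ⟨decide (a ≤ b), (bits a + bits b) ^ 2⟩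
def ltQ (a b : ℚ) : Cost Bool := ⟨decide (a < b), (bits a + bits b) ^ 2⟩
/-- Rounding a nonnegative rational down to a natural number. -/
def floorQ (a : ℚ) : Cost ℕ := ⟨⌊a⌋₊, bits a ^ 2⟩

def addN (a b : ℕ) : Cost ℕ := ⟨a + b, Nat.size a + Nat.size b + 1⟩
def mulN (a b : ℕ) : Cost ℕ := ⟨a * b, (Nat.size a + Nat.size b + 1) ^ 2⟩
def eqN (a b : ℕ) : Cost Bool := ⟨decide (a = b), Nat.size a + Nat.size b + 1⟩
def leN (a b : ℕ) : Cost Bool := ⟨decide (a ≤ b), Nat.size a + Nat.size b + 1⟩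

/-! List procedures. -/

section Lists

variable {α β : Type}

def mapC (f : α → Cost β) : List α → Cost (List β)
  | [] => do tick; pure []
  | a :: l => do
      tick
      let b ← f a
      let bs ← mapC f l
      pure (b :: bs)

def appendC : List α → List α → Cost (List α)
  | [], l => do tick; pure l
  | a :: k, l => do
      tick
      let m ← appendC k l
      pure (a :: m)

/-- Map and concatenate. -/
def bindC (f : α → Cost (List β)) : List α → Cost (List β)
  | [] => do tick; pure []
  | a :: l => do
      tick
      let b ← f a
      let bs ← bindC f l
      appendC b bs

def filterC (p : α → Cost Bool) : List α → Cost (List α)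
  | [] => do tick; pure []
  | a :: l => do
      tick
      let b ← p a
      let k ← filterC p l
      if b then pure (a :: k) else pure k

def lengthC : List α → Cost ℕ
  | [] => do tick; pure 0
  | _ :: l => do
      tick
      let k ← lengthC l
      addN k 1

/-- Map, where `f` also receives the position of the entry, counted from `i`. -/
def mapIdxC (f : ℕ → α → Cost β) : ℕ → List α → Cost (List β)
  | _, [] => do tick; pure []
  | i, a :: l => do
      tick
      let b ← f i a
      let i' ← addN i 1
      let bs ← mapIdxC f i' l
      pure (b :: bs)

/-- All lists of length `k` with entries from the given list. -/
def tuplesC (l : List α) : ℕ → Cost (List (List α))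
  | 0 => do tick; pure [[]]
  | k + 1 => do
      tick
      let ts ← tuplesC l k
      bindC (fun a => mapC (fun t => pure (a :: t)) ts) l

/-- The entry at a position, with a default. -/
def nthC (dflt : α) : List α → ℕ → Cost α
  | [], _ => do tick; pure dflt
  | a :: _, 0 => do tick; pure a
  | _ :: l, k + 1 => do
      tick
      nthC dflt l k

end Lists

/-- The list `N, N - 1, …, 0`. -/
def downFromC : ℕ → Cost (List ℕ)
  | 0 => do tick; pure [0]
  | N + 1 => do
      let k ← addN N 1
      let l ← downFromC N
      pure (k :: l)

/-- Componentwise sum. -/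
def addVecC : List ℕ → List ℕ → Cost (List ℕ)
  | a :: k, b :: l => do
      let c ← addN a b
      let m ← addVecC k l
      pure (c :: m)
  | _, _ => do tick; pure []

/-- Equality of vectors. -/
def eqVecC : List ℕ → List ℕ → Cost Bool
  | a :: k, b :: l => do
      let c ← eqN a b
      if c then eqVecC k l else pure false
  | [], [] => do tick; pure true
  | _, _ => do tick; pure false

/-- Is the list non-decreasing? -/
def sortedC : List ℚ → Cost Bool
  | [] => do tick; pure true
  | [_] => do tick; pure true
  | a :: b :: l => do
      let c ← leQ a b
      if c then sortedC (b :: l) else pure false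

/-- The sum of `g w` over the mass points `w` whose agent utility satisfies `p`. -/
def sumMassC (g : Mass → Cost ℚ) (p : ℚ → Cost Bool) : Dist → Cost ℚ
  | [] => do tick; pure 0
  | w :: d => do
      tick
      let s ← sumMassC g p d
      let b ← p w.uA
      if b then do
        let x ← g w
        addQ x s
      else pure s

/-! ## Preprocessing

`M` is a parameter of the program. Numbers that depend only on `M` and on a bin index
`j ∈ {1, …, M}` are constants of the program. -/

/-- A mass point with the numbers of the action and of the configuration it belongs to. -/
structure Tagged where
  act : ℕ
  conf : ℕ
  mass : Mass

/-- The list of all mass points of all configurations of all actions. -/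
def collect (I : Inst) : Cost (List Tagged) := do
  let perAction ← mapIdxC (fun i cfgs => do
    let perConf ← mapIdxC (fun j d => mapC (fun w => pure (Tagged.mk i j w)) d) 0 cfgs
    bindC pure perConf) 0 I
  bindC pure perAction

/-- Insertion into a list that is sorted by principal utility. -/
def insertByUP (t : Tagged) : List Tagged → Cost (List Tagged)
  | [] => do tick; pure [t]
  | s :: l => do
      tick
      let b ← leQ t.mass.uP s.mass.uP
      if b then pure (t :: s :: l) else do
        let k ← insertByUP t l
        pure (s :: k)

/-- Stable insertion sort, in non-decreasing order of the principal utility. -/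
def sortByUP : List Tagged → Cost (List Tagged)
  | [] => do tick; pure []
  | t :: l => do
      tick
      let k ← sortByUP l
      insertByUP t k

/-- The smaller of `v - u`, if this is positive, and the best gap so far. -/
def betterGap (u v : ℚ) (best : Option ℚ) : Cost (Option ℚ) := do
  let b ← ltQ u v
  if b then do
    let g ← subQ v u
    match best with
    | none => pure (some g)
    | some h => do
        let c ← leQ g h
        if c then pure (some g) else pure (some h)
  else pure best

def minGapFrom (u : ℚ) : List Tagged → Option ℚ → Cost (Option ℚ)
  | [], best => do tick; pure best
  | t :: l, best => do
      tick
      let best' ← betterGap u t.mass.uA best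
      minGapFrom u l best'

/-- The least positive difference `v - u` with `u` from the first and `v` from the second list
(`none` if there is none). -/
def minGap : List Tagged → List Tagged → Option ℚ → Cost (Option ℚ)
  | [], _, best => do tick; pure best
  | t :: k, l, best => do
      tick
      let best' ← minGapFrom t.mass.uA l best
      minGap k l best'

/-- The perturbation `δ = gap / (N (M² + 1))`, where `N` is the number of mass points and `gap` the
least distance of two different agent utilities (`1` if there are no two). Fewer than `N (M² + 1)`
multiples of `δ` are used, so that strict preferences of the agent are not changed. -/
def chooseDelta (M : ℕ) (L : List Tagged) : Cost ℚ := do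
  let gap ← minGap L L none
  let N ← lengthC L
  let D ← mulN N (M ^ 2 + 1)
  match gap with
  | none => divQ 1 D
  | some g => divQ g D

/-- One new mass point, with agent utility shifted by `δ ℓ` and probability `p`. -/
def emit (δ : ℚ) (t : Tagged) (ℓ : ℕ) (p : ℚ) : Cost Tagged := do
  let s ← mulQ δ ℓ
  let u ← addQ t.mass.uA s
  pure ⟨t.act, t.conf, ⟨u, t.mass.uP, p⟩⟩

/-- `k` new mass points of probability `1/M²`, followed by one that has the probability `rem`. The
shifts start at `δ ℓ`; the next unused `ℓ` is returned as well. -/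
def splitWhole (M : ℕ) (δ : ℚ) (t : Tagged) (rem : ℚ) : ℕ → ℕ → Cost (List Tagged × ℕ)
  | 0, ℓ => do
      tick
      let e ← emit δ t ℓ rem
      let ℓ' ← addN ℓ 1
      pure ([e], ℓ')
  | k + 1, ℓ => do
      tick
      let e ← emit δ t ℓ (1 / (M : ℚ) ^ 2)
      let ℓ' ← addN ℓ 1
      let r ← splitWhole M δ t rem k ℓ'
      pure (e :: r.1, r.2)

/-- Split every mass point `p` of the list into `⌊p M²⌋` pieces of size `1/M²` and a remainder, and
shift the agent utilities by `δ ℓ` with a new `ℓ` for every piece, starting from the given `ℓ`. -/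
def splitAll (M : ℕ) (δ : ℚ) : List Tagged → ℕ → Cost (List Tagged)
  | [], _ => do tick; pure []
  | t :: l, ℓ => do
      tick
      let x ← mulQ t.mass.prob ((M : ℚ) ^ 2)
      let k ← floorQ x
      let y ← mulQ k (1 / (M : ℚ) ^ 2)
      let rem ← subQ t.mass.prob y
      let r ← splitWhole M δ t rem k ℓ
      let rest ← splitAll M δ l r.2
      appendC r.1 rest

/-- The preprocessed instance: all mass points are sorted by principal utility, split into pieces
of probability at most `1/M²`, and given pairwise different agent utilities. -/
def preprocess (M : ℕ) (I : Inst) : Cost Inst := do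
  let L ← collect I
  let sorted ← sortByUP L
  let δ ← chooseDelta M L
  let pieces ← splitAll M δ sorted 0
  mapIdxC (fun i cfgs => mapIdxC (fun j _ => do
    let mine ← filterC (fun t => do
      let a ← eqN t.act i
      let b ← eqN t.conf j
      pure (a && b)) pieces
    mapC (fun t => pure t.mass) mine) 0 cfgs) 0 I

/-! ## Bins and estimates -/

/-- The bin `B_j`, where `j = idx`: `[lo, hi)`, or `[lo, hi]` if `last`; `lo = none` means `-∞`. -/
structure Bin where
  idx : ℕ
  lo : Option ℚ
  hi : ℚ
  last : Bool

/-- The bins `[û_{j-1}, û_j)` for `j < M` and `[û_{M-1}, û_M]` of a profile `û_1 ≤ … ≤ û_M`; start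
with `j = 1` and `û_0 = -∞`. -/
def mkBins : ℕ → Option ℚ → List ℚ → Cost (List Bin)
  | _, _, [] => do tick; pure []
  | j, lo, [u] => do tick; pure [⟨j, lo, u, true⟩]
  | j, lo, u :: v :: us => do
      tick
      let j' ← addN j 1
      let bs ← mkBins j' (some u) (v :: us)
      pure (⟨j, lo, u, false⟩ :: bs)

/-- `u ∈ B_{≤ j}`, the union of the first `j` bins. -/
def Bin.memCum (b : Bin) (u : ℚ) : Cost Bool :=
  if b.last then leQ u b.hi else ltQ u b.hi

/-- `u ∈ B_j`. -/
def Bin.mem (b : Bin) (u : ℚ) : Cost Bool :=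
  match b.lo with
  | none => b.memCum u
  | some l => do
      let c ← leQ l u
      if c then b.memCum u else pure false

/-- `q_{ij}^≤ = Pr[u_i^A ∈ B_j | u_i^A ∈ B_{≤ j}]` (`0` if `Pr[u_i^A ∈ B_{≤ j}] = 0`). -/
def condProb (d : Dist) (b : Bin) : Cost ℚ := do
  let x ← sumMassC (fun w => pure w.prob) b.mem d
  let y ← sumMassC (fun w => pure w.prob) b.memCum d
  divQ x y

/-- `E[u_i^P | u_i^A ∈ B_j] Pr[u_i^A ∈ B_j | u_i^A ∈ B_{≤ j}]`, which is
`E[u_i^P 1(u_i^A ∈ B_j)] / Pr[u_i^A ∈ B_{≤ j}]` (`0` if `Pr[u_i^A ∈ B_{≤ j}] = 0`). -/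
def condUtil (d : Dist) (b : Bin) : Cost ℚ := do
  let x ← sumMassC (fun w => mulQ w.prob w.uP) b.mem d
  let y ← sumMassC (fun w => pure w.prob) b.memCum d
  divQ x y

/-- The weight `c_j` of bin `j ≥ 6` in the objective. -/
def weight (M j : ℕ) : ℚ := ((j : ℚ) - 5) / ((M : ℚ) - 1)

/-- The contribution `ψ_i = ∑_{j ≥ 6} c_j E[u_i^P | B_j] Pr[B_j | B_{≤ j}]` of one action. -/
def psi (M : ℕ) (d : Dist) : List Bin → Cost ℚ
  | [] => do tick; pure 0
  | b :: bs => do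
      tick
      let s ← psi M d bs
      let large ← leN 6 b.idx
      if large then do
        let u ← condUtil d b
        let x ← mulQ (weight M b.idx) u
        addQ x s
      else pure s

/-- `⌊q_{ij}^≤ D⌋`, with `D = M² n`, for all bins: the rounded probability, in multiples of
`1/D`. -/
def counts (D : ℕ) (d : Dist) (bins : List Bin) : Cost (List ℕ) :=
  mapC (fun b => do
    let q ← condProb d b
    let x ← mulQ q D
    floorQ x) bins

/-- For one configuration of one action: its contribution to the objective and to the rounded
additive estimates of the bin probabilities. -/
def stat (M D : ℕ) (bins : List Bin) (d : Dist) : Cost (ℚ × List ℕ) := do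
  let x ← psi M d bins
  let ks ← counts D d bins
  pure (x, ks)

/-- The least admissible rounded estimate for bin `j`. -/
def lowerBound (M j : ℕ) : ℚ := (1 - 1 / (M : ℚ)) / (j : ℚ) - 1 / (M : ℚ) ^ 2

/-- The largest admissible rounded estimate for bin `j ≥ 2` (there is none for `j = 1`). -/
def upperBound (M j : ℕ) : ℚ := (1 + 1 / (M : ℚ)) / ((j : ℚ) - 1)

/-- Do the rounded additive estimates `k_j / D` satisfy the constraints of the program? -/
def feasible (M D : ℕ) : List Bin → List ℕ → Cost Bool
  | b :: bs, k :: ks => do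
      tick
      let x ← divQ k D
      let low ← leQ (lowerBound M b.idx) x
      let first ← leN b.idx 1
      let high ← if first then pure true else leQ x (upperBound M b.idx)
      if low && high then feasible M D bs ks else pure false
  | _, _ => do tick; pure true

/-! ## The dynamic program -/

/-- The memo table of one stage: for each vector `k`, the best value that the remaining actions can
contribute and configurations that attain it, or `none` (value `-∞`). -/
abbrev Table := List (List ℕ × Option (ℚ × List ℕ))

def lookup (k : List ℕ) : Table → Cost (Option (ℚ × List ℕ))
  | [] => do tick; pure none
  | e :: T => do
      tick
      let b ← eqVecC k e.1
      if b then pure e.2 else lookup k T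

/-- The recurrence `OPT(i, k) = max_c (ψ_i(c) + OPT(i + 1, k + k^{i,c}))`, over the configurations
from number `c` on. -/
def bestChoice (T : Table) (k : List ℕ) :
    ℕ → List (ℚ × List ℕ) → Cost (Option (ℚ × List ℕ))
  | _, [] => do tick; pure none
  | c, s :: ss => do
      tick
      let c' ← addN c 1
      let other ← bestChoice T k c' ss
      let k' ← addVecC k s.2
      let e ← lookup k' T
      match e with
      | none => pure other
      | some (v, C) => do
          let v' ← addQ s.1 v
          match other with
          | none => pure (some (v', c :: C))
          | some (x, X) => do
              let b ← leQ x v'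
              if b then pure (some (v', c :: C)) else pure (some (x, X))

/-- The memo table for the remaining actions, filled from the last action to the first. -/
def table (M D : ℕ) (bins : List Bin) (keys : List (List ℕ)) :
    List (List (ℚ × List ℕ)) → Cost Table
  | [] => do
      tick
      mapC (fun k => do
        let b ← feasible M D bins k
        if b then pure (k, some (0, [])) else pure (k, none)) keys
  | s :: ss => do
      tick
      let T ← table M D bins keys ss
      mapC (fun k => do
        let e ← bestChoice T k 0 s
        pure (k, e)) keys

/-- A configuration that maximizes the approximate objective subject to the constraints on the
rounded estimates, for the given bins; `none` if there is no feasible one. -/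
def solve (M n : ℕ) (keys : List (List ℕ)) (I : Inst) (bins : List Bin) :
    Cost (Option (List ℕ)) := do
  let D ← mulN (M ^ 2) n
  let stats ← mapC (mapC (stat M D bins)) I
  let T ← table M D bins keys stats
  let zero ← mapC (fun _ => pure 0) bins
  let e ← lookup zero T
  match e with
  | none => pure none
  | some (_, C) => pure (some C)

/-! ## The true expected utility of a configuration -/

def chosenC : Inst → List ℕ → Cost (List Dist)
  | cfgs :: I, c :: C => do
      tick
      let d ← nthC [] cfgs c
      let ds ← chosenC I C
      pure (d :: ds)
  | _, _ => do tick; pure []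

/-- Every mass point `w` of `d`, with its probability multiplied by the probability that the agent
utility drawn from `e` is less than that of `w`. -/
def restrict (d e : Dist) : Cost Dist :=
  mapC (fun w => do
    let s ← sumMassC (fun v => pure v.prob) (fun u => ltQ u w.uA) e
    let p ← mulQ w.prob s
    pure ⟨w.uA, w.uP, p⟩) d

/-- The distribution of the favorite of the actions seen so far, updated by one more action
(agent utilities are pairwise different). -/
def combine (acc d : Dist) : Cost Dist := do
  let x ← restrict acc d
  let y ← restrict d acc
  appendC x y

def favorite : Dist → List Dist → Cost Dist
  | acc, [] => do tick; pure acc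
  | acc, d :: ds => do
      tick
      let acc' ← combine acc d
      favorite acc' ds

/-- The principal's expected utility, through the distribution of the agent's favorite among the
first `1, 2, …, n` actions. -/
def evaluate (ds : List Dist) : Cost ℚ :=
  match ds with
  | [] => do tick; pure 0
  | d :: ds => do
      let acc ← favorite d ds
      sumMassC (fun w => mulQ w.prob w.uP) (fun _ => pure true) acc

/-! ## The main loop -/

/-- Try all the given profiles of bin boundaries, and keep the configuration with the largest true
expected principal utility. -/
def mainLoop (M n : ℕ) (keys : List (List ℕ)) (I : Inst) :
    List (List ℚ) → Option (ℚ × List ℕ) → Cost (Option (ℚ × List ℕ))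
  | [], best => do tick; pure best
  | u :: us, best => do
      tick
      let s ← sortedC u
      if s then do
        let bins ← mkBins 1 none u
        let sol ← solve M n keys I bins
        match sol with
        | none => mainLoop M n keys I us best
        | some C => do
            let ds ← chosenC I C
            let v ← evaluate ds
            match best with
            | none => mainLoop M n keys I us (some (v, C))
            | some (x, X) => do
                let b ← leQ x v
                if b then mainLoop M n keys I us (some (v, C))
                else mainLoop M n keys I us (some (x, X))
      else mainLoop M n keys I us best

/-- The approximation scheme with `M` bins: preprocess, list the agent utilities, guess the bin
boundaries `û_1 ≤ … ≤ û_M` among them in all ways, solve the dynamic program for each guess, and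
return the best configuration found (configuration `0` of every action if there is none). The
dynamic program uses the vectors with entries in `{0, …, M² n · n}`. -/
def scheme (M : ℕ) (I : Inst) : Cost (List ℕ) := do
  let J ← preprocess M I
  let n ← lengthC J
  let D ← mulN (M ^ 2) n
  let N ← mulN D n
  let entries ← downFromC N
  let keys ← tuplesC entries M
  let utilities ← bindC (fun cfgs => bindC (fun d => mapC (fun w => pure w.uA) d) cfgs) J
  let profiles ← tuplesC utilities M
  let best ← mainLoop M n keys J profiles none
  match best with
  | none => mapC (fun _ => pure 0) J
  | some (_, C) => pure C

/-- The instance has `n` actions, at most `m` configurations per action, at most `K` mass points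
per distribution, and all its numbers have at most `b` bits. -/
def SizeBound (I : Inst) (n m K b : ℕ) : Prop :=
  I.length = n ∧ ∀ cfgs ∈ I, cfgs.length ≤ m ∧ ∀ d ∈ cfgs, d.length ≤ K ∧
    ∀ w ∈ d, bits w.uA ≤ b ∧ bits w.uP ≤ b ∧ bits w.prob ≤ b

end UC

/-!
The preprocessing does not change the value of a configuration (`Valid.value_preprocess`): the
perturbation is too small to reverse a strict preference of the agent, and it breaks ties in favor of
larger principal utilities. Afterwards agent utilities are pairwise different and every mass is at most
`1/M²` (`Separated`), so the distribution function of the agent's utility has jumps of at most `1/M²`,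
and there is a profile `û` for which `Q_j = Pr[u^A ∈ B_{≤ j}]` of an optimal configuration lies between
`j/M` and `j/M + 1/M²` (`Separated.exists_profile`).

Let `V_j = E[u^P 1(u^A ∈ B_{≤ j})]`, and let `S_j` be the sum over the actions of
`E[u_i^P 1(u_i^A ∈ B_j)] / Pr[u_i^A ∈ B_{≤ j}]`. The favorite action lies in `B_j` if exactly one action
does and the others lie below, and its utility is at most the sum of the utilities of all actions in
`B_j`. Hence `S_j Q_{j-1} ≤ V_j - V_{j-1} ≤ S_j Q_j` (`condUtilSum_mul_le`, `le_condUtilSum_mul`). The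
objective of the dynamic program is `∑ (j - 5)/(M - 1) S_j`. In the same way, the sum `s_j` of the
conditional probabilities `q_{ij}` satisfies `(1 - s_j) Q_j ≤ Q_{j-1}` and `(1 + s_j) Q_{j-1} ≤ Q_j`.

* The optimal configuration therefore meets the constraints of the program for the profile of its
  quantiles (`meets_of_quantiles`), so the solution found for this profile has at least its objective.
* For every configuration that meets the constraints, going down from `Q_M = 1` gives
  `Q_{j-1} ≥ (j - 5)/(M - 4)` (`prAll_cum_ge`), so that its value is at least `(M - 1)/(M - 4)` times
  its objective (`totalObjective_mul_le`).
* The objective of the optimal configuration is at least `∑ (j - 5)/(M - 1) (V_j - V_{j-1}) / Q_j`.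
  Here `Q_j ≤ j (M + 1)/M²`, summation by parts leaves negative multiples of the `V_j` with `j < M`,
  and these are bounded by alignment, `V_j ≤ r_j Q_j V_M` (`weighted_sum_ge`, `totalObjective_ge`).

That the scheme computes what it should is shown by `solve_optimal` for the dynamic program, by
`Separated.evaluate_val` for the evaluation through the distribution of the favorite, and by
`scheme_spec` for the main loop.

For the number of steps, all quantities are bounded by functions `PolyB` of one size parameter, a
class that is closed under sums, products and composition. The bit lengths of intermediate numbers have
to be bounded as well; sums of many rationals stay short because they have a common denominator of
polynomial length (`bits_sum_le`, and `OnGrid` for the repeated products in the evaluation).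
-/

namespace UC


/-! ### Values and step counts of the elementary procedures -/

section Costs

variable {α β : Type}

@[simp] theorem Cost.pure_val (a : α) : (pure a : Cost α).val = a := rfl
@[simp] theorem Cost.pure_steps (a : α) : (pure a : Cost α).steps = 0 := rfl
@[simp] theorem Cost.bind_val (x : Cost α) (k : α → Cost β) :
    (x >>= k).val = (k x.val).val := rfl
@[simp] theorem Cost.bind_steps (x : Cost α) (k : α → Cost β) :
    (x >>= k).steps = x.steps + (k x.val).steps := rfl
@[simp] theorem Cost.ite_val (p : Prop) [Decidable p] (x y : Cost α) :
    (if p then x else y).val = if p then x.val else y.val := by split <;> rfl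
@[simp] theorem Cost.ite_steps (p : Prop) [Decidable p] (x y : Cost α) :
    (if p then x else y).steps = if p then x.steps else y.steps := by split <;> rfl

@[simp] theorem tick_val : tick.val = () := rfl
@[simp] theorem tick_steps : tick.steps = 1 := rfl
@[simp] theorem addQ_val (a b : ℚ) : (addQ a b).val = a + b := rfl
@[simp] theorem subQ_val (a b : ℚ) : (subQ a b).val = a - b := rfl
@[simp] theorem mulQ_val (a b : ℚ) : (mulQ a b).val = a * b := rfl
@[simp] theorem divQ_val (a b : ℚ) : (divQ a b).val = a / b := rfl
@[simp] theorem leQ_val (a b : ℚ) : (leQ a b).val = decide (a ≤ b) := rfl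
@[simp] theorem ltQ_val (a b : ℚ) : (ltQ a b).val = decide (a < b) := rfl
@[simp] theorem floorQ_val (a : ℚ) : (floorQ a).val = ⌊a⌋₊ := rfl
@[simp] theorem addN_val (a b : ℕ) : (addN a b).val = a + b := rfl
@[simp] theorem mulN_val (a b : ℕ) : (mulN a b).val = a * b := rfl
@[simp] theorem eqN_val (a b : ℕ) : (eqN a b).val = decide (a = b) := rfl
@[simp] theorem leN_val (a b : ℕ) : (leN a b).val = decide (a ≤ b) := rfl
@[simp] theorem addQ_steps (a b : ℚ) : (addQ a b).steps = (bits a + bits b) ^ 2 := rfl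
@[simp] theorem subQ_steps (a b : ℚ) : (subQ a b).steps = (bits a + bits b) ^ 2 := rfl
@[simp] theorem mulQ_steps (a b : ℚ) : (mulQ a b).steps = (bits a + bits b) ^ 2 := rfl
@[simp] theorem divQ_steps (a b : ℚ) : (divQ a b).steps = (bits a + bits b) ^ 2 := rfl
@[simp] theorem leQ_steps (a b : ℚ) : (leQ a b).steps = (bits a + bits b) ^ 2 := rfl
@[simp] theorem ltQ_steps (a b : ℚ) : (ltQ a b).steps = (bits a + bits b) ^ 2 := rfl
@[simp] theorem floorQ_steps (a : ℚ) : (floorQ a).steps = bits a ^ 2 := rfl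
@[simp] theorem addN_steps (a b : ℕ) : (addN a b).steps = Nat.size a + Nat.size b + 1 := rfl
@[simp] theorem mulN_steps (a b : ℕ) : (mulN a b).steps = (Nat.size a + Nat.size b + 1) ^ 2 := rfl
@[simp] theorem eqN_steps (a b : ℕ) : (eqN a b).steps = Nat.size a + Nat.size b + 1 := rfl
@[simp] theorem leN_steps (a b : ℕ) : (leN a b).steps = Nat.size a + Nat.size b + 1 := rfl

@[simp] theorem mapC_val (f : α → Cost β) (l : List α) :
    (mapC f l).val = l.map fun a => (f a).val := by
  induction l <;> simp_all [mapC]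

@[simp] theorem appendC_val (k l : List α) : (appendC k l).val = k ++ l := by
  induction k <;> simp_all [appendC]

@[simp] theorem bindC_val (f : α → Cost (List β)) (l : List α) :
    (bindC f l).val = l.flatMap fun a => (f a).val := by
  induction l <;> simp_all [bindC]

@[simp] theorem filterC_val (p : α → Cost Bool) (l : List α) :
    (filterC p l).val = l.filter fun a => (p a).val := by
  induction l with
  | nil => simp [filterC]
  | cons a l ih => by_cases h : (p a).val <;> simp [filterC, ih, h]

@[simp] theorem lengthC_val (l : List α) : (lengthC l).val = l.length := by
  induction l <;> simp_all [lengthC]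

@[simp] theorem mapIdxC_val (f : ℕ → α → Cost β) (i : ℕ) (l : List α) :
    (mapIdxC f i l).val = l.mapIdx fun k a => (f (i + k) a).val := by
  induction l generalizing i with
  | nil => simp [mapIdxC]
  | cons a l ih =>
    simp [mapIdxC, ih, List.mapIdx_cons, Nat.add_assoc, Nat.add_comm 1]

theorem mem_tuplesC {l : List α} {k : ℕ} {t : List α} :
    t ∈ (tuplesC l k).val ↔ t.length = k ∧ ∀ x ∈ t, x ∈ l := by
  induction k generalizing t with
  | zero => simp +contextual [tuplesC]
  | succ k ih =>
    cases t with
    | nil => simp [tuplesC]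
    | cons a t => simp [tuplesC, ih]; tauto

@[simp] theorem nthC_val (dflt : α) (l : List α) (k : ℕ) :
    (nthC dflt l k).val = l.getD k dflt := by
  induction l generalizing k with
  | nil => simp [nthC]
  | cons a l ih => cases k <;> simp [nthC, ih]

end Costs

@[simp] theorem mem_downFromC {N k : ℕ} : k ∈ (downFromC N).val ↔ k ≤ N := by
  induction N with
  | zero => simp [downFromC]
  | succ N ih => simp [downFromC, ih]; omega

@[simp] theorem addVecC_val (k l : List ℕ) : (addVecC k l).val = List.zipWith (· + ·) k l := by
  induction k generalizing l with
  | nil => simp [addVecC]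
  | cons a k ih => cases l <;> simp [addVecC, ih]

@[simp] theorem eqVecC_val (k l : List ℕ) : (eqVecC k l).val = decide (k = l) := by
  induction k generalizing l with
  | nil => cases l <;> simp [eqVecC]
  | cons a k ih =>
    cases l with
    | nil => simp [eqVecC]
    | cons b l => by_cases h : a = b <;> simp [eqVecC, ih, h]

theorem sortedC_val (l : List ℚ) (h : l.Pairwise (· ≤ ·)) : (sortedC l).val = true := by
  induction l with
  | nil => simp [sortedC]
  | cons a l ih =>
    cases l with
    | nil => simp [sortedC]
    | cons b l =>
      have h' := List.pairwise_cons.1 h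
      simp [sortedC, ih h'.2, h'.1 b (by simp)]

/-! ### Weighted sums and expectations -/

/-- The number `1` for a true and `0` for a false statement. -/
def ind (b : Bool) : ℚ := if b then 1 else 0

@[simp] theorem ind_true : ind true = 1 := rfl
@[simp] theorem ind_false : ind false = 0 := rfl
theorem ind_nonneg (b : Bool) : 0 ≤ ind b := by cases b <;> simp
theorem ind_le_one (b : Bool) : ind b ≤ 1 := by cases b <;> simp
theorem ind_and (a b : Bool) : ind (a && b) = ind a * ind b := by cases a <;> simp

/-- The expectation of `h w` for `w` drawn from the single distribution `d`. -/
def avg (d : Dist) (h : Mass → ℚ) : ℚ := (d.map fun w => w.prob * h w).sum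

@[simp] theorem avg_nil (h : Mass → ℚ) : avg [] h = 0 := rfl
@[simp] theorem avg_cons (w : Mass) (d : Dist) (h : Mass → ℚ) :
    avg (w :: d) h = w.prob * h w + avg d h := by simp [avg]
@[simp] theorem avg_append (d e : Dist) (h : Mass → ℚ) :
    avg (d ++ e) h = avg d h + avg e h := by simp [avg]

theorem sumMassC_val (g : Mass → Cost ℚ) (p : ℚ → Cost Bool) (d : Dist) :
    (sumMassC g p d).val = (d.map fun w => ind (p w.uA).val * (g w).val).sum := by
  induction d with
  | nil => simp [sumMassC]
  | cons w d ih => by_cases h : (p w.uA).val <;> simp [sumMassC, ih, h]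

theorem sumMassC_prob (p : ℚ → Cost Bool) (d : Dist) :
    (sumMassC (fun w => pure w.prob) p d).val = avg d fun w => ind (p w.uA).val := by
  simp [sumMassC_val, avg, mul_comm]

theorem sumMassC_prob_mul (p : ℚ → Cost Bool) (d : Dist) :
    (sumMassC (fun w => mulQ w.prob w.uP) p d).val = avg d fun w => ind (p w.uA).val * w.uP := by
  simp only [sumMassC_val, avg, mulQ_val]
  congr 2; funext w; ring

theorem avg_congr {d : Dist} {g h : Mass → ℚ} (H : ∀ w ∈ d, g w = h w) : avg d g = avg d h := by
  unfold avg; congr 1; exact List.map_congr_left fun w hw => by rw [H w hw]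

theorem avg_add (d : Dist) (g h : Mass → ℚ) : avg d (fun w => g w + h w) = avg d g + avg d h := by
  induction d with
  | nil => simp
  | cons w d ih => simp [ih]; ring

theorem avg_sub (d : Dist) (g h : Mass → ℚ) : avg d (fun w => g w - h w) = avg d g - avg d h := by
  induction d with
  | nil => simp
  | cons w d ih => simp [ih]; ring

theorem avg_mul_right (d : Dist) (a : ℚ) (h : Mass → ℚ) :
    avg d (fun w => h w * a) = avg d h * a := by
  induction d with
  | nil => simp
  | cons w d ih => simp [ih]; ring

theorem avg_mul_left (d : Dist) (a : ℚ) (h : Mass → ℚ) :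
    avg d (fun w => a * h w) = a * avg d h := by
  induction d with
  | nil => simp
  | cons w d ih => simp [ih]; ring

@[simp] theorem avg_zero (d : Dist) : avg d (fun _ => 0) = 0 := by
  induction d with
  | nil => simp
  | cons w d ih => simp [ih]

/-- `d` is a probability distribution (masses of probability zero are allowed) with nonnegative
principal utilities. -/
structure IsProb (d : Dist) : Prop where
  prob_nonneg : ∀ w ∈ d, 0 ≤ w.prob
  uP_nonneg : ∀ w ∈ d, 0 ≤ w.uP
  sum_eq : avg d (fun _ => 1) = 1

theorem avg_mono {d : Dist} {g h : Mass → ℚ} (hd : ∀ w ∈ d, 0 ≤ w.prob)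
    (H : ∀ w ∈ d, g w ≤ h w) : avg d g ≤ avg d h := by
  unfold avg
  exact List.sum_le_sum fun w hw => mul_le_mul_of_nonneg_left (H w hw) (hd w hw)

theorem avg_nonneg {d : Dist} {h : Mass → ℚ} (hd : ∀ w ∈ d, 0 ≤ w.prob)
    (H : ∀ w ∈ d, 0 ≤ h w) : 0 ≤ avg d h := by
  simpa using avg_mono (g := fun _ => 0) hd H

theorem expect_cons (d : Dist) (ds : List Dist) (g : List Mass → ℚ) :
    expect (d :: ds) g = avg d fun w => expect ds fun ω => g (w :: ω) := rfl

@[simp] theorem expect_nil (g : List Mass → ℚ) : expect [] g = g [] := rfl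

/-- `ω` is a list of mass points that can be drawn from the distributions `ds`. -/
def Draw (ds : List Dist) (ω : List Mass) : Prop := List.Forall₂ (fun d w => w ∈ d) ds ω

theorem Draw.cons {d : Dist} {ds : List Dist} {w : Mass} {ω : List Mass} (hw : w ∈ d)
    (h : Draw ds ω) : Draw (d :: ds) (w :: ω) := List.Forall₂.cons hw h

theorem Draw.exists_mem {ds : List Dist} {ω : List Mass} (h : Draw ds ω) :
    ∀ w ∈ ω, ∃ d ∈ ds, w ∈ d := by
  induction h with
  | nil => simp
  | cons hw _ ih =>
    intro v hv
    rcases List.mem_cons.1 hv with rfl | hv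
    · exact ⟨_, by simp, hw⟩
    · obtain ⟨e, he, hve⟩ := ih v hv
      exact ⟨e, by simp [he], hve⟩

theorem expect_congr {ds : List Dist} {g h : List Mass → ℚ} (H : ∀ ω, Draw ds ω → g ω = h ω) :
    expect ds g = expect ds h := by
  induction ds generalizing g h with
  | nil => exact H [] .nil
  | cons d ds ih =>
    simp only [expect_cons]
    exact avg_congr fun w hw => ih fun ω hω => H _ (hω.cons hw)

theorem expect_mono {ds : List Dist} {g h : List Mass → ℚ}
    (hds : ∀ d ∈ ds, ∀ w ∈ d, 0 ≤ w.prob) (H : ∀ ω, Draw ds ω → g ω ≤ h ω) :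
    expect ds g ≤ expect ds h := by
  induction ds generalizing g h with
  | nil => exact H [] .nil
  | cons d ds ih =>
    simp only [expect_cons]
    exact avg_mono (hds d (by simp)) fun w hw =>
      ih (fun e he => hds e (by simp [he])) fun ω hω => H _ (hω.cons hw)

theorem expect_mul_left (ds : List Dist) (a : ℚ) (g : List Mass → ℚ) :
    expect ds (fun ω => a * g ω) = a * expect ds g := by
  induction ds generalizing g with
  | nil => rfl
  | cons d ds ih => simp [expect_cons, ih, avg_mul_left]

theorem expect_add (ds : List Dist) (g h : List Mass → ℚ) :
    expect ds (fun ω => g ω + h ω) = expect ds g + expect ds h := by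
  induction ds generalizing g h with
  | nil => rfl
  | cons d ds ih => simp [expect_cons, ih, avg_add]

theorem expect_sub (ds : List Dist) (g h : List Mass → ℚ) :
    expect ds (fun ω => g ω - h ω) = expect ds g - expect ds h := by
  induction ds generalizing g h with
  | nil => rfl
  | cons d ds ih => simp [expect_cons, ih, avg_sub]

@[simp] theorem expect_zero (ds : List Dist) : expect ds (fun _ => 0) = 0 := by
  induction ds with
  | nil => rfl
  | cons d ds ih => simp [expect_cons, ih]

theorem expect_nonneg {ds : List Dist} {g : List Mass → ℚ}
    (hds : ∀ d ∈ ds, ∀ w ∈ d, 0 ≤ w.prob) (H : ∀ ω, Draw ds ω → 0 ≤ g ω) : 0 ≤ expect ds g := by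
  simpa using expect_mono (g := fun _ => 0) hds H

/-- `Pr[u^A ∈ P]` for one action with distribution `d`. -/
def pr (d : Dist) (P : ℚ → Bool) : ℚ := avg d fun w => ind (P w.uA)

/-- `∏ᵢ Pr[uᵢ^A ∈ P]`, the probability that all agent utilities lie in `P`. -/
def prAll (ds : List Dist) (P : ℚ → Bool) : ℚ := (ds.map fun d => pr d P).prod

@[simp] theorem prAll_nil (P : ℚ → Bool) : prAll [] P = 1 := rfl
@[simp] theorem prAll_cons (d : Dist) (ds : List Dist) (P : ℚ → Bool) :
    prAll (d :: ds) P = pr d P * prAll ds P := by simp [prAll]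

/-- All agent utilities of the draw `ω` lie in `P`. -/
def allIn (P : ℚ → Bool) (ω : List Mass) : Bool := ω.all fun w => P w.uA

@[simp] theorem allIn_nil (P : ℚ → Bool) : allIn P [] = true := rfl
@[simp] theorem allIn_cons (P : ℚ → Bool) (w : Mass) (ω : List Mass) :
    allIn P (w :: ω) = (P w.uA && allIn P ω) := by simp [allIn]
theorem allIn_eq_true {P : ℚ → Bool} {ω : List Mass} :
    allIn P ω = true ↔ ∀ w ∈ ω, P w.uA = true := by simp [allIn]

theorem expect_allIn (ds : List Dist) (P : ℚ → Bool) :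
    expect ds (fun ω => ind (allIn P ω)) = prAll ds P := by
  induction ds with
  | nil => simp
  | cons d ds ih =>
    simp only [expect_cons, allIn_cons, ind_and, expect_mul_left, ih, avg_mul_right, prAll_cons, pr]

theorem pr_nonneg {d : Dist} (hd : IsProb d) (P : ℚ → Bool) : 0 ≤ pr d P :=
  avg_nonneg hd.prob_nonneg fun _ _ => ind_nonneg _

theorem pr_mono {d : Dist} (hd : IsProb d) {P R : ℚ → Bool}
    (h : ∀ w ∈ d, P w.uA = true → R w.uA = true) : pr d P ≤ pr d R :=
  avg_mono hd.prob_nonneg fun w hw => by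
    have := h w hw
    cases hP : P w.uA
    · simpa using ind_nonneg _
    · simp [this hP]

theorem pr_le_one {d : Dist} (hd : IsProb d) (P : ℚ → Bool) : pr d P ≤ 1 := by
  rw [← hd.sum_eq]; exact avg_mono hd.prob_nonneg fun _ _ => ind_le_one _

theorem prAll_nonneg {ds : List Dist} (hds : ∀ d ∈ ds, IsProb d) (P : ℚ → Bool) :
    0 ≤ prAll ds P := by
  refine List.prod_nonneg fun x hx => ?_
  obtain ⟨d, hd, rfl⟩ := List.mem_map.1 hx
  exact pr_nonneg (hds d hd) P

theorem prAll_le_one {ds : List Dist} (hds : ∀ d ∈ ds, IsProb d) (P : ℚ → Bool) :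
    prAll ds P ≤ 1 := by
  induction ds with
  | nil => simp
  | cons d ds ih =>
    simp only [prAll_cons]
    exact mul_le_one₀ (pr_le_one (hds d (by simp)) P)
      (prAll_nonneg (fun e he => hds e (by simp [he])) _)
      (ih fun e he => hds e (by simp [he]))

/-! ### The favorite action -/

theorem agentUtil_le {ω : List Mass} {U : ℚ} :
    agentUtil ω ≤ (U : WithBot ℚ) ↔ ∀ w ∈ ω, w.uA ≤ U := by
  refine ⟨fun h w hw => ?_, fun h => List.maximum_le_of_forall_le fun u hu => ?_⟩
  · exact WithBot.coe_le_coe.1 ((List.le_maximum_of_mem' (List.mem_map_of_mem hw)).trans h)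
  · obtain ⟨w, hw, rfl⟩ := List.mem_map.1 hu
    exact WithBot.coe_le_coe.2 (h w hw)

theorem uA_eq_agentUtil {ω : List Mass} {w : Mass} (hw : w ∈ ω) :
    (w.uA : WithBot ℚ) = agentUtil ω ↔ ∀ v ∈ ω, v.uA ≤ w.uA := by
  rw [← agentUtil_le]
  have h : (w.uA : WithBot ℚ) ≤ agentUtil ω :=
    List.le_maximum_of_mem' (List.mem_map.2 ⟨w, hw, rfl⟩)
  exact ⟨fun h => h.ge, fun h' => le_antisymm h h'⟩

theorem foldr_max_le {l : List ℚ} {x : ℚ} : l.foldr max 0 ≤ x ↔ 0 ≤ x ∧ ∀ y ∈ l, y ≤ x := by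
  induction l with
  | nil => simp
  | cons a l ih => simp [ih]; tauto

theorem principalUtil_le_iff {ω : List Mass} {x : ℚ} :
    principalUtil ω ≤ x ↔ 0 ≤ x ∧ ∀ w ∈ ω, (∀ v ∈ ω, v.uA ≤ w.uA) → w.uP ≤ x := by
  unfold principalUtil
  rw [foldr_max_le]
  refine and_congr_right fun _ => ⟨fun H w hw h => H _ ?_, fun H y hy => ?_⟩
  · refine List.mem_map.2 ⟨w, List.mem_filter.2 ⟨hw, ?_⟩, rfl⟩
    simpa using (uA_eq_agentUtil hw).2 h
  · obtain ⟨w, hw, rfl⟩ := List.mem_map.1 hy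
    obtain ⟨hw, h⟩ := List.mem_filter.1 hw
    exact H w hw ((uA_eq_agentUtil hw).1 (by simpa using h))

theorem principalUtil_nonneg (ω : List Mass) : 0 ≤ principalUtil ω :=
  (principalUtil_le_iff.1 le_rfl).1

theorem le_principalUtil {ω : List Mass} {w : Mass} (hw : w ∈ ω) (h : ∀ v ∈ ω, v.uA ≤ w.uA) :
    w.uP ≤ principalUtil ω := (principalUtil_le_iff.1 le_rfl).2 w hw h

theorem exists_favorite {ω : List Mass} (h : ω ≠ []) : ∃ w ∈ ω, ∀ v ∈ ω, v.uA ≤ w.uA := by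
  induction ω with
  | nil => exact absurd rfl h
  | cons a ω ih =>
    by_cases h0 : ω = []
    · exact ⟨a, by simp, by simp [h0]⟩
    · obtain ⟨w, hw, H⟩ := ih h0
      rcases le_total a.uA w.uA with h1 | h1
      · exact ⟨w, by simp [hw], by simpa using ⟨h1, H⟩⟩
      · exact ⟨a, by simp, by simpa using fun v hv => (H v hv).trans h1⟩


/-! ### The principal's utility from one bin of agent utilities -/

/-- `P` describes a set of agent utilities that is closed downwards. -/
def Down (P : ℚ → Bool) : Prop := ∀ u v, u ≤ v → P v = true → P u = true

/-- Membership in the bin `R \ P` between two sets of agent utilities. -/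
def between (P R : ℚ → Bool) (u : ℚ) : Bool := R u && !P u

/-- `E[u^P 1(u^A ∈ R \ P)]` for one action. -/
def binUtil (d : Dist) (P R : ℚ → Bool) : ℚ := avg d fun w => ind (between P R w.uA) * w.uP

/-- `E[u^P 1(u^A ∈ R)]` for the agent's favorite action. -/
def restrictedValue (ds : List Dist) (R : ℚ → Bool) : ℚ :=
  expect ds fun ω => ind (allIn R ω) * principalUtil ω

/-- The sum of the principal's utilities over the actions in the bin `R \ P` all of whose competitors
lie in `P`. -/
def soloUtil (P R : ℚ → Bool) : List Mass → ℚ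
  | [] => 0
  | w :: ω => ind (between P R w.uA) * w.uP * ind (allIn P ω) + ind (P w.uA) * soloUtil P R ω

/-- The sum of the principal's utilities over the actions in the bin `R \ P`, if all actions lie
in `R`. -/
def sharedUtil (P R : ℚ → Bool) : List Mass → ℚ
  | [] => 0
  | w :: ω => ind (between P R w.uA) * w.uP * ind (allIn R ω) + ind (R w.uA) * sharedUtil P R ω

theorem soloUtil_eq (P R : ℚ → Bool) (hP : Down P) (hPR : ∀ u, P u = true → R u = true)
    (ω : List Mass) : soloUtil P R ω = 0 ∨ ∃ w ∈ ω, soloUtil P R ω = w.uP ∧ P w.uA = false ∧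
      (∀ v ∈ ω, v.uA ≤ w.uA) ∧ ∀ v ∈ ω, R v.uA = true := by
  induction ω with
  | nil => left; rfl
  | cons w ω ih =>
    cases hw : P w.uA
    · cases hA : allIn P ω
      · left; simp [soloUtil, hA, hw]
      · cases hR : R w.uA
        · left; simp [soloUtil, hA, hw, between, hR]
        · right
          rw [allIn_eq_true] at hA
          refine ⟨w, by simp, by simp [soloUtil, allIn_eq_true.2 hA, hw, between, hR], hw, ?_, ?_⟩
          · simp only [List.mem_cons, forall_eq_or_imp, le_refl, true_and]
            intro v hv
            by_contra h
            have := hP _ _ (le_of_lt (not_le.1 h)) (hA v hv)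
            simp [hw] at this
          · simp only [List.mem_cons, forall_eq_or_imp, hR, true_and]
            exact fun v hv => hPR _ (hA v hv)
    · have hS : soloUtil P R (w :: ω) = soloUtil P R ω := by simp [soloUtil, hw, between]
      rw [hS]
      rcases ih with h | ⟨v, hv, h1, h2, h3, h4⟩
      · exact Or.inl h
      · refine Or.inr ⟨v, by simp [hv], h1, h2, ?_, ?_⟩
        · simp only [List.mem_cons, forall_eq_or_imp]
          refine ⟨?_, h3⟩
          by_contra h
          have := hP _ _ (le_of_lt (not_le.1 h)) hw
          simp [h2] at this
        · simp only [List.mem_cons, forall_eq_or_imp]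
          exact ⟨hPR _ hw, h4⟩

theorem soloUtil_le (P R : ℚ → Bool) (hP : Down P) (hPR : ∀ u, P u = true → R u = true)
    (ω : List Mass) :
    soloUtil P R ω ≤ ind (allIn R ω) * principalUtil ω - ind (allIn P ω) * principalUtil ω := by
  rcases soloUtil_eq P R hP hPR ω with h | ⟨w, hw, h1, h2, h3, h4⟩
  · rw [h, ← sub_mul]
    refine mul_nonneg ?_ (principalUtil_nonneg ω)
    cases hA : allIn P ω
    · simpa using ind_nonneg _
    · rw [allIn_eq_true.2 fun w hw => hPR _ (allIn_eq_true.1 hA w hw)]; simp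
  · have hA : allIn P ω = false := by
      by_contra h
      have := allIn_eq_true.1 (by simpa using h) w hw
      simp [h2] at this
    rw [h1, hA, allIn_eq_true.2 h4]
    simpa using le_principalUtil hw h3

theorem sharedUtil_nonneg (P R : ℚ → Bool) {ω : List Mass} (hω : ∀ w ∈ ω, 0 ≤ w.uP) :
    0 ≤ sharedUtil P R ω := by
  induction ω with
  | nil => exact le_rfl
  | cons w ω ih =>
    simp only [List.mem_cons, forall_eq_or_imp] at hω
    exact add_nonneg (mul_nonneg (mul_nonneg (ind_nonneg _) hω.1) (ind_nonneg _))
      (mul_nonneg (ind_nonneg _) (ih hω.2))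

theorem uP_le_sharedUtil (P R : ℚ → Bool) {ω : List Mass} (hω : ∀ w ∈ ω, 0 ≤ w.uP)
    (hR : ∀ w ∈ ω, R w.uA = true) : ∀ w ∈ ω, P w.uA = false → w.uP ≤ sharedUtil P R ω := by
  induction ω with
  | nil => simp
  | cons v ω ih =>
    simp only [List.mem_cons, forall_eq_or_imp] at hω hR ⊢
    have h0 := sharedUtil_nonneg P R hω.2
    have hA : allIn R ω = true := allIn_eq_true.2 hR.2
    refine ⟨fun h => ?_, fun w hw h => ?_⟩
    · simp only [sharedUtil, between, h, hR.1, hA]; simpa using h0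
    · refine (ih hω.2 hR.2 w hw h).trans ?_
      simp only [sharedUtil, hR.1, hA, ind_true, one_mul, mul_one, le_add_iff_nonneg_left]
      exact mul_nonneg (ind_nonneg _) hω.1

theorem le_sharedUtil (P R : ℚ → Bool) (hP : Down P) {ω : List Mass}
    (hω : ∀ w ∈ ω, 0 ≤ w.uP) :
    ind (allIn R ω) * principalUtil ω - ind (allIn P ω) * principalUtil ω ≤ sharedUtil P R ω := by
  have h0 := sharedUtil_nonneg P R hω
  have h1 := principalUtil_nonneg ω
  cases hR : allIn R ω
  · simp only [ind_false, zero_mul, zero_sub]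
    exact (neg_nonpos.2 (mul_nonneg (ind_nonneg _) h1)).trans h0
  · cases hA : allIn P ω
    · simp only [ind_true, one_mul, ind_false, zero_mul, sub_zero]
      refine principalUtil_le_iff.2 ⟨h0, fun w hw hmax => ?_⟩
      refine uP_le_sharedUtil P R hω (allIn_eq_true.1 hR) w hw ?_
      by_contra h
      rw [Bool.not_eq_false] at h
      have : allIn P ω = true := allIn_eq_true.2 fun v hv => hP _ _ (hmax v hv) h
      simp [this] at hA
    · simpa using h0

theorem expect_soloUtil_cons (P R : ℚ → Bool) (d : Dist) (ds : List Dist) :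
    expect (d :: ds) (soloUtil P R) =
      binUtil d P R * prAll ds P + pr d P * expect ds (soloUtil P R) := by
  simp only [expect_cons, soloUtil, expect_add, expect_mul_left, expect_allIn, avg_add,
    avg_mul_right, binUtil, pr]

theorem expect_sharedUtil_cons (P R : ℚ → Bool) (d : Dist) (ds : List Dist) :
    expect (d :: ds) (sharedUtil P R) =
      binUtil d P R * prAll ds R + pr d R * expect ds (sharedUtil P R) := by
  simp only [expect_cons, sharedUtil, expect_add, expect_mul_left, expect_allIn, avg_add,
    avg_mul_right, binUtil, pr]

theorem binUtil_nonneg {d : Dist} (hd : IsProb d) (P R : ℚ → Bool) : 0 ≤ binUtil d P R :=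
  avg_nonneg hd.prob_nonneg fun w hw => mul_nonneg (ind_nonneg _) (hd.uP_nonneg w hw)

theorem prob_mul_eq_zero {d : Dist} {h : Mass → ℚ} (hd : ∀ w ∈ d, 0 ≤ w.prob * h w)
    (h0 : avg d h = 0) : ∀ w ∈ d, w.prob * h w = 0 := by
  induction d with
  | nil => simp
  | cons w d ih =>
    simp only [List.mem_cons, forall_eq_or_imp, avg_cons] at hd h0 ⊢
    have h1 : 0 ≤ avg d h := List.sum_nonneg fun x hx => by
      obtain ⟨v, hv, rfl⟩ := List.mem_map.1 hx
      exact hd.2 v hv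
    exact ⟨by linarith [hd.1], ih hd.2 (by linarith [hd.1])⟩

theorem binUtil_eq_zero {d : Dist} (hd : IsProb d) {P R : ℚ → Bool} (h : pr d R = 0) :
    binUtil d P R = 0 := by
  have h0 := prob_mul_eq_zero (fun w hw => mul_nonneg (hd.prob_nonneg w hw) (ind_nonneg _)) h
  unfold binUtil avg
  rw [← avg_zero d]
  unfold avg
  congr 1
  refine List.map_congr_left fun w hw => ?_
  have := h0 w hw
  simp only [between, ind_and]
  linear_combination this * ind (!P w.uA) * w.uP

/-- The sum of `E[uᵢ^P 1(uᵢ^A ∈ R \ P)] / Pr[uᵢ^A ∈ R]` over all actions. -/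
def condUtilSum (ds : List Dist) (P R : ℚ → Bool) : ℚ :=
  (ds.map fun d => binUtil d P R / pr d R).sum

theorem condUtilSum_nonneg {ds : List Dist} (hds : ∀ d ∈ ds, IsProb d) (P R : ℚ → Bool) :
    0 ≤ condUtilSum ds P R := by
  refine List.sum_nonneg fun x hx => ?_
  obtain ⟨d, hd, rfl⟩ := List.mem_map.1 hx
  exact div_nonneg (binUtil_nonneg (hds d hd) P R) (pr_nonneg (hds d hd) R)

theorem le_expect_soloUtil {ds : List Dist} (hds : ∀ d ∈ ds, IsProb d) {P R : ℚ → Bool}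
    (hPR : ∀ u, P u = true → R u = true) :
    condUtilSum ds P R * prAll ds P ≤ expect ds (soloUtil P R) := by
  induction ds with
  | nil => simp [condUtilSum, soloUtil]
  | cons d ds ih =>
    have hd := hds d (by simp)
    have hds' : ∀ e ∈ ds, IsProb e := fun e he => hds e (by simp [he])
    have ih := ih hds'
    rw [expect_soloUtil_cons]
    have h1 : binUtil d P R / pr d R * pr d P ≤ binUtil d P R := by
      rw [div_mul_eq_mul_div]
      exact div_le_of_le_mul₀ (pr_nonneg hd R) (binUtil_nonneg hd P R)
        (mul_le_mul_of_nonneg_left (pr_mono hd fun w _ => hPR _) (binUtil_nonneg hd P R))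
    have h2 := mul_le_mul_of_nonneg_right h1 (prAll_nonneg hds' P)
    have h3 := mul_le_mul_of_nonneg_left ih (pr_nonneg hd P)
    simp only [condUtilSum, List.map_cons, List.sum_cons, prAll_cons] at h3 ⊢
    linarith

theorem expect_sharedUtil {ds : List Dist} (hds : ∀ d ∈ ds, IsProb d) (P R : ℚ → Bool) :
    expect ds (sharedUtil P R) = condUtilSum ds P R * prAll ds R := by
  induction ds with
  | nil => simp [condUtilSum, sharedUtil]
  | cons d ds ih =>
    have hd := hds d (by simp)
    rw [expect_sharedUtil_cons, ih fun e he => hds e (by simp [he])]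
    have h1 : binUtil d P R = binUtil d P R / pr d R * pr d R := by
      by_cases h : pr d R = 0
      · simp [h, binUtil_eq_zero hd h]
      · field_simp
    simp only [condUtilSum, List.map_cons, List.sum_cons, prAll_cons]
    linear_combination prAll ds R * h1

/-- The favorite action lies in the bin `R \ P` whenever a single action does so and all others lie
in `P`. -/
theorem condUtilSum_mul_le {ds : List Dist} (hds : ∀ d ∈ ds, IsProb d) {P R : ℚ → Bool}
    (hP : Down P) (hPR : ∀ u, P u = true → R u = true) :
    condUtilSum ds P R * prAll ds P ≤ restrictedValue ds R - restrictedValue ds P := by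
  refine (le_expect_soloUtil hds hPR).trans ?_
  rw [restrictedValue, restrictedValue, ← expect_sub]
  exact expect_mono (fun d hd => (hds d hd).prob_nonneg) fun ω _ => soloUtil_le P R hP hPR ω

/-- The utility of the favorite action is at most the sum of the utilities of all actions in its
bin. -/
theorem le_condUtilSum_mul {ds : List Dist} (hds : ∀ d ∈ ds, IsProb d) {P R : ℚ → Bool}
    (hP : Down P) :
    restrictedValue ds R - restrictedValue ds P ≤ condUtilSum ds P R * prAll ds R := by
  rw [← expect_sharedUtil hds, restrictedValue, restrictedValue, ← expect_sub]
  refine expect_mono (fun d hd => (hds d hd).prob_nonneg) fun ω hω =>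
    le_sharedUtil P R hP fun w hw => ?_
  obtain ⟨d, hd, hwd⟩ := hω.exists_mem w hw
  exact (hds d hd).uP_nonneg w hwd

theorem restrictedValue_nonneg {ds : List Dist} (hds : ∀ d ∈ ds, IsProb d) (R : ℚ → Bool) :
    0 ≤ restrictedValue ds R :=
  expect_nonneg (fun d hd => (hds d hd).prob_nonneg) fun ω _ =>
    mul_nonneg (ind_nonneg _) (principalUtil_nonneg ω)

/-! ### Additive estimates of the bin probabilities -/

/-- The conditional probability `Pr[u^A ∈ R \ P | u^A ∈ R]` for one action. -/
def condPr (P R : ℚ → Bool) (d : Dist) : ℚ := pr d (between P R) / pr d R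

theorem pr_between {d : Dist} {P R : ℚ → Bool} (hPR : ∀ u, P u = true → R u = true) :
    pr d (between P R) = pr d R - pr d P := by
  rw [pr, pr, pr, ← avg_sub]
  refine avg_congr fun w _ => ?_
  have := hPR w.uA
  unfold between
  cases hP : P w.uA <;> simp_all

theorem one_sub_condPr_mul {d : Dist} (hd : IsProb d) {P R : ℚ → Bool}
    (hPR : ∀ u, P u = true → R u = true) : (1 - condPr P R d) * pr d R = pr d P := by
  have h1 := pr_mono hd (P := P) (R := R) fun w _ => hPR _
  have h2 := pr_nonneg hd P
  rw [condPr, pr_between hPR]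
  by_cases h : pr d R = 0
  · rw [h, mul_zero]; linarith
  · field_simp; ring

theorem condPr_nonneg {d : Dist} (hd : IsProb d) (P R : ℚ → Bool) : 0 ≤ condPr P R d :=
  div_nonneg (pr_nonneg hd _) (pr_nonneg hd _)

theorem condPr_le_one {d : Dist} (hd : IsProb d) (P R : ℚ → Bool) : condPr P R d ≤ 1 :=
  div_le_one_of_le₀ (pr_mono hd fun w _ => by simp +contextual [between]) (pr_nonneg hd _)

theorem prod_mul_prAll {ds : List Dist} (hds : ∀ d ∈ ds, IsProb d) {P R : ℚ → Bool}
    (hPR : ∀ u, P u = true → R u = true) :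
    (ds.map fun d => 1 - condPr P R d).prod * prAll ds R = prAll ds P := by
  induction ds with
  | nil => simp
  | cons d ds ih =>
    have h1 := one_sub_condPr_mul (hds d (by simp)) hPR
    have h2 := ih fun e he => hds e (by simp [he])
    simp only [List.map_cons, List.prod_cons, prAll_cons]
    rw [← h1, ← h2]; ring

theorem prod_one_sub_bounds (l : List ℚ) (hl : ∀ x ∈ l, 0 ≤ x ∧ x ≤ 1) :
    0 ≤ (l.map fun x => 1 - x).prod ∧ (l.map fun x => 1 - x).prod ≤ 1 ∧ 0 ≤ l.sum ∧
      1 - l.sum ≤ (l.map fun x => 1 - x).prod ∧ (1 + l.sum) * (l.map fun x => 1 - x).prod ≤ 1 := by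
  induction l with
  | nil => simp
  | cons x l ih =>
    obtain ⟨h1, h2, h3, h4, h5⟩ := ih fun y hy => hl y (by simp [hy])
    obtain ⟨hx0, hx1⟩ := hl x (by simp)
    simp only [List.map_cons, List.prod_cons, List.sum_cons]
    generalize (l.map fun x => 1 - x).prod = p at *
    generalize l.sum = s at *
    have hx : 0 ≤ 1 - x := by linarith
    refine ⟨mul_nonneg hx h1, mul_le_one₀ (by linarith) h1 h2, by linarith, ?_, ?_⟩
    · nlinarith
    · have e1 := mul_le_mul_of_nonneg_left h5 hx
      have e2 := mul_le_mul_of_nonneg_left h2 (mul_nonneg hx0 hx)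
      nlinarith

theorem one_sub_sum_condPr_mul_le {ds : List Dist} (hds : ∀ d ∈ ds, IsProb d) {P R : ℚ → Bool}
    (hPR : ∀ u, P u = true → R u = true) :
    (1 - (ds.map (condPr P R)).sum) * prAll ds R ≤ prAll ds P := by
  obtain ⟨-, -, -, h, -⟩ := prod_one_sub_bounds (ds.map (condPr P R)) fun x hx => by
    obtain ⟨d, hd, rfl⟩ := List.mem_map.1 hx
    exact ⟨condPr_nonneg (hds d hd) _ _, condPr_le_one (hds d hd) _ _⟩
  rw [← prod_mul_prAll hds hPR]
  refine mul_le_mul_of_nonneg_right ?_ (prAll_nonneg hds R)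
  simpa [Function.comp_def] using h

theorem one_add_sum_condPr_mul_le {ds : List Dist} (hds : ∀ d ∈ ds, IsProb d) {P R : ℚ → Bool}
    (hPR : ∀ u, P u = true → R u = true) :
    (1 + (ds.map (condPr P R)).sum) * prAll ds P ≤ prAll ds R := by
  obtain ⟨-, -, -, -, h⟩ := prod_one_sub_bounds (ds.map (condPr P R)) fun x hx => by
    obtain ⟨d, hd, rfl⟩ := List.mem_map.1 hx
    exact ⟨condPr_nonneg (hds d hd) _ _, condPr_le_one (hds d hd) _ _⟩
  rw [← prod_mul_prAll hds hPR, ← mul_assoc]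
  refine mul_le_of_le_one_left (prAll_nonneg hds R) ?_
  simpa [Function.comp_def] using h

/-! ### The distribution function of the agent's utility has small jumps -/

theorem avg_ind_eq_le {d : Dist} {ε a : ℚ} (hε : 0 ≤ ε) (hd : ∀ w ∈ d, w.prob ≤ ε)
    (hnd : (d.map Mass.uA).Nodup) : pr d (fun u => decide (u = a)) ≤ ε := by
  unfold pr
  induction d with
  | nil => simpa
  | cons w d ih =>
    simp only [List.map_cons, List.nodup_cons, List.mem_cons, forall_eq_or_imp] at hnd hd
    by_cases h : w.uA = a
    · have : avg d (fun w => ind (decide (w.uA = a))) = 0 := by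
        rw [← avg_zero d]
        refine avg_congr fun v hv => ?_
        have : v.uA ≠ a := fun hv' => hnd.1 (by rw [h, ← hv']; exact List.mem_map_of_mem hv)
        simp [this]
      simp [this, h, hd.1]
    · simpa [h] using ih hd.2 hnd.2

theorem prAll_le_add {ds : List Dist} {ε a : ℚ} (hε : 0 ≤ ε) (hds : ∀ d ∈ ds, IsProb d)
    (hp : ∀ d ∈ ds, ∀ w ∈ d, w.prob ≤ ε) (hnd : ∀ d ∈ ds, (d.map Mass.uA).Nodup)
    (hpw : ds.Pairwise fun d e => ∀ w ∈ d, ∀ v ∈ e, w.uA ≠ v.uA) :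
    prAll ds (fun u => decide (u ≤ a)) ≤ prAll ds (fun u => decide (u < a)) + ε := by
  induction ds with
  | nil => simpa
  | cons d ds ih =>
    simp only [List.mem_cons, forall_eq_or_imp, List.pairwise_cons] at hds hp hnd hpw
    simp only [prAll_cons]
    have hle : pr d (fun u => decide (u ≤ a)) =
        pr d (fun u => decide (u < a)) + pr d (fun u => decide (u = a)) := by
      rw [pr, pr, pr, ← avg_add]
      refine avg_congr fun w _ => ?_
      rcases lt_trichotomy w.uA a with h | h | h
      · simp [h, h.le, h.ne]
      · simp [h]
      · simp [h.ne', h.not_ge, h.not_gt]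
    by_cases h : ∃ w ∈ d, w.uA = a
    · obtain ⟨w, hw, rfl⟩ := h
      have heq : prAll ds (fun u => decide (u ≤ w.uA)) = prAll ds (fun u => decide (u < w.uA)) := by
        unfold prAll
        congr 1
        refine List.map_congr_left fun e he => avg_congr fun v hv => ?_
        have := (hpw.1 e he w hw v hv).symm
        congr 1
        simp [le_iff_lt_or_eq, this]
      rw [heq, hle, add_mul]
      have h1 := avg_ind_eq_le (a := w.uA) hε hp.1 hnd.1
      have h2 := prAll_le_one hds.2 fun u => decide (u < w.uA)
      have h3 := prAll_nonneg hds.2 fun u => decide (u < w.uA)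
      have h4 := mul_le_mul h1 h2 h3 hε
      linarith
    · push Not at h
      have h0 : pr d (fun u => decide (u = a)) = 0 := by
        rw [← avg_zero d]
        exact avg_congr fun w hw => by simp [h w hw]
      rw [hle, h0, add_zero]
      have ih := ih hds.2 hp.2 hnd.2 hpw.2
      have h1 := pr_le_one hds.1 fun u => decide (u < a)
      have h2 := pr_nonneg hds.1 fun u => decide (u < a)
      have h3 := mul_le_mul_of_nonneg_left ih h2
      have h4 := mul_le_mul_of_nonneg_right h1 hε
      linarith


/-! ### Preprocessing: listing, sorting and the perturbation -/

theorem filter_flatten_mapIdx {α β : Type} (p : β → Bool) (l : List α) (F : ℕ → α → List β) (i : ℕ)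
    (hF : ∀ k a, k ≠ i → (F k a).filter p = []) :
    (l.mapIdx F).flatten.filter p = (l[i]?.map fun a => (F i a).filter p).getD [] := by
  induction l generalizing F i with
  | nil => simp
  | cons a l ih =>
    rw [List.mapIdx_cons, List.flatten_cons, List.filter_append]
    cases i with
    | zero =>
      have : ((l.mapIdx fun i => F (i + 1)).flatten.filter p) = [] := by
        rw [List.filter_eq_nil_iff]
        intro b hb
        obtain ⟨m, hm, hbm⟩ := List.mem_flatten.1 hb
        obtain ⟨k, hk, rfl⟩ := List.mem_mapIdx.1 hm
        exact List.filter_eq_nil_iff.1 (hF (k + 1) _ (by omega)) b hbm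
      simp [this]
    | succ i =>
      rw [hF 0 a (by omega), ih _ i fun k a hk => hF (k + 1) a (by omega)]
      simp

theorem mem_collect {I : Inst} {t : Tagged} :
    t ∈ (collect I).val ↔ ∃ cfgs, I[t.act]? = some cfgs ∧ ∃ d, cfgs[t.conf]? = some d ∧
      t.mass ∈ d := by
  obtain ⟨i, c, w⟩ := t
  simp only [collect, Cost.bind_val, bindC_val, mapIdxC_val, mapC_val, Cost.pure_val,
    List.mem_flatMap, List.mem_mapIdx, zero_add]
  constructor
  · rintro ⟨_, ⟨k, hk, rfl⟩, ht⟩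
    simp only [List.mem_flatMap, List.mem_mapIdx] at ht
    obtain ⟨_, ⟨j, hj, rfl⟩, ht⟩ := ht
    obtain ⟨v, hv, h⟩ := List.mem_map.1 ht
    cases h
    exact ⟨_, List.getElem?_eq_getElem hk, _, List.getElem?_eq_getElem hj, hv⟩
  · rintro ⟨cfgs, h1, d, h2, h3⟩
    obtain ⟨hk, rfl⟩ := List.getElem?_eq_some_iff.1 h1
    obtain ⟨hj, rfl⟩ := List.getElem?_eq_some_iff.1 h2
    refine ⟨_, ⟨i, hk, rfl⟩, ?_⟩
    simp only [List.mem_flatMap, List.mem_mapIdx]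
    exact ⟨_, ⟨c, hj, rfl⟩, List.mem_map.2 ⟨w, h3, rfl⟩⟩

/-- The mass points of action `i` in configuration `c`. -/
def distAt (I : Inst) (i c : ℕ) : Dist := (I.getD i []).getD c []

/-- Selects the mass points of action `i` in configuration `c`. -/
def hasTag (i c : ℕ) (t : Tagged) : Bool := decide (t.act = i) && decide (t.conf = c)

theorem filter_collect (I : Inst) (i c : ℕ) :
    ((collect I).val.filter (hasTag i c)).map Tagged.mass = distAt I i c := by
  have h1 : (collect I).val = (I.mapIdx fun i cfgs =>
      (cfgs.mapIdx fun j d => d.map (Tagged.mk i j)).flatten).flatten := by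
    simp [collect, List.flatMap_id']
  rw [h1, filter_flatten_mapIdx _ _ _ i]
  · unfold distAt
    cases hI : I[i]? with
    | none => simp [hI]
    | some cfgs =>
      rw [Option.map_some, Option.getD_some, filter_flatten_mapIdx _ _ _ c]
      · cases hc : cfgs[c]? with
        | none => simp [hI, hc]
        | some d =>
          have : (d.map (Tagged.mk i c)).filter (hasTag i c) = d.map (Tagged.mk i c) := by
            rw [List.filter_eq_self]
            simp +contextual [hasTag]
          simp [hI, hc, this, Function.comp_def]
      · intro k d hk
        rw [List.filter_eq_nil_iff]
        intro t ht
        obtain ⟨w, hw, rfl⟩ := List.mem_map.1 ht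
        simp [hasTag, hk]
  · intro k cfgs hk
    rw [List.filter_eq_nil_iff]
    intro t ht
    obtain ⟨m, hm, ht⟩ := List.mem_flatten.1 ht
    obtain ⟨j, hj, rfl⟩ := List.mem_mapIdx.1 hm
    obtain ⟨w, hw, rfl⟩ := List.mem_map.1 ht
    simp [hasTag, hk]

theorem insertByUP_perm (t : Tagged) (l : List Tagged) : (insertByUP t l).val.Perm (t :: l) := by
  induction l with
  | nil => simp [insertByUP]
  | cons s l ih =>
    by_cases h : t.mass.uP ≤ s.mass.uP
    · simp [insertByUP, h]
    · simpa [insertByUP, h] using (ih.cons s).trans (List.Perm.swap t s l)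

theorem sortByUP_perm (l : List Tagged) : (sortByUP l).val.Perm l := by
  induction l with
  | nil => simp [sortByUP]
  | cons t l ih => exact (insertByUP_perm t _).trans (ih.cons t)

theorem insertByUP_sorted (t : Tagged) (l : List Tagged)
    (hl : l.Pairwise fun s t => s.mass.uP ≤ t.mass.uP) :
    (insertByUP t l).val.Pairwise fun s t => s.mass.uP ≤ t.mass.uP := by
  induction l with
  | nil => simp [insertByUP]
  | cons s l ih =>
    obtain ⟨h1, h2⟩ := List.pairwise_cons.1 hl
    by_cases h : t.mass.uP ≤ s.mass.uP
    · simp only [insertByUP, Cost.bind_val, leQ_val, h, decide_true, if_true, Cost.pure_val]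
      refine List.pairwise_cons.2 ⟨fun x hx => ?_, hl⟩
      rcases List.mem_cons.1 hx with rfl | hx
      exacts [h, h.trans (h1 x hx)]
    · simp only [insertByUP, Cost.bind_val, leQ_val, h, decide_false, Cost.pure_val,
        Bool.false_eq_true, if_false]
      refine List.pairwise_cons.2 ⟨fun x hx => ?_, ih h2⟩
      rcases List.mem_cons.1 ((insertByUP_perm t l).mem_iff.1 hx) with rfl | hx
      exacts [(not_le.1 h).le, h1 x hx]

theorem sortByUP_sorted (l : List Tagged) :
    (sortByUP l).val.Pairwise fun s t => s.mass.uP ≤ t.mass.uP := by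
  induction l with
  | nil => simp [sortByUP]
  | cons t l ih => exact insertByUP_sorted t _ ih

/-- The gap `o` is at most `g`, where `none` stands for the gap `∞`. -/
def GapLe (o : Option ℚ) (g : ℚ) : Prop := ∃ h ∈ o, h ≤ g

theorem betterGap_spec (u v : ℚ) (best : Option ℚ) (hb : ∀ h ∈ best, 0 < h) :
    (∀ h ∈ (betterGap u v best).val, 0 < h) ∧ (u < v → GapLe (betterGap u v best).val (v - u)) ∧
      ∀ g, GapLe best g → GapLe (betterGap u v best).val g := by
  by_cases h : u < v
  · cases best with
    | none => simp [betterGap, h, GapLe]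
    | some x =>
      by_cases hx : v - u ≤ x
      · simp only [betterGap, h, hx, GapLe, Cost.bind_val, ltQ_val, decide_true, if_true, subQ_val,
          leQ_val, Cost.pure_val, Option.mem_def, Option.some.injEq, exists_eq_left', forall_eq']
        refine ⟨by linarith, fun _ => le_rfl, fun g hg => hx.trans hg⟩
      · simp only [betterGap, h, hx, GapLe, Cost.bind_val, ltQ_val, decide_true, if_true, subQ_val,
          leQ_val, Cost.pure_val, Option.mem_def, Option.some.injEq, exists_eq_left', forall_eq',
          decide_false, Bool.false_eq_true, if_false]
        exact ⟨hb x rfl, fun _ => (not_le.1 hx).le, fun g hg => hg⟩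
  · simpa [betterGap, h] using hb

theorem minGapFrom_spec (u : ℚ) (l : List Tagged) (best : Option ℚ) (hb : ∀ h ∈ best, 0 < h) :
    (∀ h ∈ (minGapFrom u l best).val, 0 < h) ∧
      (∀ t ∈ l, u < t.mass.uA → GapLe (minGapFrom u l best).val (t.mass.uA - u)) ∧
      ∀ g, GapLe best g → GapLe (minGapFrom u l best).val g := by
  induction l generalizing best with
  | nil => simpa [minGapFrom] using hb
  | cons t l ih =>
    obtain ⟨h1, h2, h3⟩ := betterGap_spec u t.mass.uA best hb
    obtain ⟨k1, k2, k3⟩ := ih _ h1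
    simp only [minGapFrom, Cost.bind_val, List.mem_cons, forall_eq_or_imp]
    exact ⟨k1, ⟨fun h => k3 _ (h2 h), k2⟩, fun g hg => k3 _ (h3 g hg)⟩

theorem minGap_spec (k l : List Tagged) (best : Option ℚ) (hb : ∀ h ∈ best, 0 < h) :
    (∀ h ∈ (minGap k l best).val, 0 < h) ∧
      (∀ s ∈ k, ∀ t ∈ l, s.mass.uA < t.mass.uA →
        GapLe (minGap k l best).val (t.mass.uA - s.mass.uA)) ∧
      ∀ g, GapLe best g → GapLe (minGap k l best).val g := by
  induction k generalizing best with
  | nil => simpa [minGap] using hb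
  | cons t k ih =>
    obtain ⟨h1, h2, h3⟩ := minGapFrom_spec t.mass.uA l best hb
    obtain ⟨k1, k2, k3⟩ := ih _ h1
    simp only [minGap, Cost.bind_val, List.mem_cons, forall_eq_or_imp]
    exact ⟨k1, ⟨fun t ht h => k3 _ (h2 t ht h), k2⟩, fun g hg => k3 _ (h3 g hg)⟩

/-- The perturbation is positive, and its first `N (M² + 1)` multiples are smaller than the distance
of any two different agent utilities. -/
theorem chooseDelta_spec (M : ℕ) (L : List Tagged) (hL : L ≠ []) :
    0 < (chooseDelta M L).val ∧ ∀ s ∈ L, ∀ t ∈ L, s.mass.uA < t.mass.uA →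
      ∀ ℓ : ℕ, ℓ < L.length * (M ^ 2 + 1) →
        (chooseDelta M L).val * ℓ < t.mass.uA - s.mass.uA := by
  obtain ⟨h1, h2, -⟩ := minGap_spec L L none (by simp)
  have hpos : 0 < L.length * (M ^ 2 + 1) := by
    have := List.length_pos_iff.2 hL
    positivity
  have hD : (0 : ℚ) < ((L.length * (M ^ 2 + 1) : ℕ) : ℚ) := by exact_mod_cast hpos
  simp only [chooseDelta, Cost.bind_val, lengthC_val, mulN_val]
  cases hg : (minGap L L none).val with
  | none =>
    refine ⟨div_pos one_pos hD, fun s hs t ht hst => ?_⟩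
    have := h2 s hs t ht hst
    simp [hg, GapLe] at this
  | some g =>
    have hg0 : 0 < g := h1 g (by simp [hg])
    refine ⟨div_pos hg0 hD, fun s hs t ht hst ℓ hℓ => ?_⟩
    obtain ⟨x, hx, hx'⟩ := h2 s hs t ht hst
    obtain rfl : g = x := by simpa [hg] using hx
    refine lt_of_lt_of_le ?_ hx'
    have hℓ' : (ℓ : ℚ) < ((L.length * (M ^ 2 + 1) : ℕ) : ℚ) := by exact_mod_cast hℓ
    simp only [divQ_val]
    rw [div_mul_eq_mul_div, div_lt_iff₀ hD]
    exact mul_lt_mul_of_pos_left hℓ' hg0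

/-! ### Preprocessing: splitting the mass points -/

/-- The pieces of one mass point: consecutive numbers, starting at `ℓ`, with their probabilities. -/
def cuts (M : ℕ) (rem : ℚ) : ℕ → ℕ → List (ℕ × ℚ)
  | 0, ℓ => [(ℓ, rem)]
  | k + 1, ℓ => (ℓ, 1 / (M : ℚ) ^ 2) :: cuts M rem k (ℓ + 1)

/-- The mass point `t` shifted by `δ` times the number of a piece, with the probability of the
piece. -/
def shifted (δ : ℚ) (x : Tagged × ℕ × ℚ) : Tagged :=
  ⟨x.1.act, x.1.conf, ⟨x.1.mass.uA + δ * x.2.1, x.1.mass.uP, x.2.2⟩⟩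

/-- All pieces of the given mass points: the original mass point, the number of the piece (counted
from `ℓ`), and its probability. -/
def labeled (M : ℕ) : List Tagged → ℕ → List (Tagged × ℕ × ℚ)
  | [], _ => []
  | t :: l, ℓ =>
    (cuts M (t.mass.prob - ⌊t.mass.prob * (M : ℚ) ^ 2⌋₊ * (1 / (M : ℚ) ^ 2))
      ⌊t.mass.prob * (M : ℚ) ^ 2⌋₊ ℓ).map (Prod.mk t) ++
    labeled M l (ℓ + ⌊t.mass.prob * (M : ℚ) ^ 2⌋₊ + 1)

theorem splitWhole_val (M : ℕ) (δ : ℚ) (t : Tagged) (rem : ℚ) (k ℓ : ℕ) :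
    (splitWhole M δ t rem k ℓ).val =
      ((cuts M rem k ℓ).map fun x => shifted δ (t, x), ℓ + k + 1) := by
  induction k generalizing ℓ with
  | zero => simp [splitWhole, cuts, emit, shifted]
  | succ k ih => simp [splitWhole, cuts, emit, shifted, ih]; omega

theorem splitAll_val (M : ℕ) (δ : ℚ) (l : List Tagged) (ℓ : ℕ) :
    (splitAll M δ l ℓ).val = (labeled M l ℓ).map (shifted δ) := by
  induction l generalizing ℓ with
  | nil => simp [splitAll, labeled]
  | cons t l ih =>
    simp [splitAll, labeled, splitWhole_val, ih, Function.comp_def]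

theorem cuts_number {M : ℕ} {rem : ℚ} {k ℓ : ℕ} :
    (cuts M rem k ℓ).map Prod.fst = List.range' ℓ (k + 1) := by
  induction k generalizing ℓ with
  | zero => simp [cuts]
  | succ k ih => simp [cuts, ih, List.range'_succ (n := k + 1)]

theorem length_cuts (M : ℕ) (rem : ℚ) (k ℓ : ℕ) : (cuts M rem k ℓ).length = k + 1 := by
  have := congrArg List.length (cuts_number (M := M) (rem := rem) (k := k) (ℓ := ℓ))
  simpa using this

theorem cuts_prob {M : ℕ} {rem : ℚ} {k ℓ : ℕ} {x : ℕ × ℚ} (hx : x ∈ cuts M rem k ℓ) :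
    x.2 = rem ∨ x.2 = 1 / (M : ℚ) ^ 2 := by
  induction k generalizing ℓ with
  | zero => simp_all [cuts]
  | succ k ih =>
    rcases List.mem_cons.1 hx with rfl | hx
    exacts [Or.inr rfl, ih hx]

theorem cuts_sum (M : ℕ) (rem : ℚ) (k ℓ : ℕ) :
    ((cuts M rem k ℓ).map Prod.snd).sum = k * (1 / (M : ℚ) ^ 2) + rem := by
  induction k generalizing ℓ with
  | zero => simp [cuts]
  | succ k ih => simp only [cuts, List.map_cons, List.sum_cons, ih]; push_cast; ring

theorem labeled_number (M : ℕ) (l : List Tagged) (ℓ : ℕ) :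
    (labeled M l ℓ).map (fun x => x.2.1) = List.range' ℓ (labeled M l ℓ).length := by
  induction l generalizing ℓ with
  | nil => simp [labeled]
  | cons t l ih =>
    have h2 : ∀ k rem, (cuts M rem k ℓ).map ((fun x => x.2.1) ∘ Prod.mk t) =
        List.range' ℓ (k + 1) := fun k rem => cuts_number
    simp only [labeled, List.map_append, List.map_map, h2, ih, List.length_append, List.length_map,
      length_cuts]
    rw [add_assoc ℓ, List.range'_append_1]

theorem labeled_length {M : ℕ} (hM : 0 < M) {l : List Tagged} (hl : ∀ t ∈ l, t.mass.prob ≤ 1)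
    (ℓ : ℕ) : (labeled M l ℓ).length ≤ l.length * (M ^ 2 + 1) := by
  induction l generalizing ℓ with
  | nil => simp [labeled]
  | cons t l ih =>
    simp only [List.mem_cons, forall_eq_or_imp] at hl
    have hf : ⌊t.mass.prob * (M : ℚ) ^ 2⌋₊ ≤ M ^ 2 := by
      refine Nat.floor_le_of_le ?_
      push_cast
      exact mul_le_of_le_one_left (by positivity) hl.1
    have := ih hl.2 (ℓ + ⌊t.mass.prob * (M : ℚ) ^ 2⌋₊ + 1)
    simp only [labeled, List.length_append, List.length_map, length_cuts, List.length_cons]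
    linarith

theorem labeled_spec {M : ℕ} (hM : 0 < M) {l : List Tagged} (hl : ∀ t ∈ l, 0 ≤ t.mass.prob)
    (ℓ : ℕ) : ∀ x ∈ labeled M l ℓ, x.1 ∈ l ∧ 0 ≤ x.2.2 ∧ x.2.2 ≤ 1 / (M : ℚ) ^ 2 := by
  induction l generalizing ℓ with
  | nil => simp [labeled]
  | cons t l ih =>
    simp only [List.mem_cons, forall_eq_or_imp] at hl
    intro x hx
    have hM2 : (0 : ℚ) < (M : ℚ) ^ 2 := by positivity
    rcases List.mem_append.1 hx with hx | hx
    · obtain ⟨y, hy, rfl⟩ := List.mem_map.1 hx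
      refine ⟨by simp, ?_⟩
      have h1 := Nat.floor_le (mul_nonneg hl.1 hM2.le)
      have h2 := (Nat.lt_floor_add_one (t.mass.prob * (M : ℚ) ^ 2)).le
      rcases cuts_prob hy with h | h
      · simp only [h]
        rw [← mul_div_assoc, mul_one, sub_nonneg, div_le_iff₀ hM2]
        refine ⟨h1, ?_⟩
        rw [sub_le_iff_le_add, ← add_div, le_div_iff₀ hM2, add_comm]
        exact h2
      · simp only [h]
        exact ⟨by positivity, le_rfl⟩
    · obtain ⟨h1, h2⟩ := ih hl.2 _ x hx
      exact ⟨by simp [h1], h2⟩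

theorem labeled_sorted {M : ℕ} {l : List Tagged}
    (hl : l.Pairwise fun s t => s.mass.uP ≤ t.mass.uP) (h0 : ∀ t ∈ l, 0 ≤ t.mass.prob)
    (hM : 0 < M) (ℓ : ℕ) :
    (labeled M l ℓ).Pairwise fun x y => x.1.mass.uP ≤ y.1.mass.uP := by
  induction l generalizing ℓ with
  | nil => simp [labeled]
  | cons t l ih =>
    obtain ⟨h1, h2⟩ := List.pairwise_cons.1 hl
    simp only [List.mem_cons, forall_eq_or_imp] at h0
    refine List.pairwise_append.2 ⟨?_, ih h2 h0.2 _, ?_⟩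
    · exact List.pairwise_map.2 (List.pairwise_of_forall fun _ _ => le_rfl)
    · intro x hx y hy
      obtain ⟨z, -, rfl⟩ := List.mem_map.1 hx
      exact h1 _ (labeled_spec hM h0.2 _ y hy).1

theorem labeled_sum (M : ℕ) (l : List Tagged) (ℓ : ℕ) (h : Tagged → ℚ) :
    ((labeled M l ℓ).map fun x => x.2.2 * h x.1).sum =
      (l.map fun t => t.mass.prob * h t).sum := by
  induction l generalizing ℓ with
  | nil => simp [labeled]
  | cons t l ih =>
    have hs : ∀ L : List (ℕ × ℚ), ((L.map (Prod.mk t)).map fun x => x.2.2 * h x.1).sum =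
        (L.map Prod.snd).sum * h t := by
      intro L
      induction L with
      | nil => simp
      | cons x L ihL => simp only [List.map_cons, List.sum_cons, ihL]; ring
    simp only [labeled, List.map_append, List.sum_append, ih, hs, cuts_sum, List.map_cons,
      List.sum_cons]
    ring


/-! ### The preprocessed instance -/

/-- The perturbation used by the preprocessing of `I`. -/
def delta (M : ℕ) (I : Inst) : ℚ := (chooseDelta M (collect I).val).val

/-- All pieces of all mass points of `I`. -/
def allPieces (M : ℕ) (I : Inst) : List (Tagged × ℕ × ℚ) :=
  labeled M (sortByUP (collect I).val).val 0

/-- The pieces of the mass points of action `i` in configuration `c`. -/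
def piecesAt (M : ℕ) (I : Inst) (i c : ℕ) : List (Tagged × ℕ × ℚ) :=
  (allPieces M I).filter fun x => hasTag i c x.1

/-- The mass point of the preprocessed instance that a piece stands for. -/
def pieceMass (M : ℕ) (I : Inst) (x : Tagged × ℕ × ℚ) : Mass := (shifted (delta M I) x).mass

theorem preprocess_val (M : ℕ) (I : Inst) : (preprocess M I).val =
    I.mapIdx fun i cfgs => cfgs.mapIdx fun j _ => (piecesAt M I i j).map (pieceMass M I) := by
  unfold preprocess
  simp only [Cost.bind_val, mapIdxC_val, filterC_val, mapC_val, Cost.pure_val, eqN_val, zero_add]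
  congr 1; funext i cfgs; congr 1; funext j d
  rw [splitAll_val, List.filter_map, List.map_map]
  rfl

theorem isConfig_iff {I : Inst} {C : List ℕ} : IsConfig I C ↔ C.length = I.length ∧
    ∀ i, i < I.length → C.getD i 0 < (I.getD i []).length := by
  unfold IsConfig
  rw [List.forall₂_iff_get]
  constructor
  · rintro ⟨h, H⟩
    refine ⟨h.symm, fun i hi => ?_⟩
    simpa [List.getD, hi, h ▸ hi] using H i hi (h ▸ hi)
  · rintro ⟨h, H⟩
    refine ⟨h.symm, fun i hi hi' => ?_⟩
    simpa [List.getD, hi, hi'] using H i hi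

theorem chosen_eq_mapIdx {I : Inst} {C : List ℕ} (h : IsConfig I C) :
    chosen I C = C.mapIdx fun i c => distAt I i c := by
  unfold IsConfig at h
  induction h with
  | nil => rfl
  | cons hab _ ih => simpa [chosen, List.mapIdx_cons, distAt] using ih

theorem isConfig_mapIdx {I : Inst} {F : ℕ → ℕ → Dist} {C : List ℕ} :
    IsConfig (I.mapIdx fun i cfgs => cfgs.mapIdx fun j _ => F i j) C ↔ IsConfig I C := by
  simp only [isConfig_iff, List.length_mapIdx]
  refine and_congr_right fun _ => forall_congr' fun i => forall_congr' fun hi => ?_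
  simp [List.getD, hi]

theorem isConfig_preprocess {M : ℕ} {I : Inst} {C : List ℕ} :
    IsConfig (preprocess M I).val C ↔ IsConfig I C := by
  rw [preprocess_val]; exact isConfig_mapIdx

theorem chosen_preprocess {M : ℕ} {I : Inst} {C : List ℕ} (h : IsConfig I C) :
    chosen (preprocess M I).val C = C.mapIdx fun i c => (piecesAt M I i c).map (pieceMass M I) := by
  rw [chosen_eq_mapIdx (isConfig_preprocess.2 h)]
  obtain ⟨h1, h2⟩ := isConfig_iff.1 h
  refine List.ext_getElem (by simp) fun i hi _ => ?_
  have hiC : i < C.length := by simpa using hi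
  have h3 := h2 i (h1 ▸ hiC)
  have hiI : i < I.length := h1 ▸ hiC
  simp only [List.getD, hiC, hiI, List.getElem?_eq_getElem, Option.getD_some] at h3
  simp [preprocess_val, distAt, List.getD, hiI, h3]

variable {I : Inst}

theorem avg_distAt (M : ℕ) (I : Inst) (i c : ℕ) (h : Mass → ℚ) :
    avg (distAt I i c) h =
      ((piecesAt M I i c).map fun x => (pieceMass M I x).prob * h x.1.mass).sum := by
  have hf : ∀ {α : Type} (l : List α) (p : α → Bool) (g : α → ℚ),
      ((l.filter p).map g).sum = (l.map fun x => if p x then g x else 0).sum := by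
    intro α l p g
    induction l with
    | nil => simp
    | cons a l ih => by_cases hp : p a <;> simp [hp, ih]
  rw [← filter_collect, avg, List.map_map, hf, piecesAt, hf]
  have h1 := labeled_sum M (sortByUP (collect I).val).val 0
    fun t => if hasTag i c t then h t.mass else 0
  rw [((sortByUP_perm (collect I).val).map _).sum_eq] at h1
  simp only [mul_ite, mul_zero] at h1
  exact h1.symm

theorem Valid.isProb (hI : Valid I) {i c : ℕ} (hi : i < I.length)
    (hc : c < (I.getD i []).length) : IsProb (distAt I i c) ∧ ∀ w ∈ distAt I i c, w.prob ≤ 1 := by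
  simp only [List.getD, hi, List.getElem?_eq_getElem, Option.getD_some] at hc
  obtain ⟨h1, h2⟩ := (hI.2 _ (List.getElem_mem hi)).2 _ (List.getElem_mem hc)
  have hd : distAt I i c = I[i][c] := by simp [distAt, List.getD, hi, hc]
  rw [hd]
  refine ⟨⟨fun w hw => (h1 w hw).1.le, fun w hw => (h1 w hw).2, by simpa [avg] using h2⟩, ?_⟩
  intro w hw
  rw [← h2]
  refine List.single_le_sum (fun x hx => ?_) _ (List.mem_map_of_mem hw)
  obtain ⟨v, hv, rfl⟩ := List.mem_map.1 hx
  exact (h1 v hv).1.le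

theorem Valid.collect_spec (hI : Valid I) {t : Tagged} (ht : t ∈ (collect I).val) :
    0 < t.mass.prob ∧ t.mass.prob ≤ 1 ∧ 0 ≤ t.mass.uP := by
  obtain ⟨cfgs, h1, d, h2, h3⟩ := mem_collect.1 ht
  obtain ⟨hi, rfl⟩ := List.getElem?_eq_some_iff.1 h1
  obtain ⟨hc, rfl⟩ := List.getElem?_eq_some_iff.1 h2
  have h4 := ((hI.2 _ (List.getElem_mem hi)).2 _ (List.getElem_mem hc)).1 _ h3
  refine ⟨h4.1, (hI.isProb hi (c := t.conf) (by simpa [List.getD, hi] using hc)).2 _ ?_, h4.2⟩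
  simpa [distAt, List.getD, hi, hc] using h3

theorem Valid.mem_allPieces (hI : Valid I) {M : ℕ} (hM : 0 < M) {x : Tagged × ℕ × ℚ}
    (hx : x ∈ allPieces M I) :
    x.1 ∈ (collect I).val ∧ 0 ≤ x.2.2 ∧ x.2.2 ≤ 1 / (M : ℚ) ^ 2 ∧
      x.2.1 < (collect I).val.length * (M ^ 2 + 1) := by
  have hmem : ∀ t, t ∈ (sortByUP (collect I).val).val ↔ t ∈ (collect I).val := fun t =>
    (sortByUP_perm _).mem_iff
  obtain ⟨h1, h2, h3⟩ := labeled_spec hM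
    (fun t ht => (hI.collect_spec ((hmem t).1 ht)).1.le) 0 x hx
  refine ⟨(hmem _).1 h1, h2, h3, ?_⟩
  have h4 : x.2.1 ∈ (allPieces M I).map fun x => x.2.1 := List.mem_map_of_mem hx
  rw [allPieces, labeled_number, List.mem_range'_1] at h4
  have h5 := labeled_length hM (fun t ht => (hI.collect_spec ((hmem t).1 ht)).2.1) 0
  rw [(sortByUP_perm (collect I).val).length_eq] at h5
  omega

theorem Valid.piece_order (hI : Valid I) {M : ℕ} (hM : 0 < M) {x y : Tagged × ℕ × ℚ}
    (hx : x ∈ allPieces M I) (hy : y ∈ allPieces M I) :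
    (x.1.mass.uA < y.1.mass.uA → (pieceMass M I x).uA < (pieceMass M I y).uA) ∧
    (x.1.mass.uA = y.1.mass.uA → (pieceMass M I x).uA ≤ (pieceMass M I y).uA →
      x.1.mass.uP ≤ y.1.mass.uP) ∧
    ((pieceMass M I x).uA = (pieceMass M I y).uA → x = y) := by
  obtain ⟨hx1, -, -, hx2⟩ := hI.mem_allPieces hM hx
  obtain ⟨hy1, -, -, hy2⟩ := hI.mem_allPieces hM hy
  obtain ⟨hδ, hgap⟩ := chooseDelta_spec M (collect I).val (List.ne_nil_of_mem hx1)
  have lt_of : ∀ a ∈ allPieces M I, ∀ b ∈ allPieces M I, a.1.mass.uA < b.1.mass.uA →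
      (pieceMass M I a).uA < (pieceMass M I b).uA := by
    intro a ha b hb h
    obtain ⟨ha1, -, -, ha2⟩ := hI.mem_allPieces hM ha
    obtain ⟨hb1, -, -, hb2⟩ := hI.mem_allPieces hM hb
    have h1 := hgap _ ha1 _ hb1 h _ ha2
    have h2 : 0 ≤ delta M I * (b.2.1 : ℚ) := mul_nonneg hδ.le (Nat.cast_nonneg _)
    simp only [pieceMass, shifted]
    change delta M I * _ < _ at h1
    linarith
  have hnum : (allPieces M I).Pairwise fun a b => a.2.1 < b.2.1 := by
    rw [← List.pairwise_map (f := fun x : Tagged × ℕ × ℚ => x.2.1), allPieces, labeled_number]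
    exact List.pairwise_lt_range'
  have hsort : (allPieces M I).Pairwise fun a b => a.1.mass.uP ≤ b.1.mass.uP :=
    labeled_sorted (sortByUP_sorted _)
      (fun t ht => (hI.collect_spec ((sortByUP_perm _).mem_iff.1 ht)).1.le) hM 0
  -- The list of pieces is sorted strictly by number, and by principal utility.
  have hcmp : ∀ a ∈ allPieces M I, ∀ b ∈ allPieces M I, a = b ∨
      (a.2.1 < b.2.1 ∧ a.1.mass.uP ≤ b.1.mass.uP) ∨
      (b.2.1 < a.2.1 ∧ b.1.mass.uP ≤ a.1.mass.uP) := by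
    intro a ha b hb
    obtain ⟨i, hi, rfl⟩ := List.getElem_of_mem ha
    obtain ⟨j, hj, rfl⟩ := List.getElem_of_mem hb
    rcases lt_trichotomy i j with h | h | h
    · exact Or.inr (Or.inl ⟨List.pairwise_iff_getElem.1 hnum i j hi hj h,
        List.pairwise_iff_getElem.1 hsort i j hi hj h⟩)
    · subst h; exact Or.inl rfl
    · exact Or.inr (Or.inr ⟨List.pairwise_iff_getElem.1 hnum j i hj hi h,
        List.pairwise_iff_getElem.1 hsort j i hj hi h⟩)
  refine ⟨lt_of x hx y hy, fun h1 h2 => ?_, fun h => ?_⟩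
  · simp only [pieceMass, shifted, h1, add_le_add_iff_left] at h2
    have h3 := le_of_mul_le_mul_left h2 hδ
    have h4 : x.2.1 ≤ y.2.1 := by exact_mod_cast h3
    rcases hcmp x hx y hy with rfl | h | h
    · exact le_rfl
    · exact h.2
    · omega
  · have h1 : x.1.mass.uA = y.1.mass.uA := by
      rcases lt_trichotomy x.1.mass.uA y.1.mass.uA with h' | h' | h'
      · exact absurd h (lt_of x hx y hy h').ne
      · exact h'
      · exact absurd h (lt_of y hy x hx h').ne'
    simp only [pieceMass, shifted, h1, add_right_inj] at h
    have h3 : (x.2.1 : ℚ) = y.2.1 := mul_left_cancel₀ hδ.ne' h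
    have h4 : x.2.1 = y.2.1 := by exact_mod_cast h3
    rcases hcmp x hx y hy with rfl | h | h
    · rfl
    · omega
    · omega

/-- The properties of the distributions chosen in a preprocessed instance. -/
structure Separated (ε : ℚ) (ds : List Dist) : Prop where
  isProb : ∀ d ∈ ds, IsProb d
  prob_le : ∀ d ∈ ds, ∀ w ∈ d, w.prob ≤ ε
  nodup : ∀ d ∈ ds, (d.map Mass.uA).Nodup
  ne : ds.Pairwise fun d e => ∀ w ∈ d, ∀ v ∈ e, w.uA ≠ v.uA

theorem Valid.separated (hI : Valid I) {M : ℕ} (hM : 0 < M) {C : List ℕ} (hC : IsConfig I C) :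
    Separated (1 / (M : ℚ) ^ 2) (chosen (preprocess M I).val C) := by
  obtain ⟨hC1, hC2⟩ := isConfig_iff.1 hC
  have hmem : ∀ i c x, x ∈ piecesAt M I i c → x ∈ allPieces M I ∧ x.1.act = i := by
    intro i c x hx
    obtain ⟨h1, h2⟩ := List.mem_filter.1 hx
    simp only [hasTag, Bool.and_eq_true, decide_eq_true_eq] at h2
    exact ⟨h1, h2.1⟩
  have hchosen : ∀ d ∈ chosen (preprocess M I).val C, ∃ i c, i < I.length ∧
      c < (I.getD i []).length ∧ d = (piecesAt M I i c).map (pieceMass M I) := by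
    intro d hd
    rw [chosen_preprocess hC] at hd
    obtain ⟨i, hi, rfl⟩ := List.mem_mapIdx.1 hd
    have := hC2 i (hC1 ▸ hi)
    exact ⟨i, C[i], hC1 ▸ hi, by simpa [List.getD, hi] using this, rfl⟩
  refine ⟨fun d hd => ?_, fun d hd w hw => ?_, fun d hd => ?_, ?_⟩
  · obtain ⟨i, c, hi, hc, rfl⟩ := hchosen d hd
    refine ⟨fun w hw => ?_, fun w hw => ?_, ?_⟩
    · obtain ⟨x, hx, rfl⟩ := List.mem_map.1 hw
      exact (hI.mem_allPieces hM (hmem _ _ _ hx).1).2.1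
    · obtain ⟨x, hx, rfl⟩ := List.mem_map.1 hw
      exact (hI.collect_spec (hI.mem_allPieces hM (hmem _ _ _ hx).1).1).2.2
    · have h1 := avg_distAt M I i c fun _ => 1
      rw [(hI.isProb hi hc).1.sum_eq] at h1
      rw [avg, List.map_map]; exact h1.symm
  · obtain ⟨i, c, hi, hc, rfl⟩ := hchosen d hd
    obtain ⟨x, hx, rfl⟩ := List.mem_map.1 hw
    exact (hI.mem_allPieces hM (hmem _ _ _ hx).1).2.2.1
  · obtain ⟨i, c, hi, hc, rfl⟩ := hchosen d hd
    rw [List.map_map]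
    refine List.Nodup.map_on (fun x hx y hy h =>
      (hI.piece_order hM (hmem _ _ _ hx).1 (hmem _ _ _ hy).1).2.2 h) ?_
    refine List.Nodup.filter _ (List.Nodup.of_map (fun x => x.2.1) ?_)
    rw [allPieces, labeled_number]
    exact List.nodup_range'
  · rw [chosen_preprocess hC, List.pairwise_iff_getElem]
    intro i j hi hj hij w hw v hv h
    rw [List.getElem_mapIdx] at hw hv
    obtain ⟨x, hx, rfl⟩ := List.mem_map.1 hw
    obtain ⟨y, hy, rfl⟩ := List.mem_map.1 hv
    have hx := hmem _ _ _ hx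
    have hy := hmem _ _ _ hy
    have := (hI.piece_order hM hx.1 hy.1).2.2 h
    rw [this] at hx
    exact hij.ne (hx.2.symm.trans hy.2)

/-- Splitting the mass points of independent draws into pieces does not change an expectation. -/
theorem expect_eq_of_split {X : Type} (orig piece : X → Mass) {ds : List Dist} {Ts : List (List X)}
    {g g' : List Mass → ℚ}
    (h : List.Forall₂ (fun d T => ∀ h : Mass → ℚ,
      avg d h = (T.map fun x => (piece x).prob * h (orig x)).sum) ds Ts)
    (hg : ∀ τ, List.Forall₂ (fun T x => x ∈ T) Ts τ → g (τ.map orig) = g' (τ.map piece)) :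
    expect ds g = expect (Ts.map fun T => T.map piece) g' := by
  induction h generalizing g g' with
  | nil => exact hg [] .nil
  | @cons d T ds Ts hd _ ih =>
    rw [List.map_cons, expect_cons, expect_cons, hd, avg, List.map_map]
    congr 1
    refine List.map_congr_left fun x hx => ?_
    simp only [Function.comp]
    rw [ih (g' := fun ω => g' (piece x :: ω))]
    intro τ hτ
    exact hg (x :: τ) (.cons hx hτ)

/-- The preprocessing does not change the value of any configuration: the perturbation preserves
the strict preferences of the agent, and it breaks ties in favor of the principal. -/
theorem Valid.value_preprocess (hI : Valid I) {M : ℕ} (hM : 0 < M) {C : List ℕ}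
    (hC : IsConfig I C) : value (preprocess M I).val C = value I C := by
  unfold value
  have hmap : chosen (preprocess M I).val C =
      (C.mapIdx fun i c => piecesAt M I i c).map fun T => T.map (pieceMass M I) := by
    rw [chosen_preprocess hC]
    exact List.ext_getElem (by simp) fun i _ _ => by simp
  rw [hmap, chosen_eq_mapIdx hC]
  symm
  refine expect_eq_of_split (fun x => x.1.mass) (pieceMass M I) ?_ ?_
  · rw [List.forall₂_iff_get]
    refine ⟨by simp, fun i hi hi' => ?_⟩
    simpa using avg_distAt M I i _
  · intro τ hτ
    have hmem : ∀ x ∈ τ, x ∈ allPieces M I := by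
      have : ∀ Ts : List (List (Tagged × ℕ × ℚ)), (∀ T ∈ Ts, ∀ x ∈ T, x ∈ allPieces M I) →
          ∀ τ, List.Forall₂ (fun T x => x ∈ T) Ts τ → ∀ x ∈ τ, x ∈ allPieces M I := by
        intro Ts hTs τ h
        induction h with
        | nil => simp
        | cons hx _ ih =>
          simp only [List.mem_cons, forall_eq_or_imp] at hTs ⊢
          exact ⟨hTs.1 _ hx, ih hTs.2⟩
      refine this _ (fun T hT x hx => ?_) τ hτ
      obtain ⟨i, hi, rfl⟩ := List.mem_mapIdx.1 hT
      exact (List.mem_filter.1 hx).1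
    have horder := fun x hx y hy => hI.piece_order hM (hmem x hx) (hmem y hy)
    -- A piece that the agent likes best comes from a mass point that the agent likes best.
    have hmax : ∀ x ∈ τ, (∀ y ∈ τ, (pieceMass M I y).uA ≤ (pieceMass M I x).uA) →
        ∀ y ∈ τ, y.1.mass.uA ≤ x.1.mass.uA := fun x hx h y hy => by
      by_contra hlt
      exact absurd (h y hy) (not_le.2 ((horder x hx y hy).1 (not_le.1 hlt)))
    apply le_antisymm
    · rw [principalUtil_le_iff]
      refine ⟨principalUtil_nonneg _, ?_⟩
      simp only [List.mem_map, forall_exists_index, and_imp, forall_apply_eq_imp_iff₂]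
      intro x hx h
      obtain ⟨_, hm, hz'⟩ := exists_favorite (ω := τ.map (pieceMass M I))
        (by simpa using List.ne_nil_of_mem hx)
      obtain ⟨z, hz, rfl⟩ := List.mem_map.1 hm
      refine le_trans ?_ (le_principalUtil hm hz')
      simp only [List.mem_map, forall_exists_index, and_imp, forall_apply_eq_imp_iff₂] at hz'
      have h1 := hmax z hz hz' x hx
      exact (horder x hx z hz).2.1 (le_antisymm h1 (h z hz)) (hz' x hx)
    · rw [principalUtil_le_iff]
      refine ⟨principalUtil_nonneg _, ?_⟩
      simp only [List.mem_map, forall_exists_index, and_imp, forall_apply_eq_imp_iff₂]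
      intro x hx h
      refine le_principalUtil (w := x.1.mass) (List.mem_map_of_mem (f := fun x => x.1.mass) hx) ?_
      simp only [List.mem_map, forall_exists_index, and_imp, forall_apply_eq_imp_iff₂]
      exact hmax x hx h


/-! ### Evaluating a configuration through the distribution of the favorite -/

theorem principalUtil_le_of {ω ω' : List Mass}
    (h : ∀ w ∈ ω, (∀ v ∈ ω, v.uA ≤ w.uA) →
      ∃ w' ∈ ω', (∀ v ∈ ω', v.uA ≤ w'.uA) ∧ w.uP ≤ w'.uP) :
    principalUtil ω ≤ principalUtil ω' :=
  principalUtil_le_iff.2 ⟨principalUtil_nonneg _, fun w hw hmax => by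
    obtain ⟨w', h1, h2, h3⟩ := h w hw hmax
    exact h3.trans (le_principalUtil h1 h2)⟩

theorem principalUtil_set_prob (w : Mass) (p : ℚ) (ω : List Mass) :
    principalUtil (⟨w.uA, w.uP, p⟩ :: ω) = principalUtil (w :: ω) := by
  apply le_antisymm <;>
  · refine principalUtil_le_of fun x hx hmax => ?_
    simp only [List.mem_cons, forall_eq_or_imp] at hmax
    rcases List.mem_cons.1 hx with rfl | hx
    · exact ⟨_, List.mem_cons_self, by simpa using hmax, le_rfl⟩
    · exact ⟨x, by simp [hx], by simpa using hmax, le_rfl⟩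

theorem principalUtil_drop {w v : Mass} (h : v.uA < w.uA) (ω : List Mass) :
    principalUtil (w :: v :: ω) = principalUtil (w :: ω) ∧
      principalUtil (v :: w :: ω) = principalUtil (w :: ω) := by
  refine ⟨le_antisymm ?_ ?_, le_antisymm ?_ ?_⟩ <;>
  · refine principalUtil_le_of fun x hx hmax => ⟨x, ?_, ?_, le_rfl⟩
    · simp only [List.mem_cons, forall_eq_or_imp] at hmax hx ⊢
      have : x ≠ v := by rintro rfl; linarith
      tauto
    · simp only [List.mem_cons, forall_eq_or_imp] at hmax ⊢
      refine ⟨?_, ?_⟩ <;> grind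

theorem principalUtil_singleton {w : Mass} (h : 0 ≤ w.uP) : principalUtil [w] = w.uP :=
  le_antisymm (principalUtil_le_iff.2 ⟨h, by simp⟩) (le_principalUtil (by simp) (by simp))

theorem avg_comm (d e : Dist) (F : Mass → Mass → ℚ) :
    avg d (fun w => avg e fun v => F w v) = avg e fun v => avg d fun w => F w v := by
  induction d with
  | nil => simp
  | cons w d ih => simp only [avg_cons, ih, avg_add, avg_mul_left]

theorem avg_restrict (d e : Dist) {h : Mass → ℚ}
    (hh : ∀ w : Mass, ∀ p, h ⟨w.uA, w.uP, p⟩ = h w) :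
    avg (restrict d e).val h = avg d fun w => pr e (fun u => decide (u < w.uA)) * h w := by
  simp only [restrict, mapC_val, Cost.bind_val, sumMassC_prob, mulQ_val, Cost.pure_val, ltQ_val,
    avg, List.map_map, pr]
  congr 1
  refine List.map_congr_left fun w _ => ?_
  simp only [Function.comp, hh]
  ring

theorem mem_restrict {d e : Dist} {w : Mass} (h : w ∈ (restrict d e).val) :
    ∃ v ∈ d, w.uA = v.uA ∧ w.uP = v.uP := by
  simp only [restrict, mapC_val, List.mem_map] at h
  obtain ⟨v, hv, rfl⟩ := h
  exact ⟨v, hv, rfl, rfl⟩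

theorem combine_val (acc d : Dist) :
    (combine acc d).val = (restrict acc d).val ++ (restrict d acc).val := by
  simp [combine]

theorem mem_combine {acc d : Dist} {w : Mass} (h : w ∈ (combine acc d).val) :
    ∃ v, (v ∈ acc ∨ v ∈ d) ∧ w.uA = v.uA ∧ w.uP = v.uP := by
  rw [combine_val, List.mem_append] at h
  rcases h with h | h
  · obtain ⟨v, hv, h⟩ := mem_restrict h
    exact ⟨v, Or.inl hv, h⟩
  · obtain ⟨v, hv, h⟩ := mem_restrict h
    exact ⟨v, Or.inr hv, h⟩

theorem expect_combine {acc d : Dist} (ds : List Dist)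
    (hne : ∀ w ∈ acc, ∀ v ∈ d, w.uA ≠ v.uA) :
    expect ((combine acc d).val :: ds) principalUtil = expect (acc :: d :: ds) principalUtil := by
  have hh : ∀ (w : Mass) (p : ℚ), expect ds (fun ω => principalUtil (⟨w.uA, w.uP, p⟩ :: ω)) =
      expect ds fun ω => principalUtil (w :: ω) := fun w p => by
    simp only [principalUtil_set_prob]
  rw [expect_cons, combine_val, avg_append, avg_restrict _ _ hh, avg_restrict _ _ hh]
  simp only [pr, expect_cons, ← avg_mul_right]
  rw [avg_comm d acc, ← avg_add]
  refine avg_congr fun w hw => ?_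
  rw [← avg_add]
  refine avg_congr fun v hv => ?_
  rcases lt_or_gt_of_ne (hne w hw v hv) with h | h
  · simp [h, h.not_gt, (principalUtil_drop h _).2]
  · simp [h, h.not_gt, (principalUtil_drop h _).1]

theorem favorite_val (acc : Dist) (ds : List Dist) (hP : ∀ w ∈ acc, 0 ≤ w.uP)
    (hdP : ∀ d ∈ ds, ∀ w ∈ d, 0 ≤ w.uP)
    (hne : (acc :: ds).Pairwise fun d e => ∀ w ∈ d, ∀ v ∈ e, w.uA ≠ v.uA) :
    avg (favorite acc ds).val (fun w => w.uP) = expect (acc :: ds) principalUtil := by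
  induction ds generalizing acc with
  | nil =>
    simp only [favorite, Cost.bind_val, Cost.pure_val, expect_cons, expect_nil]
    exact avg_congr fun w hw => (principalUtil_singleton (hP w hw)).symm
  | cons d ds ih =>
    simp only [List.pairwise_cons, List.mem_cons, forall_eq_or_imp] at hne hdP
    simp only [favorite, Cost.bind_val]
    rw [← expect_combine ds hne.1.1]
    refine ih _ (fun w hw => ?_) hdP.2 (List.pairwise_cons.2 ⟨fun e he w hw v hv => ?_, hne.2.2⟩)
    · obtain ⟨x, hx | hx, -, h⟩ := mem_combine hw
      · exact h ▸ hP x hx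
      · exact h ▸ hdP.1 x hx
    · obtain ⟨x, hx | hx, h, -⟩ := mem_combine hw
      · exact h ▸ hne.1.2 e he x hx v hv
      · exact h ▸ hne.2.1 e he x hx v hv

theorem chosenC_val (I : Inst) (C : List ℕ) : (chosenC I C).val = chosen I C := by
  unfold chosen
  induction I generalizing C with
  | nil => simp [chosenC]
  | cons cfgs I ih => cases C <;> simp [chosenC, ih]

theorem Separated.evaluate_val {ε : ℚ} {ds : List Dist} (h : Separated ε ds) (hne : ds ≠ []) :
    (evaluate ds).val = expect ds principalUtil := by
  cases ds with
  | nil => exact absurd rfl hne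
  | cons d ds =>
    have h1 := fun e he => (h.isProb e he).uP_nonneg
    simp only [List.mem_cons, forall_eq_or_imp] at h1
    rw [← favorite_val d ds h1.1 h1.2 h.ne]
    simp [evaluate, sumMassC_prob_mul]

/-! ### The dynamic program -/

/-- The configuration `C` picks the entries `es`, one from each list of `ss`. -/
inductive Picks : List (List (ℚ × List ℕ)) → List ℕ → List (ℚ × List ℕ) → Prop
  | nil : Picks [] [] []
  | cons {s : List (ℚ × List ℕ)} {ss : List (List (ℚ × List ℕ))} {c : ℕ} {C : List ℕ}
      {e : ℚ × List ℕ} {es : List (ℚ × List ℕ)} :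
      s[c]? = some e → Picks ss C es → Picks (s :: ss) (c :: C) (e :: es)

/-- The vector `k` plus the vectors of the given entries. -/
def load : List ℕ → List (ℚ × List ℕ) → List ℕ
  | k, [] => k
  | k, e :: es => load (List.zipWith (· + ·) k e.2) es

theorem lookup_map (keys : List (List ℕ)) (F : List ℕ → Option (ℚ × List ℕ)) (k : List ℕ) :
    (lookup k (keys.map fun k => (k, F k))).val = if k ∈ keys then F k else none := by
  induction keys with
  | nil => simp [lookup]
  | cons a keys ih =>
    by_cases h : k = a
    · simp [lookup, h]
    · simp [lookup, h, ih]

theorem bestChoice_cons_none {T : Table} {k : List ℕ} {c : ℕ} {s : ℚ × List ℕ}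
    {ss : List (ℚ × List ℕ)} (h : (lookup (List.zipWith (· + ·) k s.2) T).val = none) :
    (bestChoice T k c (s :: ss)).val = (bestChoice T k (c + 1) ss).val := by
  simp [bestChoice, h]

theorem bestChoice_cons_some {T : Table} {k : List ℕ} {c : ℕ} {s : ℚ × List ℕ}
    {ss : List (ℚ × List ℕ)} {v : ℚ} {C : List ℕ}
    (h : (lookup (List.zipWith (· + ·) k s.2) T).val = some (v, C)) :
    (bestChoice T k c (s :: ss)).val = match (bestChoice T k (c + 1) ss).val with
      | none => some (s.1 + v, c :: C)
      | some (x, X) => if x ≤ s.1 + v then some (s.1 + v, c :: C) else some (x, X) := by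
  cases h' : (bestChoice T k (c + 1) ss).val <;> simp [bestChoice, h, h']

theorem bestChoice_sound {T : Table} {k : List ℕ} {ss : List (ℚ × List ℕ)} {c : ℕ} {v : ℚ}
    {C : List ℕ} (h : (bestChoice T k c ss).val = some (v, C)) :
    ∃ j e v' C', ss[j]? = some e ∧ C = (c + j) :: C' ∧ v = e.1 + v' ∧
      (lookup (List.zipWith (· + ·) k e.2) T).val = some (v', C') := by
  induction ss generalizing c v C with
  | nil => simp [bestChoice] at h
  | cons s ss ih =>
    have step : (bestChoice T k (c + 1) ss).val = some (v, C) → ∃ j e v' C',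
        (s :: ss)[j]? = some e ∧ C = (c + j) :: C' ∧ v = e.1 + v' ∧
          (lookup (List.zipWith (· + ·) k e.2) T).val = some (v', C') := fun h => by
      obtain ⟨j, e, v', C', h1, h2, h3⟩ := ih h
      exact ⟨j + 1, e, v', C', by simpa using h1, by rw [h2]; congr 1; omega, h3⟩
    cases hl : (lookup (List.zipWith (· + ·) k s.2) T).val with
    | none => exact step (by rwa [bestChoice_cons_none hl] at h)
    | some e =>
      obtain ⟨v', C'⟩ := e
      rw [bestChoice_cons_some hl] at h
      have here : (s.1 + v', c :: C') = (v, C) → ∃ j e v' C',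
          (s :: ss)[j]? = some e ∧ C = (c + j) :: C' ∧ v = e.1 + v' ∧
            (lookup (List.zipWith (· + ·) k e.2) T).val = some (v', C') := fun h => by
        cases h
        exact ⟨0, s, v', C', by simp, by simp, rfl, hl⟩
      cases ho : (bestChoice T k (c + 1) ss).val with
      | none => rw [ho] at h; exact here (Option.some.inj h)
      | some o =>
        rw [ho] at h
        by_cases hx : o.1 ≤ s.1 + v'
        · simp only [hx, if_true] at h
          exact here (Option.some.inj h)
        · simp only [hx, if_false] at h
          exact step (ho.trans h)

theorem bestChoice_optimal {T : Table} {k : List ℕ} {ss : List (ℚ × List ℕ)} {c : ℕ} {j : ℕ}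
    {e : ℚ × List ℕ} {v' : ℚ} {C' : List ℕ} (hj : ss[j]? = some e)
    (hl : (lookup (List.zipWith (· + ·) k e.2) T).val = some (v', C')) :
    ∃ v C, (bestChoice T k c ss).val = some (v, C) ∧ e.1 + v' ≤ v := by
  induction ss generalizing c j with
  | nil => simp at hj
  | cons s ss ih =>
    cases j with
    | zero =>
      obtain rfl : s = e := by simpa using hj
      rw [bestChoice_cons_some hl]
      cases ho : (bestChoice T k (c + 1) ss).val with
      | none => exact ⟨_, _, rfl, le_rfl⟩
      | some o =>
        by_cases hx : o.1 ≤ s.1 + v'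
        · simp only [hx, if_true]
          exact ⟨_, _, rfl, le_rfl⟩
        · simp only [hx, if_false]
          exact ⟨_, _, rfl, (not_le.1 hx).le⟩
    | succ j =>
      obtain ⟨v, C, h1, h2⟩ := ih (c := c + 1) (by simpa using hj)
      cases hs : (lookup (List.zipWith (· + ·) k s.2) T).val with
      | none => exact ⟨v, C, by rw [bestChoice_cons_none hs, h1], h2⟩
      | some o =>
        rw [bestChoice_cons_some (v := o.1) (C := o.2) hs, h1]
        by_cases hx : v ≤ s.1 + o.1
        · simp only [hx, if_true]
          exact ⟨_, _, rfl, h2.trans hx⟩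
        · simp only [hx, if_false]
          exact ⟨_, _, rfl, h2⟩

theorem table_nil_val (M D : ℕ) (bins : List Bin) (keys : List (List ℕ)) :
    (table M D bins keys []).val = keys.map fun k =>
      (k, if (feasible M D bins k).val then some (0, []) else none) := by
  simp only [table, Cost.bind_val, mapC_val]
  refine List.map_congr_left fun k _ => ?_
  by_cases h : (feasible M D bins k).val <;> simp [h]

theorem table_cons_val (M D : ℕ) (bins : List Bin) (keys : List (List ℕ))
    (s : List (ℚ × List ℕ)) (ss : List (List (ℚ × List ℕ))) :
    (table M D bins keys (s :: ss)).val = keys.map fun k =>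
      (k, (bestChoice (table M D bins keys ss).val k 0 s).val) := by
  simp [table]

theorem table_sound {M D : ℕ} {bins : List Bin} {keys : List (List ℕ)}
    {ss : List (List (ℚ × List ℕ))} {k : List ℕ} {v : ℚ} {C : List ℕ}
    (h : (lookup k (table M D bins keys ss).val).val = some (v, C)) :
    ∃ es, Picks ss C es ∧ v = (es.map Prod.fst).sum ∧
      (feasible M D bins (load k es)).val = true := by
  induction ss generalizing k v C with
  | nil =>
    rw [table_nil_val, lookup_map] at h
    split_ifs at h with h1 h2
    obtain ⟨rfl, rfl⟩ := Prod.mk.inj (Option.some.inj h)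
    exact ⟨[], .nil, rfl, h2⟩
  | cons s ss ih =>
    rw [table_cons_val, lookup_map] at h
    split_ifs at h with h1
    obtain ⟨j, e, v', C', h2, rfl, rfl, h4⟩ := bestChoice_sound h
    obtain ⟨es, h5, rfl, h6⟩ := ih h4
    exact ⟨e :: es, .cons (by simpa using h2) h5, by simp, h6⟩

theorem load_bounds {m N : ℕ} {es : List (ℚ × List ℕ)} (hes : ∀ e ∈ es, e.2.length = m)
    {k : List ℕ} (hk : k.length = m) (h : ∀ x ∈ load k es, x ≤ N) : ∀ x ∈ k, x ≤ N := by
  induction es generalizing k with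
  | nil => exact h
  | cons e es ih =>
    simp only [List.mem_cons, forall_eq_or_imp] at hes
    have h1 := ih hes.2 (by simp [hk, hes.1]) h
    intro x hx
    obtain ⟨i, hi, rfl⟩ := List.getElem_of_mem hx
    have hi' : i < (List.zipWith (· + ·) k e.2).length := by simp [hk, hes.1] at hi ⊢; omega
    have := h1 _ (List.getElem_mem hi')
    rw [List.getElem_zipWith] at this
    omega

theorem table_optimal {M D N m : ℕ} {bins : List Bin} {keys : List (List ℕ)}
    (hkeys : ∀ k, k.length = m → (∀ x ∈ k, x ≤ N) → k ∈ keys)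
    {ss : List (List (ℚ × List ℕ))} {C : List ℕ} {es : List (ℚ × List ℕ)} (hp : Picks ss C es)
    (hes : ∀ e ∈ es, e.2.length = m) {k : List ℕ} (hk : k.length = m)
    (hN : ∀ x ∈ load k es, x ≤ N) (hf : (feasible M D bins (load k es)).val = true) :
    ∃ v C', (lookup k (table M D bins keys ss).val).val = some (v, C') ∧
      (es.map Prod.fst).sum ≤ v := by
  induction hp generalizing k with
  | nil =>
    refine ⟨0, [], ?_, le_rfl⟩
    rw [table_nil_val, lookup_map, if_pos (hkeys k hk hN)]
    simpa [load] using hf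
  | @cons s ss c C e es hc _ ih =>
    have hk' := hkeys k hk (load_bounds hes hk hN)
    simp only [List.mem_cons, forall_eq_or_imp] at hes
    obtain ⟨v, C', h1, h2⟩ := ih hes.2 (k := List.zipWith (· + ·) k e.2)
      (by simp [hk, hes.1]) hN hf
    obtain ⟨v', C'', h3, h4⟩ := bestChoice_optimal (c := 0) hc h1
    refine ⟨v', C'', ?_, ?_⟩
    · rw [table_cons_val, lookup_map, if_pos hk', h3]
    · simp only [List.map_cons, List.sum_cons]
      linarith

theorem picks_iff (f : Dist → ℚ × List ℕ) {I : Inst} {C : List ℕ} {es : List (ℚ × List ℕ)} :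
    Picks (I.map fun cfgs => cfgs.map f) C es ↔ IsConfig I C ∧ es = (chosen I C).map f := by
  constructor
  · intro h
    generalize hJ : (I.map fun cfgs => cfgs.map f) = J at h
    induction h generalizing I with
    | nil =>
      obtain rfl : I = [] := by simpa using hJ
      exact ⟨.nil, rfl⟩
    | @cons s ss c C e es hc _ ih =>
      cases I with
      | nil => simp at hJ
      | cons cfgs I =>
        simp only [List.map_cons, List.cons.injEq] at hJ
        obtain ⟨h1, h2⟩ := ih hJ.2
        rw [← hJ.1, List.getElem?_map, Option.map_eq_some_iff] at hc
        obtain ⟨d, hd, rfl⟩ := hc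
        obtain ⟨hlt, rfl⟩ := List.getElem?_eq_some_iff.1 hd
        exact ⟨.cons hlt h1, by rw [h2]; simp [chosen, List.getD, hlt]⟩
  · rintro ⟨h, rfl⟩
    unfold IsConfig at h
    induction h with
    | nil => exact .nil
    | @cons cfgs c I C hc _ ih => exact .cons (by simp [List.getD, hc]) ih


/-! ### Bins, objective and constraints for a given profile -/

/-- Membership in `B_{≤ j}` for the profile `U 1 ≤ … ≤ U M`. -/
def cum (M : ℕ) (U : ℕ → ℚ) (j : ℕ) (u : ℚ) : Bool :=
  if j = 0 then false else if j = M then decide (u ≤ U M) else decide (u < U j)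

/-- The bin `B_j` for the profile `U 1 ≤ … ≤ U M`. -/
def binOf (M : ℕ) (U : ℕ → ℚ) (j : ℕ) : Bin :=
  ⟨j, if j = 1 then none else some (U (j - 1)), U j, decide (j = M)⟩

/-- The profile `[U 1, …, U M]`. -/
def profile (M : ℕ) (U : ℕ → ℚ) : List ℚ := (List.range' 1 M).map U

theorem mkBins_val (M : ℕ) (U : ℕ → ℚ) (n j : ℕ) (hj : 1 ≤ j) (hn : j + n = M + 1) :
    (mkBins j (if j = 1 then none else some (U (j - 1))) ((List.range' j n).map U)).val =
      (List.range' j n).map (binOf M U) := by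
  induction n generalizing j with
  | zero => simp [mkBins]
  | succ n ih =>
    cases n with
    | zero => simp [mkBins, binOf]; omega
    | succ n =>
      have h := ih (j + 1) (by omega) (by omega)
      have h1 : j + 1 ≠ 1 := by omega
      have h2 : j ≠ M := by omega
      simp only [h1, if_false, Nat.add_sub_cancel] at h
      rw [List.range'_succ (n := n + 1), List.range'_succ (n := n)] at *
      simp only [List.map_cons] at h ⊢
      simp [mkBins, h, binOf, h2]

theorem mkBins_profile (M : ℕ) (U : ℕ → ℚ) :
    (mkBins 1 none (profile M U)).val = (List.range' 1 M).map (binOf M U) :=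
  mkBins_val M U M 1 le_rfl (by omega)

theorem memCum_val {M : ℕ} {U : ℕ → ℚ} {j : ℕ} (hj : 1 ≤ j) (u : ℚ) :
    ((binOf M U j).memCum u).val = cum M U j u := by
  have h0 : j ≠ 0 := by omega
  by_cases h : j = M
  · subst h; simp [Bin.memCum, binOf, cum, h0]
  · simp [Bin.memCum, binOf, cum, h0, h]

theorem mem_val {M : ℕ} {U : ℕ → ℚ} {j : ℕ} (hj : 1 ≤ j) (hjM : j ≤ M) (u : ℚ) :
    ((binOf M U j).mem u).val = between (cum M U (j - 1)) (cum M U j) u := by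
  rw [between, ← memCum_val hj]
  by_cases h1 : j = 1
  · subst h1
    simp [Bin.mem, binOf, cum]
  · have h2 : j - 1 ≠ 0 := by omega
    have h3 : j - 1 ≠ M := by omega
    have h4 : (binOf M U j).lo = some (U (j - 1)) := by simp [binOf, h1]
    have h5 : cum M U (j - 1) u = decide (u < U (j - 1)) := by simp [cum, h2, h3]
    rw [h5, Bin.mem, h4]
    by_cases h : U (j - 1) ≤ u
    · simp [h, h.not_gt]
    · simp [h, not_le.1 h]

theorem condProb_val {M : ℕ} {U : ℕ → ℚ} {j : ℕ} (hj : 1 ≤ j) (hjM : j ≤ M) (d : Dist) :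
    (condProb d (binOf M U j)).val = condPr (cum M U (j - 1)) (cum M U j) d := by
  simp only [condProb, Cost.bind_val, sumMassC_prob, divQ_val, mem_val hj hjM, memCum_val hj]
  rfl

theorem condUtil_val {M : ℕ} {U : ℕ → ℚ} {j : ℕ} (hj : 1 ≤ j) (hjM : j ≤ M) (d : Dist) :
    (condUtil d (binOf M U j)).val =
      binUtil d (cum M U (j - 1)) (cum M U j) / pr d (cum M U j) := by
  simp only [condUtil, Cost.bind_val, sumMassC_prob, sumMassC_prob_mul, divQ_val, mem_val hj hjM,
    memCum_val hj]
  rfl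

/-- The objective `ψ` of one action, as a function of its distribution. -/
def objective (M : ℕ) (U : ℕ → ℚ) (d : Dist) : ℚ :=
  ((List.range' 1 M).map fun j => if 6 ≤ j then
    weight M j * (binUtil d (cum M U (j - 1)) (cum M U j) / pr d (cum M U j)) else 0).sum

theorem psi_val (M : ℕ) (U : ℕ → ℚ) (d : Dist) :
    (psi M d ((List.range' 1 M).map (binOf M U))).val = objective M U d := by
  have : ∀ L : List ℕ, (∀ j ∈ L, 1 ≤ j ∧ j ≤ M) → (psi M d (L.map (binOf M U))).val =
      (L.map fun j => if 6 ≤ j then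
        weight M j * (binUtil d (cum M U (j - 1)) (cum M U j) / pr d (cum M U j)) else 0).sum := by
    intro L hL
    induction L with
    | nil => simp [psi]
    | cons j L ih =>
      simp only [List.mem_cons, forall_eq_or_imp] at hL
      have hidx : (binOf M U j).idx = j := rfl
      by_cases h : 6 ≤ j
      · simp [psi, ih hL.2, hidx, h, condUtil_val hL.1.1 hL.1.2]
      · simp [psi, ih hL.2, hidx, h]
  exact this _ fun j hj => by rw [List.mem_range'_1] at hj; omega

/-- The rounded conditional bin probability, in multiples of `1/D`. -/
def count (M D : ℕ) (U : ℕ → ℚ) (d : Dist) (j : ℕ) : ℕ :=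
  ⌊condPr (cum M U (j - 1)) (cum M U j) d * D⌋₊

theorem counts_val (M D : ℕ) (U : ℕ → ℚ) (d : Dist) :
    (counts D d ((List.range' 1 M).map (binOf M U))).val =
      (List.range' 1 M).map (count M D U d) := by
  simp only [counts, mapC_val, List.map_map, Cost.bind_val, mulQ_val, floorQ_val]
  refine List.map_congr_left fun j hj => ?_
  rw [List.mem_range'_1] at hj
  simp [Function.comp, count, condProb_val hj.1 (by omega : j ≤ M)]

theorem stat_val (M D : ℕ) (U : ℕ → ℚ) (d : Dist) :
    (stat M D ((List.range' 1 M).map (binOf M U)) d).val =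
      (objective M U d, (List.range' 1 M).map (count M D U d)) := by
  simp [stat, psi_val, counts_val]

/-- The total rounded estimate for bin `j`, in multiples of `1/D`. -/
def totalCount (M D : ℕ) (U : ℕ → ℚ) (ds : List Dist) (j : ℕ) : ℕ :=
  (ds.map fun d => count M D U d j).sum

theorem load_stats (M D : ℕ) (U : ℕ → ℚ) (ds : List Dist) (z : ℕ → ℕ) :
    load ((List.range' 1 M).map z)
      (ds.map fun d => (objective M U d, (List.range' 1 M).map (count M D U d))) =
      (List.range' 1 M).map fun j => z j + totalCount M D U ds j := by
  induction ds generalizing z with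
  | nil => simp [load, totalCount]
  | cons d ds ih =>
    have h : List.zipWith (· + ·) ((List.range' 1 M).map z)
        ((List.range' 1 M).map (count M D U d)) =
        (List.range' 1 M).map fun j => z j + count M D U d j := by
      rw [List.zipWith_map, List.zipWith_self]
    simp only [List.map_cons, load, h, ih]
    simp [totalCount, add_assoc]

/-- The constraints of the program on the total rounded estimates. -/
def Meets (M D : ℕ) (k : ℕ → ℕ) : Prop := ∀ j, 1 ≤ j → j ≤ M →
  lowerBound M j ≤ (k j : ℚ) / D ∧ (2 ≤ j → (k j : ℚ) / D ≤ upperBound M j)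

theorem feasible_iff (M D : ℕ) (U : ℕ → ℚ) (k : ℕ → ℕ) :
    (feasible M D ((List.range' 1 M).map (binOf M U)) ((List.range' 1 M).map k)).val = true ↔
      Meets M D k := by
  have : ∀ L : List ℕ, (feasible M D (L.map (binOf M U)) (L.map k)).val = true ↔
      ∀ j ∈ L, lowerBound M j ≤ (k j : ℚ) / D ∧ (2 ≤ j → (k j : ℚ) / D ≤ upperBound M j) := by
    intro L
    induction L with
    | nil => simp [feasible]
    | cons j L ih =>
      have hidx : (binOf M U j).idx = j := rfl
      simp only [List.map_cons, feasible, Cost.bind_val, divQ_val, leQ_val, hidx, leN_val,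
        List.mem_cons, forall_eq_or_imp, ← ih]
      by_cases h1 : lowerBound M j ≤ (k j : ℚ) / D
      · by_cases h2 : j ≤ 1
        · have : ¬ 2 ≤ j := by omega
          simp [h1, h2, this]
        · have : 2 ≤ j := by omega
          by_cases h3 : (k j : ℚ) / D ≤ upperBound M j
          · simp [h1, h2, h3]
          · simp [h1, h2, h3, this]
      · simp [h1]
  rw [this]
  refine forall_congr' fun j => ?_
  rw [List.mem_range'_1]
  constructor
  · intro h h1 h2; exact h ⟨h1, by omega⟩
  · intro h h1; exact h h1.1 (by omega)

/-- The objective of a configuration. -/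
def totalObjective (M : ℕ) (U : ℕ → ℚ) (ds : List Dist) : ℚ := (ds.map (objective M U)).sum

theorem solve_val (M n : ℕ) (keys : List (List ℕ)) (I : Inst) (U : ℕ → ℚ) :
    (solve M n keys I ((List.range' 1 M).map (binOf M U))).val =
      (lookup ((List.range' 1 M).map fun _ => 0)
        (table M (M ^ 2 * n) ((List.range' 1 M).map (binOf M U)) keys
          (I.map fun cfgs => cfgs.map fun d => (objective M U d,
            (List.range' 1 M).map (count M (M ^ 2 * n) U d)))).val).val.map Prod.snd := by
  simp only [solve, Cost.bind_val, mulN_val, mapC_val, stat_val, Cost.pure_val, List.map_map,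
    Function.comp_def]
  cases h : (lookup ((List.range' 1 M).map fun _ => 0)
        (table M (M ^ 2 * n) ((List.range' 1 M).map (binOf M U)) keys
          (I.map fun cfgs => cfgs.map fun d => (objective M U d,
            (List.range' 1 M).map (count M (M ^ 2 * n) U d)))).val).val <;> rfl

/-- If some configuration meets the constraints, then the dynamic program finds one, whose objective
is at least as large. -/
theorem solve_optimal {M n N : ℕ} {keys : List (List ℕ)} {I : Inst} {U : ℕ → ℚ}
    (hkeys : ∀ k, k.length = M → (∀ x ∈ k, x ≤ N) → k ∈ keys) {C : List ℕ} (hC : IsConfig I C)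
    (hN : ∀ j, 1 ≤ j → j ≤ M → totalCount M (M ^ 2 * n) U (chosen I C) j ≤ N)
    (hf : Meets M (M ^ 2 * n) (totalCount M (M ^ 2 * n) U (chosen I C))) :
    ∃ C', (solve M n keys I ((List.range' 1 M).map (binOf M U))).val = some C' ∧ IsConfig I C' ∧
      Meets M (M ^ 2 * n) (totalCount M (M ^ 2 * n) U (chosen I C')) ∧
      totalObjective M U (chosen I C) ≤ totalObjective M U (chosen I C') := by
  rw [solve_val]
  have hp := (picks_iff (fun d => (objective M U d,
    (List.range' 1 M).map (count M (M ^ 2 * n) U d)))).2 ⟨hC, rfl⟩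
  obtain ⟨v, C', h1, h2⟩ := table_optimal (D := M ^ 2 * n)
    (bins := (List.range' 1 M).map (binOf M U)) hkeys hp
    (k := (List.range' 1 M).map fun _ => 0) (by
      intro e he
      obtain ⟨d, -, rfl⟩ := List.mem_map.1 he
      simp) (by simp) (by
      rw [load_stats]
      intro x hx
      obtain ⟨j, hj, rfl⟩ := List.mem_map.1 hx
      rw [List.mem_range'_1] at hj
      simpa using hN j hj.1 (by omega)) (by
      rw [load_stats, feasible_iff]
      simpa using hf)
  obtain ⟨es, h3, h4, h5⟩ := table_sound h1
  obtain ⟨h6, rfl⟩ := (picks_iff _).1 h3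
  rw [load_stats, feasible_iff] at h5
  refine ⟨C', by rw [h1]; rfl, h6, by simpa using h5, ?_⟩
  rw [h4] at h2
  simpa [totalObjective, List.map_map, Function.comp_def] using h2

theorem solve_isConfig {M n : ℕ} {keys : List (List ℕ)} {I : Inst} {bins : List Bin} {C : List ℕ}
    (h : (solve M n keys I bins).val = some C) : IsConfig I C := by
  simp only [solve, Cost.bind_val, mulN_val, mapC_val, Cost.pure_val] at h
  have hp : ∀ e : Option (ℚ × List ℕ), (match e with
      | none => (pure none : Cost (Option (List ℕ)))
      | some (_, C) => pure (some C)).val = some C → ∃ v, e = some (v, C) := by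
    rintro (_ | ⟨v, C'⟩) h
    · simp at h
    · exact ⟨v, by simpa using h⟩
  obtain ⟨v, hv⟩ := hp _ h
  obtain ⟨es, h1, -⟩ := table_sound hv
  exact ((picks_iff fun d => (stat M (M ^ 2 * n) bins d).val).1 h1).1

/-! ### The main loop -/

/-- Every configuration that the main loop holds comes with its evaluation. -/
def Honest (I : Inst) (o : Option (ℚ × List ℕ)) : Prop :=
  ∀ x ∈ o, IsConfig I x.2 ∧ x.1 = (evaluate (chosen I x.2)).val

/-- The stored value is at least `v`. -/
def AtLeast (o : Option (ℚ × List ℕ)) (v : ℚ) : Prop := ∃ x ∈ o, v ≤ x.1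

/-- One pass of the main loop keeps the better one of two configurations. -/
theorem mainLoop_cons (M n : ℕ) (keys : List (List ℕ)) (I : Inst) (u : List ℚ)
    (us : List (List ℚ)) (best : Option (ℚ × List ℕ)) (hb : Honest I best) :
    ∃ best', Honest I best' ∧ (mainLoop M n keys I (u :: us) best).val =
        (mainLoop M n keys I us best').val ∧ (∀ v, AtLeast best v → AtLeast best' v) ∧
      ∀ C, (sortedC u).val = true → (solve M n keys I (mkBins 1 none u).val).val = some C →
        AtLeast best' (evaluate (chosen I C)).val := by
  by_cases hs : (sortedC u).val = true
  · cases hsol : (solve M n keys I (mkBins 1 none u).val).val with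
    | none => exact ⟨best, hb, by simp [mainLoop, hs, hsol], fun v h => h, by simp⟩
    | some C =>
      have hC := solve_isConfig hsol
      have hnew : Honest I (some ((evaluate (chosen I C)).val, C)) := by
        intro x hx
        obtain rfl : _ = x := Option.some.inj hx
        exact ⟨hC, rfl⟩
      rcases best with _ | ⟨x, X⟩
      · refine ⟨_, hnew, by simp [mainLoop, hs, hsol, chosenC_val], by simp [AtLeast], ?_⟩
        rintro C' - hC'
        obtain rfl : C = C' := Option.some.inj hC'
        exact ⟨_, rfl, le_rfl⟩
      · by_cases hx : x ≤ (evaluate (chosen I C)).val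
        · refine ⟨_, hnew, by simp [mainLoop, hs, hsol, chosenC_val, hx], ?_, ?_⟩
          · rintro v ⟨y, hy, hv⟩
            obtain rfl : (x, X) = y := Option.some.inj hy
            exact ⟨_, rfl, hv.trans hx⟩
          · rintro C' - hC'
            obtain rfl : C = C' := Option.some.inj hC'
            exact ⟨_, rfl, le_rfl⟩
        · refine ⟨_, hb, by simp [mainLoop, hs, hsol, chosenC_val, hx], fun v h => h, ?_⟩
          rintro C' - hC'
          obtain rfl : C = C' := Option.some.inj hC'
          exact ⟨_, rfl, (not_le.1 hx).le⟩
  · exact ⟨best, hb, by simp [mainLoop, hs], fun v h => h, fun C h => absurd h hs⟩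

theorem mainLoop_spec (M n : ℕ) (keys : List (List ℕ)) (I : Inst) (us : List (List ℚ))
    (best : Option (ℚ × List ℕ)) (hb : Honest I best) :
    Honest I (mainLoop M n keys I us best).val ∧
      (∀ v, AtLeast best v → AtLeast (mainLoop M n keys I us best).val v) ∧
      ∀ u ∈ us, ∀ C, (sortedC u).val = true →
        (solve M n keys I (mkBins 1 none u).val).val = some C →
        AtLeast (mainLoop M n keys I us best).val (evaluate (chosen I C)).val := by
  induction us generalizing best with
  | nil => simpa [mainLoop] using hb
  | cons u us ih =>
    obtain ⟨best', h1, h2, h3, h4⟩ := mainLoop_cons M n keys I u us best hb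
    obtain ⟨k1, k2, k3⟩ := ih best' h1
    rw [h2]
    simp only [List.mem_cons, forall_eq_or_imp]
    exact ⟨k1, fun v hv => k2 v (h3 v hv), fun C hs hC => k2 _ (h4 C hs hC), k3⟩

/-- All agent utilities of an instance. -/
def utilities (J : Inst) : List ℚ := J.flatMap fun cfgs => cfgs.flatMap fun d => d.map Mass.uA

theorem isConfig_zero {I : Inst} (h : ∀ cfgs ∈ I, cfgs ≠ []) : IsConfig I (I.map fun _ => 0) := by
  unfold IsConfig
  induction I with
  | nil => exact .nil
  | cons cfgs I ih =>
    simp only [List.mem_cons, forall_eq_or_imp] at h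
    exact .cons (List.length_pos_iff.2 h.1) (ih h.2)

/-- The scheme returns a configuration. Its evaluation is at least that of the solution of the
dynamic program for any non-decreasing profile of agent utilities. -/
theorem scheme_spec {M : ℕ} {I J : Inst} (hJ : (preprocess M I).val = J)
    (hne : ∀ cfgs ∈ J, cfgs ≠ []) :
    IsConfig J (scheme M I).val ∧ ∀ keys,
      keys = (tuplesC (downFromC (M ^ 2 * J.length * J.length)).val M).val →
      ∀ u : List ℚ, u.length = M → (∀ x ∈ u, x ∈ utilities J) → (sortedC u).val = true →
      ∀ C, (solve M J.length keys J (mkBins 1 none u).val).val = some C →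
        (evaluate (chosen J C)).val ≤ (evaluate (chosen J (scheme M I).val)).val := by
  have hspec := mainLoop_spec M J.length
    (tuplesC (downFromC (M ^ 2 * J.length * J.length)).val M).val J
    (tuplesC (utilities J) M).val none (by simp [Honest])
  have hval : (scheme M I).val = match (mainLoop M J.length
      (tuplesC (downFromC (M ^ 2 * J.length * J.length)).val M).val J
      (tuplesC (utilities J) M).val none).val with
      | none => J.map fun _ => 0
      | some (_, C) => C := by
    simp only [scheme, Cost.bind_val, hJ, lengthC_val, mulN_val, bindC_val, mapC_val,
      Cost.pure_val]
    rw [← utilities]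
    cases (mainLoop M J.length
      (tuplesC (downFromC (M ^ 2 * J.length * J.length)).val M).val J
      (tuplesC (utilities J) M).val none).val <;> simp
  obtain ⟨h1, -, h3⟩ := hspec
  refine ⟨?_, ?_⟩
  · rw [hval]
    generalize (mainLoop M J.length _ J _ none).val = o at h1
    rcases o with _ | ⟨x, X⟩
    · exact isConfig_zero hne
    · exact (h1 _ rfl).1
  · rintro keys rfl u hu hmem hs C hC
    obtain ⟨x, hx, hv⟩ := h3 u (mem_tuplesC.2 ⟨hu, hmem⟩) C hs hC
    rw [hval, hx]
    exact hv.trans_eq (h1 x hx).2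


/-! ### The choice of the profile for an optimal configuration -/

theorem cum_of_lt {M j : ℕ} {U : ℕ → ℚ} (h0 : j ≠ 0) (h : j < M) :
    cum M U j = fun u => decide (u < U j) := by
  funext u; simp [cum, h0, h.ne]

theorem cum_self {M : ℕ} {U : ℕ → ℚ} (h0 : M ≠ 0) : cum M U M = fun u => decide (u ≤ U M) := by
  funext u; simp [cum, h0]

theorem down_cum (M : ℕ) (U : ℕ → ℚ) (j : ℕ) : Down (cum M U j) := by
  intro u v huv h
  unfold cum at h ⊢
  split_ifs at h ⊢
  · exact decide_eq_true (huv.trans (of_decide_eq_true h))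
  · exact decide_eq_true (huv.trans_lt (of_decide_eq_true h))

/-- The profile is non-decreasing. -/
def MonoProfile (M : ℕ) (U : ℕ → ℚ) : Prop := ∀ i j, 1 ≤ i → i ≤ j → j ≤ M → U i ≤ U j

theorem cum_mono {M : ℕ} {U : ℕ → ℚ} (hU : MonoProfile M U) {j : ℕ} (hj : 1 ≤ j) (hjM : j ≤ M)
    (u : ℚ) (h : cum M U (j - 1) u = true) : cum M U j u = true := by
  by_cases h1 : j - 1 = 0
  · simp [cum, h1] at h
  · have hle := hU (j - 1) j (by omega) (by omega) hjM
    rw [cum_of_lt h1 (by omega)] at h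
    have hlt := of_decide_eq_true h
    rcases hjM.lt_or_eq with h2 | rfl
    · rw [cum_of_lt (by omega) h2]
      exact decide_eq_true (hlt.trans_le hle)
    · rw [cum_self (by omega)]
      exact decide_eq_true (hlt.le.trans hle)

theorem prAll_congr {ds : List Dist} {P R : ℚ → Bool}
    (h : ∀ d ∈ ds, ∀ w ∈ d, P w.uA = R w.uA) : prAll ds P = prAll ds R := by
  unfold prAll pr
  congr 1
  exact List.map_congr_left fun d hd => avg_congr fun w hw => by rw [h d hd w hw]

theorem prAll_eq_one {ds : List Dist} (hds : ∀ d ∈ ds, IsProb d) {P : ℚ → Bool}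
    (h : ∀ d ∈ ds, ∀ w ∈ d, P w.uA = true) : prAll ds P = 1 := by
  unfold prAll pr
  refine List.prod_eq_one fun x hx => ?_
  obtain ⟨d, hd, rfl⟩ := List.mem_map.1 hx
  rw [← (hds d hd).sum_eq]
  exact avg_congr fun w hw => by simp [h d hd w hw]

theorem prAll_eq_zero {ds : List Dist} (hne : ds ≠ []) {P : ℚ → Bool}
    (h : ∀ d ∈ ds, ∀ w ∈ d, P w.uA = false) : prAll ds P = 0 := by
  cases ds with
  | nil => exact absurd rfl hne
  | cons d ds =>
    have : pr d P = 0 := by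
      rw [pr, ← avg_zero d]
      exact avg_congr fun w hw => by simp [h d (by simp) w hw]
    simp [this]

/-- For every probability level `t` up to `1 - ε`, there is a least agent utility `u` with
`Pr[u^A < u] ≥ t`, and the level is exceeded by at most `ε`. -/
theorem Separated.exists_quantile {ε t : ℚ} {ds : List Dist} (h : Separated ε ds) (hε : 0 ≤ ε)
    (hne : ds ≠ []) {S : Finset ℚ} (hS : ∀ d ∈ ds, ∀ w ∈ d, w.uA ∈ S) (hS0 : S.Nonempty)
    (ht : 0 < t) (ht1 : t ≤ 1 - ε) :
    ∃ u ∈ S, t ≤ prAll ds (fun x => decide (x < u)) ∧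
      prAll ds (fun x => decide (x < u)) ≤ t + ε ∧
      ∀ v ∈ S, t ≤ prAll ds (fun x => decide (x < v)) → u ≤ v := by
  have hjump := fun a => prAll_le_add (a := a) hε h.isProb h.prob_le h.nodup h.ne
  have hT : (S.filter fun u => t ≤ prAll ds fun x => decide (x < u)).Nonempty := by
    refine ⟨S.max' hS0, Finset.mem_filter.2 ⟨S.max'_mem hS0, ?_⟩⟩
    have h1 := hjump (S.max' hS0)
    rw [prAll_eq_one h.isProb fun d hd w hw => decide_eq_true (S.le_max' _ (hS d hd w hw))] at h1
    linarith
  obtain ⟨u, hu, hmin⟩ := Finset.exists_min_image _ id hT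
  obtain ⟨huS, hut⟩ := Finset.mem_filter.1 hu
  refine ⟨u, huS, hut, ?_, fun v hv hvt => hmin v (Finset.mem_filter.2 ⟨hv, hvt⟩)⟩
  by_cases hlow : (S.filter (· < u)).Nonempty
  · obtain ⟨v, hv, hmax⟩ := Finset.exists_max_image _ id hlow
    obtain ⟨hvS, hvu⟩ := Finset.mem_filter.1 hv
    have h1 : prAll ds (fun x => decide (x < u)) = prAll ds fun x => decide (x ≤ v) := by
      refine prAll_congr fun d hd w hw => decide_eq_decide.2 ⟨fun hlt => ?_, fun hle => ?_⟩
      · exact hmax w.uA (Finset.mem_filter.2 ⟨hS d hd w hw, hlt⟩)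
      · exact hle.trans_lt hvu
    have h2 : prAll ds (fun x => decide (x < v)) < t := by
      by_contra h3
      exact absurd (hmin v (Finset.mem_filter.2 ⟨hvS, not_lt.1 h3⟩)) (not_le.2 hvu)
    rw [h1]
    linarith [hjump v]
  · have h1 : prAll ds (fun x => decide (x < u)) = 0 := by
      refine prAll_eq_zero hne fun d hd w hw => decide_eq_false fun hlt => hlow ?_
      exact ⟨w.uA, Finset.mem_filter.2 ⟨hS d hd w hw, hlt⟩⟩
    linarith

/-- A profile of agent utilities for which `Pr[u^A ∈ B_{≤ j}]` is between `j/M` and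
`j/M + 1/M²`. -/
theorem Separated.exists_profile {M : ℕ} (hM : 2 ≤ M) {ds : List Dist}
    (h : Separated (1 / (M : ℚ) ^ 2) ds) (hne : ds ≠ []) {S : Finset ℚ}
    (hS : ∀ d ∈ ds, ∀ w ∈ d, w.uA ∈ S) (hS0 : S.Nonempty) :
    ∃ U : ℕ → ℚ, MonoProfile M U ∧ (∀ j, 1 ≤ j → j ≤ M → U j ∈ S) ∧ (∀ u ∈ S, u ≤ U M) ∧
      ∀ j, 1 ≤ j → j ≤ M → (j : ℚ) / M ≤ prAll ds (cum M U j) ∧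
        prAll ds (cum M U j) ≤ (j : ℚ) / M + 1 / (M : ℚ) ^ 2 := by
  have hM0 : (0 : ℚ) < M := by exact_mod_cast (by omega : 0 < M)
  have hM1 : (1 : ℚ) ≤ M := by exact_mod_cast (by omega : 1 ≤ M)
  have hε : (0 : ℚ) ≤ 1 / (M : ℚ) ^ 2 := by positivity
  have hq : ∀ j : ℕ, 1 ≤ j ∧ j < M → ∃ u ∈ S, (j : ℚ) / M ≤ prAll ds (fun x => decide (x < u)) ∧
      prAll ds (fun x => decide (x < u)) ≤ (j : ℚ) / M + 1 / (M : ℚ) ^ 2 ∧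
      ∀ v ∈ S, (j : ℚ) / M ≤ prAll ds (fun x => decide (x < v)) → u ≤ v := by
    rintro j ⟨hj1, hj2⟩
    have h1 : (1 : ℚ) ≤ j := by exact_mod_cast hj1
    have h2 : (j : ℚ) + 1 ≤ M := by exact_mod_cast hj2
    refine h.exists_quantile hε hne hS hS0 (by positivity) ?_
    rw [le_sub_iff_add_le, div_add_div _ _ hM0.ne' (by positivity), div_le_one (by positivity)]
    nlinarith [mul_pos hM0 hM0]
  choose! q hqS hq1 hq2 hq3 using hq
  refine ⟨fun j => if j = M then S.max' hS0 else q j, ?_, ?_, ?_, ?_⟩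
  · intro i j hi hij hj
    by_cases hjM : j = M
    · by_cases hiM : i = M
      · simp [hjM, hiM]
      · simp only [hjM, hiM, if_true, if_false]
        exact S.le_max' _ (hqS i ⟨hi, by omega⟩)
    · have hiM : i ≠ M := by omega
      simp only [hjM, hiM, if_false]
      refine hq3 i ⟨hi, by omega⟩ _ (hqS j ⟨by omega, by omega⟩)
        (le_trans ?_ (hq1 j ⟨by omega, by omega⟩))
      have : (i : ℚ) ≤ j := by exact_mod_cast hij
      gcongr
  · intro j hj hjM
    by_cases h1 : j = M
    · simp only [h1, if_true]; exact S.max'_mem hS0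
    · simp only [h1, if_false]; exact hqS j ⟨hj, by omega⟩
  · intro u hu
    simp only [if_true]
    exact S.le_max' u hu
  · intro j hj hjM
    rcases hjM.lt_or_eq with h1 | rfl
    · rw [cum_of_lt (by omega) h1]
      simp only [h1.ne, if_false]
      exact ⟨hq1 j ⟨hj, h1⟩, hq2 j ⟨hj, h1⟩⟩
    · rw [cum_self (by omega)]
      simp only [if_true]
      rw [prAll_eq_one h.isProb fun d hd w hw => decide_eq_true (S.le_max' _ (hS d hd w hw)),
        div_self hM0.ne']
      exact ⟨le_rfl, by linarith⟩

/-! ### Rounded estimates -/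

/-- The additive estimate for the probability of bin `j`, before rounding. -/
def estimate (M : ℕ) (U : ℕ → ℚ) (ds : List Dist) (j : ℕ) : ℚ :=
  (ds.map (condPr (cum M U (j - 1)) (cum M U j))).sum

theorem totalCount_bounds {M D : ℕ} {U : ℕ → ℚ} {ds : List Dist} (hds : ∀ d ∈ ds, IsProb d)
    (j : ℕ) : estimate M U ds j * D - ds.length ≤ totalCount M D U ds j ∧
      (totalCount M D U ds j : ℚ) ≤ estimate M U ds j * D ∧
      totalCount M D U ds j ≤ D * ds.length := by
  induction ds with
  | nil => simp [estimate, totalCount]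
  | cons d ds ih =>
    simp only [List.mem_cons, forall_eq_or_imp] at hds
    obtain ⟨h1, h2, h3⟩ := ih hds.2
    have h0 := condPr_nonneg hds.1 (cum M U (j - 1)) (cum M U j)
    have h4 := condPr_le_one hds.1 (cum M U (j - 1)) (cum M U j)
    have h5 : (0 : ℚ) ≤ D := Nat.cast_nonneg _
    have h6 := Nat.floor_le (mul_nonneg h0 h5)
    have h7 := Nat.lt_floor_add_one (condPr (cum M U (j - 1)) (cum M U j) d * D)
    have h8 : count M D U d j ≤ D := Nat.floor_le_of_le (mul_le_of_le_one_left h5 h4)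
    simp only [estimate, totalCount, List.map_cons, List.sum_cons, List.length_cons] at *
    rw [Nat.cast_add, Nat.cast_add, Nat.cast_one]
    unfold count at *
    refine ⟨by linarith, by linarith, ?_⟩
    rw [mul_add, mul_one, add_comm]
    exact add_le_add h3 h8

/-- If `Pr[u^A ∈ B_{≤ j}]` is between `j/M` and `j/M + 1/M²` for all `j`, then the rounded estimates
meet the constraints. -/
theorem meets_of_quantiles {M : ℕ} (hM : 2 ≤ M) {U : ℕ → ℚ} (hU : MonoProfile M U)
    {ds : List Dist} (hds : ∀ d ∈ ds, IsProb d) (hne : ds ≠ [])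
    (hQ : ∀ j, 1 ≤ j → j ≤ M → (j : ℚ) / M ≤ prAll ds (cum M U j) ∧
      prAll ds (cum M U j) ≤ (j : ℚ) / M + 1 / (M : ℚ) ^ 2) :
    Meets M (M ^ 2 * ds.length) (totalCount M (M ^ 2 * ds.length) U ds) := by
  intro j hj hjM
  have hM0 : (0 : ℚ) < M := by exact_mod_cast (by omega : 0 < M)
  have hj0 : (0 : ℚ) < j := by exact_mod_cast hj
  have hn : (0 : ℚ) < ds.length := by exact_mod_cast List.length_pos_iff.2 hne
  obtain ⟨hc1, hc2, -⟩ := totalCount_bounds (M := M) (D := M ^ 2 * ds.length) (U := U) hds j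
  have hD : (0 : ℚ) < ((M ^ 2 * ds.length : ℕ) : ℚ) := by push_cast; positivity
  have hmono := cum_mono hU hj hjM
  obtain ⟨hQ1, hQ2⟩ := hQ j hj hjM
  have hQ0 : (0 : ℚ) < prAll ds (cum M U j) := lt_of_lt_of_le (by positivity) hQ1
  have hlow := one_sub_sum_condPr_mul_le hds hmono
  have hup := one_add_sum_condPr_mul_le hds hmono
  change (1 - estimate M U ds j) * _ ≤ _ at hlow
  change (1 + estimate M U ds j) * _ ≤ _ at hup
  -- The probability of the bins before `j`, which is zero for `j = 1`.
  have hprev : prAll ds (cum M U (j - 1)) ≤ ((j : ℚ) - 1) / M + 1 / (M : ℚ) ^ 2 := by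
    by_cases h1 : j = 1
    · subst h1
      rw [prAll_eq_zero hne fun d _ w _ => by simp [cum]]
      simp
    · have := (hQ (j - 1) (by omega) (by omega)).2
      rwa [Nat.cast_sub hj, Nat.cast_one] at this
  constructor
  · have h1 : (1 - 1 / (M : ℚ)) / j ≤ estimate M U ds j := by
      by_contra hlt
      have hlt := not_le.1 hlt
      have e1 : 1 - (1 - 1 / (M : ℚ)) / j < 1 - estimate M U ds j := by linarith
      have e2 := mul_lt_mul_of_pos_right e1 hQ0
      have e4 : 0 ≤ 1 - (1 - 1 / (M : ℚ)) / j := by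
        rw [sub_nonneg, div_le_one hj0]
        have : 0 ≤ 1 / (M : ℚ) := by positivity
        have : (1 : ℚ) ≤ j := by exact_mod_cast hj
        linarith
      have e3 : (1 - (1 - 1 / (M : ℚ)) / j) * ((j : ℚ) / M) ≤
          (1 - (1 - 1 / (M : ℚ)) / j) * prAll ds (cum M U j) :=
        mul_le_mul_of_nonneg_left hQ1 e4
      have e5 : (1 - (1 - 1 / (M : ℚ)) / j) * ((j : ℚ) / M) =
          ((j : ℚ) - 1) / M + 1 / (M : ℚ) ^ 2 := by field_simp; ring
      linarith
    have h2 : estimate M U ds j - 1 / (M : ℚ) ^ 2 ≤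
        (totalCount M (M ^ 2 * ds.length) U ds j : ℚ) / ((M ^ 2 * ds.length : ℕ) : ℚ) := by
      rw [le_div_iff₀ hD]
      have : 1 / (M : ℚ) ^ 2 * ((M ^ 2 * ds.length : ℕ) : ℚ) = ds.length := by
        push_cast; field_simp
      linarith
    unfold lowerBound
    linarith
  · intro h2j
    have hj1 : (0 : ℚ) < (j : ℚ) - 1 := by
      have : (2 : ℚ) ≤ j := by exact_mod_cast h2j
      linarith
    have hQ' := (hQ (j - 1) (by omega) (by omega)).1
    rw [Nat.cast_sub hj, Nat.cast_one] at hQ'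
    have h0 : 0 ≤ estimate M U ds j := List.sum_nonneg fun x hx => by
      obtain ⟨d, hd, rfl⟩ := List.mem_map.1 hx
      exact condPr_nonneg (hds d hd) _ _
    have h1 : estimate M U ds j ≤ (1 + 1 / (M : ℚ)) / ((j : ℚ) - 1) := by
      have e1 := mul_le_mul_of_nonneg_left hQ' (by linarith : 0 ≤ 1 + estimate M U ds j)
      have e2 : (1 + estimate M U ds j) * (((j : ℚ) - 1) / M) ≤ (j : ℚ) / M + 1 / (M : ℚ) ^ 2 := by
        linarith
      rw [le_div_iff₀ hj1]
      have e3 := mul_le_mul_of_nonneg_right e2 hM0.le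
      have e4 : (1 + estimate M U ds j) * (((j : ℚ) - 1) / M) * M =
          (1 + estimate M U ds j) * ((j : ℚ) - 1) := by field_simp
      have e5 : ((j : ℚ) / M + 1 / (M : ℚ) ^ 2) * M = j + 1 / M := by field_simp
      linarith
    refine le_trans ?_ h1
    rwa [div_le_iff₀ hD]

/-! ### The value of a configuration that meets the constraints -/

theorem restrictedValue_eq {ds : List Dist} {P : ℚ → Bool}
    (h : ∀ d ∈ ds, ∀ w ∈ d, P w.uA = true) :
    restrictedValue ds P = expect ds principalUtil :=
  expect_congr fun ω hω => by
    have : allIn P ω = true := allIn_eq_true.2 fun w hw => by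
      obtain ⟨d, hd, hwd⟩ := hω.exists_mem w hw
      exact h d hd w hwd
    simp [this]

theorem totalObjective_eq (M : ℕ) (U : ℕ → ℚ) (ds : List Dist) :
    totalObjective M U ds =
      ∑ j ∈ Finset.Icc 6 M, weight M j * condUtilSum ds (cum M U (j - 1)) (cum M U j) := by
  have hsum : ∀ g : ℕ → ℚ, ((List.range' 1 M).map fun j => if 6 ≤ j then g j else 0).sum =
      ∑ j ∈ Finset.Icc 6 M, g j := by
    intro g
    have h1 : Finset.Icc 6 M = (List.range' 1 M).toFinset.filter (6 ≤ ·) := by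
      ext j; simp [List.mem_range'_1]; omega
    rw [h1, Finset.sum_filter, List.sum_toFinset _ List.nodup_range']
  induction ds with
  | nil => simp [totalObjective, condUtilSum]
  | cons d ds ih =>
    simp only [totalObjective, condUtilSum, List.map_cons, List.sum_cons, mul_add,
      Finset.sum_add_distrib] at ih ⊢
    rw [ih, objective, hsum]

theorem sum_Icc_sub (V : ℕ → ℚ) {M : ℕ} (hM : 5 ≤ M) :
    ∑ j ∈ Finset.Icc 6 M, (V j - V (j - 1)) = V M - V 5 := by
  induction M, hM using Nat.le_induction with
  | base => simp
  | succ m hm ih =>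
    rw [Finset.sum_Icc_succ_top (by omega), ih]
    simp

/-- The probability that the agent's utility lies in the bins before `j` is at least
`(j - 5)/(M - 4)`. -/
theorem prAll_cum_ge {M : ℕ} (hM : 5 ≤ M) {U : ℕ → ℚ} (hU : MonoProfile M U)
    {ds : List Dist} (hds : ∀ d ∈ ds, IsProb d) (hne : ds ≠ [])
    (htop : ∀ d ∈ ds, ∀ w ∈ d, w.uA ≤ U M)
    (hmeet : Meets M (M ^ 2 * ds.length) (totalCount M (M ^ 2 * ds.length) U ds)) (k : ℕ)
    (hk : k + 5 ≤ M) : ((M : ℚ) - k - 4) / (M - 4) ≤ prAll ds (cum M U (M - k)) := by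
  have hM5 : (5 : ℚ) ≤ M := by exact_mod_cast hM
  have hM0 : (0 : ℚ) < M := by linarith
  have hM4 : (0 : ℚ) < (M : ℚ) - 4 := by linarith
  induction k with
  | zero =>
    rw [Nat.sub_zero, cum_self (by omega),
      prAll_eq_one hds fun d hd w hw => decide_eq_true (htop d hd w hw)]
    simp [hM4.ne']
  | succ k ih =>
    have ih := ih (by omega)
    obtain ⟨j, hj⟩ : ∃ j, j = M - k := ⟨_, rfl⟩
    have hj' : M - (k + 1) = j - 1 := by omega
    have hjk : (M : ℚ) - k = j := by
      rw [hj, Nat.cast_sub (by omega)]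
    have hj6 : (6 : ℚ) ≤ j := by exact_mod_cast (by omega : 6 ≤ j)
    have hjM : (j : ℚ) ≤ M := by exact_mod_cast (by omega : j ≤ M)
    rw [← hj, hjk] at ih
    rw [hj', Nat.cast_succ, ← sub_sub, hjk]
    have hlow := one_sub_sum_condPr_mul_le hds (cum_mono hU (by omega : 1 ≤ j) (by omega))
    change (1 - estimate M U ds j) * _ ≤ _ at hlow
    have hn : (0 : ℚ) < ds.length := by exact_mod_cast List.length_pos_iff.2 hne
    have hD : (0 : ℚ) < ((M ^ 2 * ds.length : ℕ) : ℚ) := by push_cast; positivity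
    have hup := (hmeet j (by omega) (by omega)).2 (by omega)
    rw [div_le_iff₀ hD] at hup
    obtain ⟨hc, -, -⟩ := totalCount_bounds (M := M) (D := M ^ 2 * ds.length) (U := U) hds j
    have hest : estimate M U ds j ≤ (1 + 2 / (M : ℚ)) / ((j : ℚ) - 1) := by
      have e1 : estimate M U ds j * ((M ^ 2 * ds.length : ℕ) : ℚ) ≤
          (upperBound M j + 1 / (M : ℚ) ^ 2) * ((M ^ 2 * ds.length : ℕ) : ℚ) := by
        have : 1 / (M : ℚ) ^ 2 * ((M ^ 2 * ds.length : ℕ) : ℚ) = ds.length := by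
          push_cast; field_simp
        linarith
      refine (le_of_mul_le_mul_right e1 hD).trans ?_
      have e2 : 1 / (M : ℚ) ^ 2 ≤ (1 / (M : ℚ)) / ((j : ℚ) - 1) := by
        rw [div_div, sq]
        exact one_div_le_one_div_of_le (mul_pos hM0 (by linarith))
          (mul_le_mul_of_nonneg_left (by linarith) hM0.le)
      unfold upperBound
      calc _ ≤ (1 + 1 / (M : ℚ)) / ((j : ℚ) - 1) + (1 / (M : ℚ)) / ((j : ℚ) - 1) := by linarith
        _ = _ := by rw [← add_div]; congr 1; ring
    have hj1 : (0 : ℚ) < (j : ℚ) - 1 := by linarith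
    have h2M : 2 / (M : ℚ) * ((j : ℚ) - 4) ≤ 3 := by
      rw [div_mul_eq_mul_div, div_le_iff₀ hM0]
      linarith
    have hx : (1 + 2 / (M : ℚ)) / ((j : ℚ) - 1) * ((j : ℚ) - 4) ≤ 1 := by
      rw [div_mul_eq_mul_div, div_le_one hj1]
      linarith
    have hx1 : (1 + 2 / (M : ℚ)) / ((j : ℚ) - 1) ≤ 1 := by
      by_contra hlt
      have := mul_le_mul_of_nonneg_left (by linarith : (1 : ℚ) ≤ (j : ℚ) - 4)
        (by linarith [not_le.1 hlt] : 0 ≤ (1 + 2 / (M : ℚ)) / ((j : ℚ) - 1))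
      linarith [not_le.1 hlt]
    have h3 : (1 - (1 + 2 / (M : ℚ)) / ((j : ℚ) - 1)) * (((j : ℚ) - 4) / (M - 4)) ≤
        prAll ds (cum M U (j - 1)) := by
      refine le_trans (mul_le_mul (by linarith : _ ≤ 1 - estimate M U ds j) ih ?_ ?_) hlow
      · exact div_nonneg (by linarith) hM4.le
      · linarith
    refine le_trans ?_ h3
    rw [← mul_div_assoc]
    gcongr
    linarith

/-- The value of a configuration that meets the constraints is at least `(M - 1)/(M - 4)` times its
objective. -/
theorem totalObjective_mul_le {M : ℕ} (hM : 5 ≤ M) {U : ℕ → ℚ} (hU : MonoProfile M U)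
    {ds : List Dist} (hds : ∀ d ∈ ds, IsProb d) (hne : ds ≠ [])
    (htop : ∀ d ∈ ds, ∀ w ∈ d, w.uA ≤ U M)
    (hmeet : Meets M (M ^ 2 * ds.length) (totalCount M (M ^ 2 * ds.length) U ds)) :
    ((M : ℚ) - 1) / (M - 4) * totalObjective M U ds ≤ expect ds principalUtil := by
  have hM5 : (5 : ℚ) ≤ M := by exact_mod_cast hM
  have hM4 : (0 : ℚ) < (M : ℚ) - 4 := by linarith
  have hM1 : (0 : ℚ) < (M : ℚ) - 1 := by linarith
  rw [totalObjective_eq, Finset.mul_sum]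
  have h1 := sum_Icc_sub (fun j => restrictedValue ds (cum M U j)) hM
  have h2 : restrictedValue ds (cum M U M) = expect ds principalUtil :=
    restrictedValue_eq fun d hd w hw => by
      rw [cum_self (by omega)]; exact decide_eq_true (htop d hd w hw)
  have h3 := restrictedValue_nonneg hds (cum M U 5)
  rw [h2] at h1
  refine le_trans (Finset.sum_le_sum fun j hj => ?_) (by linarith : _ ≤ expect ds principalUtil)
  · obtain ⟨hj6, hjM⟩ := Finset.mem_Icc.1 hj
    refine le_trans ?_ (condUtilSum_mul_le hds (down_cum M U (j - 1))
      (cum_mono hU (by omega) hjM))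
    have h4 := prAll_cum_ge hM hU hds hne htop hmeet (M - (j - 1)) (by omega)
    have h5 : ((M - (j - 1) : ℕ) : ℚ) = (M : ℚ) - ((j : ℚ) - 1) := by
      rw [Nat.cast_sub (by omega), Nat.cast_sub (by omega), Nat.cast_one]
    rw [h5, Nat.sub_sub_self (by omega)] at h4
    have h6 : ((M : ℚ) - 1) / (M - 4) *
        (weight M j * condUtilSum ds (cum M U (j - 1)) (cum M U j)) =
        condUtilSum ds (cum M U (j - 1)) (cum M U j) * (((j : ℚ) - 5) / (M - 4)) := by
      unfold weight; field_simp
    rw [h6]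
    refine mul_le_mul_of_nonneg_left (le_trans (le_of_eq ?_) h4) (condUtilSum_nonneg hds _ _)
    congr 1; ring


/-! ### The objective of an optimal configuration of an aligned instance -/

/-- Summation by parts with the coefficients `1 - 5/j`. -/
theorem sum_by_parts (V : ℕ → ℝ) {m : ℕ} (hm : 5 ≤ m) :
    ∑ j ∈ Finset.Icc 6 (m + 1), (1 - 5 / (j : ℝ)) * (V j - V (j - 1)) =
      (1 - 5 / ((m : ℝ) + 1)) * V (m + 1) - 1 / 6 * V 5 -
        ∑ j ∈ Finset.Icc 6 m, 5 / ((j : ℝ) * (j + 1)) * V j := by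
  induction m, hm using Nat.le_induction with
  | base => norm_num; ring
  | succ m hm ih =>
    rw [Finset.sum_Icc_succ_top (by omega), ih, Finset.sum_Icc_succ_top (by omega)]
    have h1 : (m : ℝ) + 1 ≠ 0 := by positivity
    have h2 : (m : ℝ) + 1 + 1 ≠ 0 := by positivity
    simp only [Nat.add_sub_cancel]
    push_cast
    field_simp
    ring

/-- The inequality behind the approximation ratio. Here `V j` is the utility of the principal from
the first `j` bins, `Q j` is the probability of these bins, and `ρ j = r j * V M`. The bounds on `Q j`
cost an excess over the claimed term with `ρ 5`, which is compensated by the slack in the term with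
`ρ 6`. -/
theorem weighted_sum_ge {M : ℕ} (hM : 6 ≤ M) {V Q ρ : ℕ → ℝ}
    (hQ1 : ∀ j, 5 ≤ j → j ≤ M → (j : ℝ) / M ≤ Q j)
    (hQ2 : ∀ j, 5 ≤ j → j ≤ M → Q j ≤ (j : ℝ) / M + 1 / (M : ℝ) ^ 2)
    (hV0 : ∀ j, 0 ≤ V j) (hV : ∀ j, 6 ≤ j → j ≤ M → V (j - 1) ≤ V j)
    (hρ : ∀ j, 5 ≤ j → j ≤ M → V j ≤ Q j * ρ j) :
    (M : ℝ) / (M + 1) * (((M : ℝ) - 5) / (M - 1) * V M - 5 / 6 * (ρ 5 / (M - 1)) -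
      5 / ((M : ℝ) - 1) * ∑ j ∈ Finset.Icc 6 M, ρ j / ((j : ℝ) - 1)) ≤
    ∑ j ∈ Finset.Icc 6 M, ((j : ℝ) - 5) / (M - 1) * ((V j - V (j - 1)) / Q j) := by
  obtain ⟨m, rfl⟩ : ∃ m, M = m + 1 := ⟨M - 1, by omega⟩
  have hm : (5 : ℝ) ≤ m := by exact_mod_cast (by omega : 5 ≤ m)
  have hm0 : (0 : ℝ) < m := by linarith
  have hMpos : (0 : ℝ) < ((m + 1 : ℕ) : ℝ) := by positivity
  have hMc : ((m + 1 : ℕ) : ℝ) = (m : ℝ) + 1 := by push_cast; ring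
  have hQpos : ∀ j, 5 ≤ j → j ≤ m + 1 → 0 < Q j := fun j h1 h2 =>
    lt_of_lt_of_le (div_pos (by exact_mod_cast (by omega : 0 < j)) hMpos) (hQ1 j h1 h2)
  have hρ0 : ∀ j, 5 ≤ j → j ≤ m + 1 → 0 ≤ ρ j := fun j h1 h2 => by
    by_contra hneg
    have := mul_neg_of_pos_of_neg (hQpos j h1 h2) (not_le.1 hneg)
    linarith [hρ j h1 h2, hV0 j]
  -- `M V_j` in terms of `ρ_j`
  have hMV : ∀ j, 5 ≤ j → j ≤ m + 1 → ((m : ℝ) + 1) * V j ≤ ((j : ℝ) + 1 / (m + 1)) * ρ j := by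
    intro j h1 h2
    have h3 := (hρ j h1 h2).trans (mul_le_mul_of_nonneg_right (hQ2 j h1 h2) (hρ0 j h1 h2))
    have h4 := mul_le_mul_of_nonneg_left h3 hMpos.le
    rw [hMc] at h4
    refine h4.trans (le_of_eq ?_)
    field_simp
  have hstep1 : ((m : ℝ) + 1) / (m + 1 + 1) * (((m : ℝ) + 1) / m *
      ∑ j ∈ Finset.Icc 6 (m + 1), (1 - 5 / (j : ℝ)) * (V j - V (j - 1))) ≤
      ∑ j ∈ Finset.Icc 6 (m + 1), ((j : ℝ) - 5) / m * ((V j - V (j - 1)) / Q j) := by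
    rw [Finset.mul_sum, Finset.mul_sum]
    refine Finset.sum_le_sum fun j hj => ?_
    obtain ⟨h1, h2⟩ := Finset.mem_Icc.1 hj
    have hj6 : (6 : ℝ) ≤ j := by exact_mod_cast h1
    have hd : 0 ≤ V j - V (j - 1) := by linarith [hV j h1 h2]
    have hQj := hQpos j (by omega) h2
    have hQle : Q j ≤ (j : ℝ) * (m + 1 + 1) / (m + 1) ^ 2 := by
      refine (hQ2 j (by omega) h2).trans ?_
      rw [hMc, div_add_div _ _ (by positivity) (by positivity), div_le_div_iff₀ (by positivity)
        (by positivity)]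
      nlinarith [pow_pos (by positivity : (0 : ℝ) < (m : ℝ) + 1) 3]
    have hinv : ((m : ℝ) + 1) ^ 2 / ((j : ℝ) * (m + 1 + 1)) ≤ 1 / Q j := by
      rw [div_le_div_iff₀ (by positivity) hQj, one_mul]
      rw [le_div_iff₀ (by positivity)] at hQle
      linarith
    have h3 : ((m : ℝ) + 1) / (m + 1 + 1) * (((m : ℝ) + 1) / m *
        ((1 - 5 / (j : ℝ)) * (V j - V (j - 1)))) =
        (((j : ℝ) - 5) / m * (V j - V (j - 1))) *
          (((m : ℝ) + 1) ^ 2 / ((j : ℝ) * (m + 1 + 1))) := by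
      field_simp
    have h4 : ((j : ℝ) - 5) / m * ((V j - V (j - 1)) / Q j) =
        (((j : ℝ) - 5) / m * (V j - V (j - 1))) * (1 / Q j) := by
      field_simp
    rw [h3, h4]
    exact mul_le_mul_of_nonneg_left hinv
      (mul_nonneg (div_nonneg (by linarith) hm0.le) hd)
  rw [hMc, add_sub_cancel_right]
  refine le_trans ?_ hstep1
  refine mul_le_mul_of_nonneg_left ?_ (by positivity)
  rw [sum_by_parts V (by omega : 5 ≤ m)]
  have hsum : ∑ j ∈ Finset.Icc 6 m, ((m : ℝ) + 1) * (5 / ((j : ℝ) * (j + 1)) * V j) ≤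
      ∑ j ∈ Finset.Icc 6 m, 5 * (ρ j / j) := by
    refine Finset.sum_le_sum fun j hj => ?_
    obtain ⟨h1, h2⟩ := Finset.mem_Icc.1 hj
    have hj6 : (6 : ℝ) ≤ j := by exact_mod_cast h1
    have h3 := hMV j (by omega) (by omega)
    have h4 : ((j : ℝ) + 1 / (m + 1)) * ρ j ≤ (j + 1) * ρ j := by
      refine mul_le_mul_of_nonneg_right ?_ (hρ0 j (by omega) (by omega))
      rw [add_le_add_iff_left, div_le_one (by positivity)]
      linarith
    calc ((m : ℝ) + 1) * (5 / ((j : ℝ) * (j + 1)) * V j)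
        = 5 / ((j : ℝ) * (j + 1)) * ((m + 1) * V j) := by ring
      _ ≤ 5 / ((j : ℝ) * (j + 1)) * ((j + 1) * ρ j) :=
        mul_le_mul_of_nonneg_left (h3.trans h4) (by positivity)
      _ = 5 * (ρ j / j) := by field_simp
  have hslack : ∑ j ∈ Finset.Icc 6 m, 5 * (ρ j / j) + ρ 6 / 6 ≤
      5 * ∑ j ∈ Finset.Icc 6 (m + 1), ρ j / ((j : ℝ) - 1) := by
    rw [Finset.sum_Icc_succ_top (by omega), ← Finset.mul_sum, mul_add]
    have hlast : 0 ≤ ρ (m + 1) := hρ0 _ (by omega) le_rfl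
    rw [hMc, add_sub_cancel_right]
    rcases (by omega : m = 5 ∨ 6 ≤ m) with rfl | h6
    · norm_num at hlast ⊢
      linarith
    · have h1 : ∑ j ∈ Finset.Icc 6 m, (ρ j / ((j : ℝ) - 1) - ρ j / j) ≥
          ρ 6 / (((6 : ℕ) : ℝ) - 1) - ρ 6 / ((6 : ℕ) : ℝ) := by
        refine Finset.single_le_sum (f := fun j => ρ j / ((j : ℝ) - 1) - ρ j / j) (fun j hj => ?_)
          (Finset.mem_Icc.2 ⟨le_rfl, h6⟩)
        obtain ⟨h1, h2⟩ := Finset.mem_Icc.1 hj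
        have hj6 : (6 : ℝ) ≤ j := by exact_mod_cast h1
        rw [sub_nonneg]
        exact div_le_div_of_nonneg_left (hρ0 j (by omega) (by omega)) (by linarith) (by linarith)
      rw [Finset.sum_sub_distrib] at h1
      have h2 : 0 ≤ ρ (m + 1) / m := div_nonneg hlast hm0.le
      norm_num at h1
      linarith
  have hfive : ((m : ℝ) + 1) * V 5 ≤ 5 * ρ 5 + ρ 6 := by
    have h5 := hMV 5 le_rfl (by omega)
    have h6 := hMV 6 (by omega) (by omega)
    have h56 := hV 6 le_rfl (by omega)
    norm_num at h5 h6 h56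
    have hρ6 := hρ0 6 (by omega) (by omega)
    have hx : ((m : ℝ) + 1)⁻¹ ≤ 1 / 6 := by
      rw [inv_le_comm₀ (by positivity) (by norm_num)]; linarith
    have hx0 : 0 < ((m : ℝ) + 1)⁻¹ := by positivity
    have h7 := mul_le_mul_of_nonneg_left h56 (by positivity : (0 : ℝ) ≤ (m : ℝ) + 1)
    set x := ((m : ℝ) + 1)⁻¹
    set A := ((m : ℝ) + 1) * V 5 with hA
    have hA0 : 0 ≤ A := mul_nonneg (by positivity) (hV0 5)
    -- `A ≤ (5 + x) ρ₅` and `A ≤ (6 + x) ρ₆` with `x = 1/M`; weight them with `5` and `x`.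
    have h8 : A ≤ 7 * ρ 6 := by nlinarith
    have h9 : 5 * A ≤ (5 + x) * (5 * ρ 5) := by linarith
    have h10 : x * A ≤ (5 + x) * ρ 6 := by nlinarith
    have h11 : (5 + x) * A ≤ (5 + x) * (5 * ρ 5 + ρ 6) := by linarith
    exact le_of_mul_le_mul_left h11 (by linarith)
  rw [← Finset.mul_sum] at hsum
  have hm1 : (m : ℝ) + 1 ≠ 0 := by positivity
  have e1 : ((m : ℝ) + 1) / m * ((1 - 5 / ((m : ℝ) + 1)) * V (m + 1) - 1 / 6 * V 5 -
      ∑ j ∈ Finset.Icc 6 m, 5 / ((j : ℝ) * (j + 1)) * V j) =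
      (((m : ℝ) + 1 - 5) * V (m + 1) - 1 / 6 * (((m : ℝ) + 1) * V 5) -
        ((m : ℝ) + 1) * ∑ j ∈ Finset.Icc 6 m, 5 / ((j : ℝ) * (j + 1)) * V j) / m := by
    field_simp
  have e2 : ((m : ℝ) + 1 - 5) / m * V (m + 1) - 5 / 6 * (ρ 5 / m) -
      5 / (m : ℝ) * ∑ j ∈ Finset.Icc 6 (m + 1), ρ j / ((j : ℝ) - 1) =
      (((m : ℝ) + 1 - 5) * V (m + 1) - 5 / 6 * ρ 5 -
        5 * ∑ j ∈ Finset.Icc 6 (m + 1), ρ j / ((j : ℝ) - 1)) / m := by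
    field_simp
  rw [e1, e2]
  refine div_le_div_of_nonneg_right ?_ hm0.le
  linarith

/-- On a finite set of agent utilities, the bins up to `j` are given by a threshold. -/
theorem exists_threshold (M : ℕ) (U : ℕ → ℚ) {j : ℕ} (hj : 1 ≤ j) (S : Finset ℚ) :
    ∃ T : ℚ, ∀ u ∈ S, cum M U j u = decide (u ≤ T) := by
  by_cases h : j = M
  · subst h; exact ⟨U j, fun u _ => by rw [cum_self (by omega)]⟩
  · have hj0 : j ≠ 0 := by omega
    have hcum : ∀ u, cum M U j u = decide (u < U j) := fun u => by
      simp [cum, h, hj0]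
    by_cases hlow : (S.filter (· < U j)).Nonempty
    · obtain ⟨v, hv, hmax⟩ := Finset.exists_max_image _ id hlow
      obtain ⟨-, hvu⟩ := Finset.mem_filter.1 hv
      refine ⟨v, fun u hu => ?_⟩
      rw [hcum]
      exact decide_eq_decide.2 ⟨fun hlt => hmax u (Finset.mem_filter.2 ⟨hu, hlt⟩),
        fun hle => hle.trans_lt hvu⟩
    · refine ⟨U j - 1, fun u hu => ?_⟩
      rw [hcum]
      refine decide_eq_decide.2 ⟨fun hlt => absurd ⟨u, Finset.mem_filter.2 ⟨hu, hlt⟩⟩ hlow,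
        fun hle => by linarith⟩

theorem ind_allIn_le (ω : List Mass) (T : ℚ) : ind (allIn (fun u => decide (u ≤ T)) ω) =
    if agentUtil ω ≤ (T : WithBot ℚ) then 1 else 0 := by
  simp only [ind, allIn_eq_true, decide_eq_true_eq, agentUtil_le]

theorem cdf_eq (J : Inst) (C : List ℕ) (T : ℚ) :
    cdf J C T = prAll (chosen J C) fun u => decide (u ≤ T) := by
  simp only [← expect_allIn, cdf, ind_allIn_le]

theorem condValue_eq (J : Inst) (C : List ℕ) (T : ℚ) :
    condValue J C T = restrictedValue (chosen J C) (fun u => decide (u ≤ T)) /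
      prAll (chosen J C) fun u => decide (u ≤ T) := by
  simp only [condValue, cdf_eq, restrictedValue, ind_allIn_le, ite_mul, one_mul, zero_mul]

theorem restrictedValue_congr {ds : List Dist} {P R : ℚ → Bool}
    (h : ∀ d ∈ ds, ∀ w ∈ d, P w.uA = R w.uA) : restrictedValue ds P = restrictedValue ds R :=
  expect_congr fun ω hω => by
    have : allIn P ω = allIn R ω := by
      unfold allIn
      rw [Bool.eq_iff_iff, List.all_eq_true, List.all_eq_true]
      refine forall₂_congr fun w hw => ?_
      obtain ⟨d, hd, hwd⟩ := hω.exists_mem w hw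
      rw [h d hd w hwd]
    rw [this]

/-- An optimal configuration of an aligned instance has a large objective for the profile of its
quantiles. -/
theorem totalObjective_ge {M : ℕ} (hM : 6 ≤ M) {J : Inst} {C : List ℕ} {f : ℝ → ℝ}
    (hf : AntitoneOn f (Set.Ioc 0 1))
    (hal : ∀ T : ℚ, 0 < cdf J C T →
      (condValue J C T : ℝ) ≤ f (cdf J C T : ℝ) * (value J C : ℝ))
    (hds : ∀ d ∈ chosen J C, IsProb d) {S : Finset ℚ}
    (hS : ∀ d ∈ chosen J C, ∀ w ∈ d, w.uA ∈ S) {U : ℕ → ℚ} (hU : MonoProfile M U)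
    (htop : ∀ u ∈ S, u ≤ U M)
    (hQ : ∀ j, 1 ≤ j → j ≤ M → (j : ℚ) / M ≤ prAll (chosen J C) (cum M U j) ∧
      prAll (chosen J C) (cum M U j) ≤ (j : ℚ) / M + 1 / (M : ℚ) ^ 2) :
    (M : ℝ) / (M - 1) * ratio M (fun j => f ((j : ℝ) / M)) * (value J C : ℝ) ≤
      (totalObjective M U (chosen J C) : ℝ) := by
  have hM6 : (6 : ℝ) ≤ M := by exact_mod_cast hM
  have hM0 : (0 : ℝ) < M := by linarith
  have hv0 : (0 : ℝ) ≤ value J C := by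
    exact_mod_cast expect_nonneg (fun d hd => (hds d hd).prob_nonneg) fun ω _ =>
      principalUtil_nonneg ω
  set ds := chosen J C with hdsdef
  have hVM : restrictedValue ds (cum M U M) = value J C :=
    restrictedValue_eq fun d hd w hw => by
      rw [cum_self (by omega)]; exact decide_eq_true (htop _ (hS d hd w hw))
  have hQr : ∀ j, 1 ≤ j → j ≤ M → (j : ℝ) / M ≤ (prAll ds (cum M U j) : ℝ) ∧
      (prAll ds (cum M U j) : ℝ) ≤ (j : ℝ) / M + 1 / (M : ℝ) ^ 2 := fun j h1 h2 => by
    obtain ⟨h3, h4⟩ := hQ j h1 h2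
    have h3 := (Rat.cast_le (K := ℝ)).2 h3
    have h4 := (Rat.cast_le (K := ℝ)).2 h4
    push_cast at h3 h4
    exact ⟨h3, h4⟩
  have hmain := weighted_sum_ge hM (V := fun j => (restrictedValue ds (cum M U j) : ℝ))
    (Q := fun j => (prAll ds (cum M U j) : ℝ)) (ρ := fun j => f ((j : ℝ) / M) * value J C)
    (fun j h1 h2 => (hQr j (by omega) h2).1)
    (fun j h1 h2 => (hQr j (by omega) h2).2)
    (fun j => by exact_mod_cast restrictedValue_nonneg hds _)
    (fun j h1 h2 => by
      have h3 := condUtilSum_mul_le hds (down_cum M U (j - 1)) (cum_mono hU (by omega) h2)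
      have h4 := mul_nonneg (condUtilSum_nonneg hds (cum M U (j - 1)) (cum M U j))
        (prAll_nonneg hds (cum M U (j - 1)))
      exact_mod_cast (by linarith :
        restrictedValue ds (cum M U (j - 1)) ≤ restrictedValue ds (cum M U j)))
    (fun j h1 h2 => by
      obtain ⟨T, hT⟩ := exists_threshold M U (by omega : 1 ≤ j) S
      have e1 : prAll ds (cum M U j) = cdf J C T := by
        rw [cdf_eq]; exact prAll_congr fun d hd w hw => hT _ (hS d hd w hw)
      have e2 : restrictedValue ds (cum M U j) =
          restrictedValue ds fun u => decide (u ≤ T) :=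
        restrictedValue_congr fun d hd w hw => hT _ (hS d hd w hw)
      have hj0 : (0 : ℝ) < j := by exact_mod_cast (by omega : 0 < j)
      have hQ1 : (j : ℝ) / M ≤ (cdf J C T : ℝ) := by
        rw [← e1]; exact (hQr j (by omega) h2).1
      have hpos : (0 : ℝ) < (cdf J C T : ℝ) := lt_of_lt_of_le (by positivity) hQ1
      have hle1 : (cdf J C T : ℝ) ≤ 1 := by
        rw [← e1]; exact_mod_cast prAll_le_one hds _
      have h3 := hal T (by exact_mod_cast hpos)
      have h4 : f (cdf J C T : ℝ) ≤ f ((j : ℝ) / M) :=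
        hf ⟨by positivity, hQ1.trans hle1⟩ ⟨hpos, hle1⟩ hQ1
      have h5 := h3.trans (mul_le_mul_of_nonneg_right h4 hv0)
      rw [condValue_eq, ← cdf_eq, Rat.cast_div, div_le_iff₀ hpos] at h5
      rw [e1, e2]
      linarith)
  have hobj : ∑ j ∈ Finset.Icc 6 M, ((j : ℝ) - 5) / (M - 1) *
      (((restrictedValue ds (cum M U j) : ℝ) - (restrictedValue ds (cum M U (j - 1)) : ℝ)) /
        (prAll ds (cum M U j) : ℝ)) ≤ (totalObjective M U ds : ℝ) := by
    rw [totalObjective_eq]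
    push_cast
    refine Finset.sum_le_sum fun j hj => ?_
    obtain ⟨h1, h2⟩ := Finset.mem_Icc.1 hj
    have hj6 : (6 : ℝ) ≤ j := by exact_mod_cast h1
    have hpos : 0 < prAll ds (cum M U j) := by
      refine lt_of_lt_of_le ?_ (hQ j (by omega) h2).1
      have : (0 : ℚ) < j := by exact_mod_cast (by omega : 0 < j)
      have : (0 : ℚ) < M := by exact_mod_cast (by omega : 0 < M)
      positivity
    have h3 := le_condUtilSum_mul hds (R := cum M U j) (down_cum M U (j - 1))
    rw [← div_le_iff₀ hpos] at h3
    have h4 : (((restrictedValue ds (cum M U j) : ℝ) - (restrictedValue ds (cum M U (j - 1)) : ℝ)) /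
        (prAll ds (cum M U j) : ℝ)) ≤ (condUtilSum ds (cum M U (j - 1)) (cum M U j) : ℝ) := by
      exact_mod_cast h3
    have h5 : ((weight M j : ℚ) : ℝ) = ((j : ℝ) - 5) / (M - 1) := by simp [weight]
    rw [h5]
    exact mul_le_mul_of_nonneg_left h4 (div_nonneg (by linarith) (by linarith))
  refine le_trans (le_of_eq ?_) (hmain.trans hobj)
  have hM1 : (M : ℝ) - 1 ≠ 0 := by linarith
  rw [ratio, hVM]
  have hs : ∑ j ∈ Finset.Icc 6 M, f ((j : ℝ) / M) * (value J C : ℝ) / ((j : ℝ) - 1) =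
      (∑ j ∈ Finset.Icc 6 M, f ((j : ℝ) / M) / ((j : ℝ) - 1)) * value J C := by
    rw [Finset.sum_mul]
    exact Finset.sum_congr rfl fun j _ => by ring
  rw [hs]
  field_simp

/-! ### The approximation guarantee -/

theorem mem_utilities_of_chosen {J : Inst} {C : List ℕ} (hC : IsConfig J C) :
    ∀ d ∈ chosen J C, ∀ w ∈ d, w.uA ∈ utilities J := by
  unfold IsConfig at hC
  induction hC with
  | nil => simp [chosen]
  | @cons cfgs c J C hc _ ih =>
    intro d hd w hw
    simp only [chosen, List.zipWith_cons_cons, List.mem_cons] at hd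
    unfold utilities
    rw [List.flatMap_cons, List.mem_append]
    rcases hd with rfl | hd
    · left
      rw [List.mem_flatMap]
      refine ⟨_, ?_, List.mem_map_of_mem hw⟩
      simp [List.getD, hc]
    · exact Or.inr (ih d hd w hw)

theorem IsConfig.length_chosen {J : Inst} {C : List ℕ} (hC : IsConfig J C) :
    (chosen J C).length = J.length := by
  have := hC.length_eq
  simp [chosen, this]

theorem Valid.isConfig_scheme {I : Inst} (hI : Valid I) (M : ℕ) : IsConfig I (scheme M I).val := by
  rw [← isConfig_preprocess (M := M)]
  refine (scheme_spec rfl fun cfgs hcfgs => ?_).1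
  rw [preprocess_val] at hcfgs
  obtain ⟨i, hi, rfl⟩ := List.mem_mapIdx.1 hcfgs
  have := (hI.2 _ (List.getElem_mem hi)).1
  simpa using this

theorem Valid.value_nonneg {I : Inst} (hI : Valid I) {C : List ℕ} (hC : IsConfig I C) :
    0 ≤ value I C := by
  rw [← hI.value_preprocess one_pos hC]
  exact expect_nonneg (fun d hd => ((hI.separated one_pos hC).isProb d hd).prob_nonneg)
    fun ω _ => principalUtil_nonneg ω

theorem Valid.scheme_value {M : ℕ} (hM : 6 ≤ M) {I : Inst} (hI : Valid I) {f : ℝ → ℝ}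
    (hf : AntitoneOn f (Set.Ioc 0 1)) {C : List ℕ} (hC : IsConfig I C)
    (hal : ∀ T : ℚ, 0 < cdf (preprocess M I).val C T → (condValue (preprocess M I).val C T : ℝ) ≤
      f (cdf (preprocess M I).val C T : ℝ) * (value (preprocess M I).val C : ℝ)) :
    ratio M (fun j => f ((j : ℝ) / M)) * (value I C : ℝ) ≤ (value I (scheme M I).val : ℝ) := by
  have hM0 : 0 < M := by omega
  have hM6 : (6 : ℝ) ≤ M := by exact_mod_cast hM
  have hout := hI.isConfig_scheme M
  have hne : ∀ {C}, IsConfig I C → chosen (preprocess M I).val C ≠ [] := fun {C} hC => by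
    have h1 := (isConfig_preprocess (M := M)).2 hC
    rw [← List.length_pos_iff, h1.length_chosen, preprocess_val, List.length_mapIdx,
      List.length_pos_iff]
    exact hI.1
  obtain ⟨J, hJ⟩ : ∃ J, J = (preprocess M I).val := ⟨_, rfl⟩
  have hCJ : IsConfig J C := hJ ▸ isConfig_preprocess.2 hC
  have hoptJ := hI.separated hM0 hC
  have hlenJ : ∀ {C}, IsConfig J C → (chosen J C).length = J.length := fun h => h.length_chosen
  rw [← hI.value_preprocess hM0 hC, ← hI.value_preprocess hM0 hout]
  have hval0 : (0 : ℝ) ≤ (value (preprocess M I).val (scheme M I).val : ℝ) := by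
    rw [hI.value_preprocess hM0 hout]; exact_mod_cast hI.value_nonneg hout
  by_cases hneg : ratio M (fun j => f ((j : ℝ) / M)) * (value (preprocess M I).val C : ℝ) ≤ 0
  · exact hneg.trans hval0
  have hneg := not_le.1 hneg
  have hneC := hne hC
  rw [← hJ] at hal hneg hoptJ hneC ⊢
  -- The profile of the quantiles of the optimal configuration.
  have hS : ∀ {C}, IsConfig J C → ∀ d ∈ chosen J C, ∀ w ∈ d, w.uA ∈ (utilities J).toFinset :=
    fun h d hd w hw => List.mem_toFinset.2 (mem_utilities_of_chosen h d hd w hw)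
  have hS0 : (utilities J).toFinset.Nonempty := by
    obtain ⟨d, hd⟩ := List.exists_mem_of_ne_nil _ hneC
    have hd1 := (hoptJ.isProb d hd).sum_eq
    obtain ⟨w, hw⟩ := List.exists_mem_of_ne_nil d (by rintro rfl; simp at hd1)
    exact ⟨_, hS hCJ d hd w hw⟩
  obtain ⟨U, hU, hUS, htop, hQ⟩ := hoptJ.exists_profile (by omega) hneC (hS hCJ) hS0
  have hmeet := meets_of_quantiles (by omega) hU hoptJ.isProb hneC hQ
  rw [hlenJ hCJ] at hmeet
  obtain ⟨C', hsol, hC', hmeet', hobj⟩ := solve_optimal (M := M) (n := J.length) (U := U)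
    (N := M ^ 2 * J.length * J.length)
    (keys := (tuplesC (downFromC (M ^ 2 * J.length * J.length)).val M).val)
    (fun k hk hkN => mem_tuplesC.2 ⟨hk, fun x hx => mem_downFromC.2 (hkN x hx)⟩) hCJ
    (fun j h1 h2 => by
      have := (totalCount_bounds (M := M) (D := M ^ 2 * J.length) (U := U) hoptJ.isProb j).2.2
      rwa [hlenJ hCJ] at this) hmeet
  have hC'I : IsConfig I C' := isConfig_preprocess.1 (hJ ▸ hC')
  have hsep' := hI.separated hM0 hC'I
  have hsepo := hI.separated hM0 hout
  have hneC' := hne hC'I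
  have hneo := hne hout
  rw [← hJ] at hsep' hsepo hneC' hneo
  have hbest : value J C' ≤ value J (scheme M I).val := by
    have h1 := (scheme_spec hJ.symm fun cfgs hcfgs => by
      rw [hJ, preprocess_val] at hcfgs
      obtain ⟨i, hi, rfl⟩ := List.mem_mapIdx.1 hcfgs
      have := (hI.2 _ (List.getElem_mem hi)).1
      simpa using this).2 _ rfl (profile M U) (by simp [profile])
      (fun x hx => by
        obtain ⟨j, hj, rfl⟩ := List.mem_map.1 hx
        rw [List.mem_range'_1] at hj
        exact List.mem_toFinset.1 (hUS j hj.1 (by omega)))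
      (sortedC_val _ (by
        refine List.pairwise_map.2 ?_
        refine List.Pairwise.imp_of_mem ?_ (List.pairwise_lt_range' (s := 1) (n := M))
        intro i j hi hj hij
        rw [List.mem_range'_1] at hi hj
        exact hU i j hi.1 hij.le (by omega))) C' (by rw [mkBins_profile]; exact hsol)
    rwa [hsep'.evaluate_val hneC', hsepo.evaluate_val hneo] at h1
  have hfound := totalObjective_mul_le (by omega) hU hsep'.isProb hneC'
    (fun d hd w hw => htop _ (hS hC' d hd w hw)) (by rw [hlenJ hC']; exact hmeet')
  have hlow := totalObjective_ge hM hf hal hoptJ.isProb (hS hCJ) hU htop hQ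
  have hchain : ((M : ℝ) - 1) / (M - 4) * (totalObjective M U (chosen J C) : ℝ) ≤
      (value J (scheme M I).val : ℝ) := by
    have h1 : ((M : ℚ) - 1) / (M - 4) * totalObjective M U (chosen J C) ≤
        value J (scheme M I).val := by
      refine le_trans (mul_le_mul_of_nonneg_left hobj ?_) (hfound.trans hbest)
      have : (6 : ℚ) ≤ M := by exact_mod_cast hM
      exact div_nonneg (by linarith) (by linarith)
    exact_mod_cast h1
  refine le_trans ?_ hchain
  have hM4 : (0 : ℝ) < (M : ℝ) - 4 := by linarith
  have hM1 : (0 : ℝ) < (M : ℝ) - 1 := by linarith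
  refine le_trans ?_ (mul_le_mul_of_nonneg_left hlow (div_nonneg hM1.le hM4.le))
  have h1 : ((M : ℝ) - 1) / (M - 4) * ((M : ℝ) / (M - 1) * ratio M (fun j => f ((j : ℝ) / M)) *
      (value J C : ℝ)) = (M : ℝ) / (M - 4) * (ratio M (fun j => f ((j : ℝ) / M)) * value J C) := by
    field_simp
  rw [h1]
  refine le_mul_of_one_le_left hneg.le ?_
  rw [one_le_div hM4]
  linarith

/-- The approximation guarantee. For `M = 5` the ratio is not positive, because the alignment at the
top threshold forces `f 1 ≥ 1`, unless the optimum is zero. -/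
theorem Valid.ratio_mul_le {M : ℕ} (hM : 5 ≤ M) {I : Inst} (hI : Valid I) {f : ℝ → ℝ}
    (hf : AntitoneOn f (Set.Ioc 0 1)) (hal : Aligned (preprocess M I).val f) {C : List ℕ}
    (hC : IsOptimal I C) :
    ratio M (fun j => f ((j : ℝ) / M)) * (value I C : ℝ) ≤ (value I (scheme M I).val : ℝ) := by
  have hM0 : 0 < M := by omega
  obtain ⟨C', ⟨hC', hopt'⟩, hal'⟩ := hal
  have hC'I : IsConfig I C' := isConfig_preprocess.1 hC'
  have heq : value I C = value I C' := by
    refine le_antisymm ?_ (hC.2 _ hC'I)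
    rw [← hI.value_preprocess hM0 hC.1, ← hI.value_preprocess hM0 hC'I]
    exact hopt' _ (isConfig_preprocess.2 hC.1)
  rw [heq]
  rcases (by omega : 6 ≤ M ∨ M = 5) with h6 | rfl
  · exact hI.scheme_value h6 hf hC'I hal'
  · have hv := hI.value_nonneg hC'I
    have hout : (0 : ℝ) ≤ (value I (scheme 5 I).val : ℝ) := by
      exact_mod_cast hI.value_nonneg (hI.isConfig_scheme 5)
    refine le_trans ?_ hout
    rcases hv.eq_or_lt with h0 | hpos
    · simp [← h0]
    · have hsep := hI.separated hM0 hC'I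
      obtain ⟨T, hT⟩ : ∃ T : ℚ, ∀ d ∈ chosen (preprocess 5 I).val C', ∀ w ∈ d, w.uA ≤ T := by
        obtain ⟨T, hT⟩ := (utilities (preprocess 5 I).val).toFinset.bddAbove
        exact ⟨T, fun d hd w hw =>
          hT (List.mem_toFinset.2 (mem_utilities_of_chosen hC' d hd w hw))⟩
      have hone : cdf (preprocess 5 I).val C' T = 1 := by
        rw [cdf_eq]
        exact prAll_eq_one hsep.isProb fun d hd w hw => decide_eq_true (hT d hd w hw)
      have h1 := hal' T (by rw [hone]; exact one_pos)
      have h2 : condValue (preprocess 5 I).val C' T = value (preprocess 5 I).val C' := by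
        rw [condValue_eq, ← cdf_eq, hone, div_one]
        exact restrictedValue_eq fun d hd w hw => decide_eq_true (hT d hd w hw)
      rw [h2, hone, hI.value_preprocess hM0 hC'I] at h1
      have hpos' : (0 : ℝ) < (value I C' : ℝ) := by exact_mod_cast hpos
      have h3 : 1 ≤ f 1 := by
        norm_num at h1
        nlinarith
      refine mul_nonpos_of_nonpos_of_nonneg ?_ hpos'.le
      rw [ratio]
      norm_num
      linarith


/-! ### Polynomial bounds -/

/-- The function is given by a polynomial with natural coefficients. -/
@[fun_prop]
def PolyB (f : ℕ → ℕ) : Prop := ∃ P : Polynomial ℕ, ∀ s, f s = P.eval s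

@[fun_prop] theorem polyB_id : PolyB fun s => s := ⟨.X, fun s => by simp⟩
@[fun_prop] theorem polyB_const (c : ℕ) : PolyB fun _ => c := ⟨.C c, fun s => by simp⟩
@[fun_prop] theorem PolyB.add {f g : ℕ → ℕ} (hf : PolyB f) (hg : PolyB g) :
    PolyB fun s => f s + g s := by
  obtain ⟨P, hP⟩ := hf
  obtain ⟨Q, hQ⟩ := hg
  exact ⟨P + Q, fun s => by simp [hP, hQ]⟩
@[fun_prop] theorem PolyB.mul {f g : ℕ → ℕ} (hf : PolyB f) (hg : PolyB g) :
    PolyB fun s => f s * g s := by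
  obtain ⟨P, hP⟩ := hf
  obtain ⟨Q, hQ⟩ := hg
  exact ⟨P * Q, fun s => by simp [hP, hQ]⟩
@[fun_prop] theorem PolyB.pow {f : ℕ → ℕ} (hf : PolyB f) (n : ℕ) : PolyB fun s => f s ^ n := by
  obtain ⟨P, hP⟩ := hf
  exact ⟨P ^ n, fun s => by simp [hP]⟩
@[fun_prop] theorem PolyB.comp {f g : ℕ → ℕ} (hf : PolyB f) (hg : PolyB g) :
    PolyB fun s => f (g s) := by
  obtain ⟨P, hP⟩ := hf
  obtain ⟨Q, hQ⟩ := hg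
  exact ⟨P.comp Q, fun s => by simp [hP, hQ]⟩

/-! ### Bit lengths -/

theorem size_le_self (n : ℕ) : Nat.size n ≤ n := Nat.size_le.2 Nat.lt_two_pow_self

theorem size_mul_le (a b : ℕ) : Nat.size (a * b) ≤ Nat.size a + Nat.size b := by
  rw [Nat.size_le, pow_add]
  rcases Nat.eq_zero_or_pos a with rfl | ha
  · rw [zero_mul]; positivity
  · exact Nat.mul_lt_mul'' (Nat.lt_size_self a) (Nat.lt_size_self b)

theorem size_add_le {a b k : ℕ} (ha : Nat.size a ≤ k) (hb : Nat.size b ≤ k) :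
    Nat.size (a + b) ≤ k + 1 := by
  rw [Nat.size_le] at *
  rw [pow_succ]
  omega

/-- The bit length of a fraction, even if it is not reduced. -/
theorem bits_le_of_eq {q : ℚ} {n : ℤ} {d : ℕ} (hd : d ≠ 0) (h : q = n / d) :
    bits q ≤ Nat.size n.natAbs + Nat.size d := by
  have hd' : (d : ℤ) ≠ 0 := by exact_mod_cast hd
  have h' : q = (n : ℚ) / ((d : ℤ) : ℚ) := by rw [h]; push_cast; rfl
  rw [Rat.intCast_div_eq_divInt] at h'
  subst h'
  have h1 := Rat.num_dvd n hd'
  have h2 := Rat.den_dvd n d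
  refine add_le_add (Nat.size_le_size ?_) (Nat.size_le_size ?_)
  · by_cases hn : n = 0
    · subst hn; simp
    · exact Nat.le_of_dvd (Int.natAbs_pos.2 hn) (Int.natAbs_dvd_natAbs.2 h1)
  · exact Nat.le_of_dvd (Nat.pos_of_ne_zero hd) (by exact_mod_cast h2)

theorem size_num_le (q : ℚ) : Nat.size q.num.natAbs ≤ bits q := Nat.le_add_right _ _
theorem size_den_le (q : ℚ) : Nat.size q.den ≤ bits q := Nat.le_add_left _ _

theorem bits_zero : bits 0 = 1 := by simp [bits]

theorem bits_natCast (n : ℕ) : bits (n : ℚ) = Nat.size n + 1 := by simp [bits]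

theorem bits_add_le (a b : ℚ) : bits (a + b) ≤ 2 * (bits a + bits b) + 1 := by
  have h : a + b = ((a.num * b.den + b.num * a.den : ℤ) : ℚ) / ((a.den * b.den : ℕ) : ℚ) := by
    have ha : (a.den : ℚ) ≠ 0 := by exact_mod_cast a.den_nz
    have hb : (b.den : ℚ) ≠ 0 := by exact_mod_cast b.den_nz
    push_cast
    rw [eq_div_iff (mul_ne_zero ha hb)]
    have e1 := Rat.mul_den_eq_num a
    have e2 := Rat.mul_den_eq_num b
    linear_combination (b.den : ℚ) * e1 + (a.den : ℚ) * e2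
  refine (bits_le_of_eq (Nat.mul_ne_zero a.den_nz b.den_nz) h).trans ?_
  have h1 : Nat.size (a.num * b.den + b.num * a.den : ℤ).natAbs ≤ bits a + bits b + 1 := by
    refine (Nat.size_le_size (Int.natAbs_add_le _ _)).trans (size_add_le ?_ ?_)
    · rw [Int.natAbs_mul, Int.natAbs_natCast]
      exact (size_mul_le _ _).trans (add_le_add (size_num_le a) (size_den_le b))
    · rw [Int.natAbs_mul, Int.natAbs_natCast, add_comm]
      exact (size_mul_le _ _).trans ((add_le_add (size_num_le b) (size_den_le a)))
  have h2 : Nat.size (a.den * b.den) ≤ bits a + bits b :=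
    (size_mul_le _ _).trans (add_le_add (size_den_le a) (size_den_le b))
  omega

theorem size_floor_le (q : ℚ) : Nat.size ⌊q⌋₊ ≤ bits q := by
  refine le_trans (Nat.size_le_size ?_) (size_num_le q)
  rcases le_or_gt 0 q with h | h
  · refine Nat.floor_le_of_le ?_
    have h1 : (q.num.natAbs : ℚ) = q.num := by
      rw [← Int.cast_natCast, Int.natAbs_of_nonneg (Rat.num_nonneg.2 h)]
    have h2 : (1 : ℚ) ≤ q.den := by exact_mod_cast q.den_pos
    rw [h1, ← Rat.mul_den_eq_num]
    exact le_mul_of_one_le_right h h2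
  · rw [Nat.floor_of_nonpos h.le]; exact Nat.zero_le _

theorem bits_neg (a : ℚ) : bits (-a) = bits a := by simp [bits]

theorem bits_sub_le (a b : ℚ) : bits (a - b) ≤ 2 * (bits a + bits b) + 1 := by
  rw [sub_eq_add_neg, ← bits_neg b]; exact bits_add_le a (-b)

theorem bits_mul_le (a b : ℚ) : bits (a * b) ≤ bits a + bits b := by
  have h : a * b = ((a.num * b.num : ℤ) : ℚ) / ((a.den * b.den : ℕ) : ℚ) := by
    push_cast
    rw [mul_div_mul_comm, Rat.num_div_den, Rat.num_div_den]
  refine (bits_le_of_eq (Nat.mul_ne_zero a.den_nz b.den_nz) h).trans ?_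
  rw [Int.natAbs_mul]
  have h1 := size_mul_le a.num.natAbs b.num.natAbs
  have h2 := size_mul_le a.den b.den
  unfold bits
  omega

theorem bits_inv_le (a : ℚ) : bits a⁻¹ ≤ bits a := by
  by_cases h : a = 0
  · subst h; simp
  have hn : a.num ≠ 0 := Rat.num_ne_zero.2 h
  have h1 : a⁻¹ = ((a.num.sign * a.den : ℤ) : ℚ) / ((a.num.natAbs : ℕ) : ℚ) := by
    have h2 : ((a.num.natAbs : ℕ) : ℚ) = ((a.num.sign * a.num : ℤ) : ℚ) := by
      rw [Int.sign_mul_self]; push_cast; simp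
    have h3 : ((a.num.sign : ℤ) : ℚ) ≠ 0 := by
      exact_mod_cast mt Int.sign_eq_zero_iff_zero.1 hn
    rw [h2]
    push_cast
    rw [mul_div_mul_left _ _ h3]
    conv_lhs => rw [← Rat.num_div_den a]
    rw [inv_div]
  refine (bits_le_of_eq (Int.natAbs_ne_zero.2 hn) h1).trans ?_
  rw [Int.natAbs_mul, Int.natAbs_sign_of_ne_zero hn, one_mul, Int.natAbs_natCast, add_comm]
  rfl

theorem bits_div_le (a b : ℚ) : bits (a / b) ≤ bits a + bits b := by
  rw [div_eq_mul_inv]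
  exact (bits_mul_le _ _).trans (Nat.add_le_add_left (bits_inv_le b) _)

/-- The bit length of a sum is linear in the total bit length of its terms, by a common
denominator. -/
theorem bits_sum_le {l : List ℚ} {B : ℕ} (h : ∀ q ∈ l, bits q ≤ B) :
    bits l.sum ≤ 2 * B * l.length + l.length + 2 := by
  have key : ∃ (n : ℤ) (d : ℕ), d ≠ 0 ∧ l.sum = n / d ∧ d ≤ 2 ^ (B * l.length) ∧
      n.natAbs ≤ l.length * 2 ^ (B * l.length) := by
    induction l with
    | nil => exact ⟨0, 1, by simp, by simp, by simp, by simp⟩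
    | cons q l ih =>
      simp only [List.mem_cons, forall_eq_or_imp] at h
      obtain ⟨n, d, h1, h2, h3, h4⟩ := ih h.2
      have hn : q.num.natAbs ≤ 2 ^ B :=
        (Nat.size_le.1 ((size_num_le q).trans h.1)).le
      have hd : q.den ≤ 2 ^ B := (Nat.size_le.1 ((size_den_le q).trans h.1)).le
      refine ⟨q.num * d + n * q.den, q.den * d, Nat.mul_ne_zero q.den_nz h1, ?_, ?_, ?_⟩
      · have e1 : (q.den : ℚ) ≠ 0 := by exact_mod_cast q.den_nz
        have e2 : (d : ℚ) ≠ 0 := by exact_mod_cast h1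
        rw [List.sum_cons, h2]
        push_cast
        conv_lhs => rw [← Rat.num_div_den q]
        field_simp
        try ring
      · rw [List.length_cons, mul_add, mul_one, add_comm, pow_add]
        exact Nat.mul_le_mul hd h3
      · refine (Int.natAbs_add_le _ _).trans ?_
        rw [Int.natAbs_mul, Int.natAbs_mul, Int.natAbs_natCast, Int.natAbs_natCast,
          List.length_cons, mul_add B, mul_one, add_comm (B * l.length), pow_add]
        have e1 := Nat.mul_le_mul hn h3
        have e2 := Nat.mul_le_mul h4 hd
        calc _ ≤ 2 ^ B * 2 ^ (B * l.length) + l.length * 2 ^ (B * l.length) * 2 ^ B :=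
              add_le_add e1 e2
          _ = _ := by ring
  obtain ⟨n, d, h1, h2, h3, h4⟩ := key
  refine (bits_le_of_eq h1 h2).trans ?_
  have hp : Nat.size (2 ^ (B * l.length)) = B * l.length + 1 := Nat.size_pow
  have h5 := (Nat.size_le_size h4).trans (size_mul_le _ _)
  have h6 := Nat.size_le_size h3
  have h7 := size_le_self l.length
  have h8 : 2 * B * l.length = B * l.length + B * l.length := by ring
  omega

/-! ### Step counts of the list procedures -/

section ListSteps

variable {α β : Type}

theorem mapC_steps_le {f : α → Cost β} {l : List α} {B : ℕ} (h : ∀ a ∈ l, (f a).steps ≤ B) :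
    (mapC f l).steps ≤ l.length * (B + 1) + 1 := by
  induction l with
  | nil => simp [mapC]
  | cons a l ih =>
    simp only [List.mem_cons, forall_eq_or_imp] at h
    have := ih h.2
    simp only [mapC, Cost.bind_steps, tick_steps, Cost.pure_steps, List.length_cons]
    linarith [h.1]

@[simp] theorem appendC_steps (k l : List α) : (appendC k l).steps = k.length + 1 := by
  induction k with
  | nil => simp [appendC]
  | cons a k ih => simp [appendC, ih]; omega

theorem bindC_steps_le {f : α → Cost (List β)} {l : List α} {B L : ℕ}
    (h : ∀ a ∈ l, (f a).steps ≤ B ∧ (f a).val.length ≤ L) :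
    (bindC f l).steps ≤ l.length * (B + L + 2) + 1 := by
  induction l with
  | nil => simp [bindC]
  | cons a l ih =>
    simp only [List.mem_cons, forall_eq_or_imp] at h
    have := ih h.2
    simp only [bindC, Cost.bind_steps, tick_steps, appendC_steps, List.length_cons]
    linarith [h.1.1, h.1.2]

theorem filterC_steps_le {p : α → Cost Bool} {l : List α} {B : ℕ} (h : ∀ a ∈ l, (p a).steps ≤ B) :
    (filterC p l).steps ≤ l.length * (B + 1) + 1 := by
  induction l with
  | nil => simp [filterC]
  | cons a l ih =>
    simp only [List.mem_cons, forall_eq_or_imp] at h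
    have := ih h.2
    simp only [filterC, Cost.bind_steps, tick_steps, Cost.ite_steps, Cost.pure_steps, ite_self,
      List.length_cons]
    linarith [h.1]

theorem lengthC_steps_le (l : List α) : (lengthC l).steps ≤ l.length * (l.length + 3) + 1 := by
  induction l with
  | nil => simp [lengthC]
  | cons a l ih =>
    have h := size_le_self l.length
    simp only [lengthC, Cost.bind_steps, tick_steps, addN_steps, lengthC_val, Nat.size_one,
      List.length_cons]
    nlinarith

theorem mapIdxC_steps_le {f : ℕ → α → Cost β} {i : ℕ} {l : List α} {B : ℕ}
    (h : ∀ k, ∀ a ∈ l, k < i + l.length → (f k a).steps ≤ B) :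
    (mapIdxC f i l).steps ≤ l.length * (B + (i + l.length) + 3) + 1 := by
  induction l generalizing i with
  | nil => simp [mapIdxC]
  | cons a l ih =>
    have h1 := ih (i := i + 1) fun k b hb hk =>
      h k b (List.mem_cons_of_mem a hb) (by rw [List.length_cons]; omega)
    have h2 := h i a List.mem_cons_self (by rw [List.length_cons]; omega)
    have h3 := size_le_self i
    have h4 : i + (l.length + 1) = i + 1 + l.length := by ring
    simp only [mapIdxC, Cost.bind_steps, tick_steps, addN_steps, addN_val, Nat.size_one,
      Cost.pure_steps, List.length_cons, h4]
    nlinarith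

theorem tuplesC_length (l : List α) (k : ℕ) : (tuplesC l k).val.length = l.length ^ k := by
  induction k with
  | zero => simp [tuplesC]
  | succ k ih =>
    simp [tuplesC, List.length_flatMap, ih, pow_succ, mul_comm]

theorem tuplesC_steps (k : ℕ) : ∃ p, PolyB p ∧ ∀ (l : List α) (s : ℕ), l.length ≤ s →
    (tuplesC l k).steps ≤ p s := by
  induction k with
  | zero => exact ⟨fun _ => 1, by fun_prop, fun l s _ => by simp [tuplesC]⟩
  | succ k ih =>
    obtain ⟨p, hp, H⟩ := ih
    refine ⟨fun s => 1 + p s + (s * ((s ^ k + 1) + s ^ k + 2) + 1), by fun_prop, fun l s hl => ?_⟩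
    have h1 : (bindC (fun a => mapC (fun t => pure (a :: t)) (tuplesC l k).val) l).steps ≤
        l.length * ((l.length ^ k + 1) + l.length ^ k + 2) + 1 := by
      refine bindC_steps_le fun a _ => ⟨?_, by simp [tuplesC_length]⟩
      have := mapC_steps_le (f := fun t => (pure (a :: t) : Cost (List α)))
        (l := (tuplesC l k).val) (B := 0) (by simp)
      simpa [tuplesC_length] using this
    have h2 : l.length * ((l.length ^ k + 1) + l.length ^ k + 2) + 1 ≤
        s * ((s ^ k + 1) + s ^ k + 2) + 1 := by gcongr
    have h3 := H l s hl
    simp only [tuplesC, Cost.bind_steps, tick_steps]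
    omega

theorem nthC_steps_le (dflt : α) (l : List α) (k : ℕ) :
    (nthC dflt l k).steps ≤ l.length + 1 := by
  induction l generalizing k with
  | nil => simp [nthC]
  | cons a l ih =>
    cases k with
    | zero => simp [nthC]
    | succ k =>
      have := ih k
      simp only [nthC, Cost.bind_steps, tick_steps, List.length_cons]
      omega

end ListSteps

theorem downFromC_steps_le (N : ℕ) : (downFromC N).steps ≤ N * (N + 3) + 1 := by
  induction N with
  | zero => simp [downFromC]
  | succ N ih =>
    have h := size_le_self N
    simp only [downFromC, Cost.bind_steps, addN_steps, Nat.size_one, Cost.pure_steps]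
    nlinarith

theorem downFromC_length (N : ℕ) : (downFromC N).val.length = N + 1 := by
  induction N with
  | zero => simp [downFromC]
  | succ N ih => simp [downFromC, ih]

theorem addVecC_steps_le {k l : List ℕ} {s : ℕ} (hk : ∀ x ∈ k, Nat.size x ≤ s)
    (hl : ∀ x ∈ l, Nat.size x ≤ s) :
    (addVecC k l).steps ≤ k.length * (2 * s + 1) + 1 := by
  induction k generalizing l with
  | nil => simp [addVecC]
  | cons a k ih =>
    cases l with
    | nil => simp [addVecC]
    | cons b l =>
      simp only [List.mem_cons, forall_eq_or_imp] at hk hl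
      have h1 := ih hk.2 hl.2
      have h2 := hk.1
      have h3 := hl.1
      simp only [addVecC, Cost.bind_steps, addN_steps, Cost.pure_steps, List.length_cons]
      linarith

theorem eqVecC_steps_le {k l : List ℕ} {s : ℕ} (hk : ∀ x ∈ k, Nat.size x ≤ s)
    (hl : ∀ x ∈ l, Nat.size x ≤ s) :
    (eqVecC k l).steps ≤ k.length * (2 * s + 1) + 1 := by
  induction k generalizing l with
  | nil => cases l <;> simp [eqVecC]
  | cons a k ih =>
    cases l with
    | nil => simp [eqVecC]
    | cons b l =>
      simp only [List.mem_cons, forall_eq_or_imp] at hk hl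
      have h1 := ih hk.2 hl.2
      have h2 := hk.1
      have h3 := hl.1
      simp only [eqVecC, Cost.bind_steps, eqN_steps, Cost.pure_steps, List.length_cons,
        Cost.ite_steps]
      split_ifs
      · linarith
      · nlinarith

theorem sq_bits_le {a b : ℚ} {s : ℕ} (ha : bits a ≤ s) (hb : bits b ≤ s) :
    (bits a + bits b) ^ 2 ≤ (2 * s) ^ 2 := Nat.pow_le_pow_left (by omega) 2

theorem sortedC_steps_le {l : List ℚ} {s : ℕ} (hl : ∀ x ∈ l, bits x ≤ s) :
    (sortedC l).steps ≤ l.length * (2 * s) ^ 2 + 1 := by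
  induction l with
  | nil => simp [sortedC]
  | cons a l ih =>
    cases l with
    | nil => simp [sortedC]
    | cons b l =>
      have h1 := ih fun x hx => hl x (List.mem_cons_of_mem a hx)
      have h2 := sq_bits_le (hl a (by simp)) (hl b (by simp))
      simp only [sortedC, Cost.bind_steps, leQ_steps, Cost.ite_steps, Cost.pure_steps,
        List.length_cons] at h1 ⊢
      split_ifs
      · linarith
      · nlinarith

theorem sumMassC_bits {g : Mass → Cost ℚ} {p : ℚ → Cost Bool} {d : Dist} {s : ℕ}
    (hd : d.length ≤ s) (hb : ∀ w ∈ d, bits (g w).val ≤ s) :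
    bits (sumMassC g p d).val ≤ 2 * s * s + s + 2 := by
  have h : (sumMassC g p d).val =
      ((d.filter fun w => (p w.uA).val).map fun w => (g w).val).sum := by
    induction d with
    | nil => simp [sumMassC]
    | cons w d ih =>
      have := ih (by rw [List.length_cons] at hd; omega) fun v hv => hb v (by simp [hv])
      by_cases hp : (p w.uA).val <;> simp [sumMassC, this, hp]
  rw [h]
  have h1 : (((d.filter fun w => (p w.uA).val).map fun w => (g w).val)).length ≤ s := by
    rw [List.length_map]; exact (List.length_filter_le _ _).trans hd
  refine (bits_sum_le (B := s) fun q hq => ?_).trans (by gcongr)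
  obtain ⟨w, hw, rfl⟩ := List.mem_map.1 hq
  exact hb w (List.mem_filter.1 hw).1

theorem sumMassC_steps : ∃ P, PolyB P ∧ ∀ (g : Mass → Cost ℚ) (p : ℚ → Cost Bool) (d : Dist) (s : ℕ),
    d.length ≤ s → (∀ w ∈ d, bits (g w).val ≤ s ∧ (g w).steps ≤ s ∧ (p w.uA).steps ≤ s) →
    (sumMassC g p d).steps ≤ P s := by
  refine ⟨fun s => s * (1 + 2 * s + (s + (2 * s * s + s + 2)) ^ 2) + 1, by fun_prop, ?_⟩
  intro g p d s hd H
  refine le_trans (b := d.length * (1 + 2 * s + (s + (2 * s * s + s + 2)) ^ 2) + 1) ?_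
    (by beta_reduce; gcongr)
  induction d with
  | nil => simp [sumMassC]
  | cons w d ih =>
    have hd' : d.length ≤ s := by rw [List.length_cons] at hd; omega
    have h1 := ih hd' fun v hv => H v (by simp [hv])
    obtain ⟨h2, h3, h4⟩ := H w (by simp)
    have h5 := sumMassC_bits (g := g) (p := p) hd' fun v hv => (H v (by simp [hv])).1
    have h6 := Nat.pow_le_pow_left (add_le_add h2 h5) 2
    have h7 := Nat.zero_le ((s + (2 * s * s + s + 2)) ^ 2)
    simp only [sumMassC, Cost.bind_steps, tick_steps, Cost.ite_steps, Cost.pure_steps, addQ_steps,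
      List.length_cons]
    split_ifs <;> linarith


/-! ### Step count of the preprocessing -/

/-- All numbers of the mass point have at most `s` bits. -/
def SizedMass (s : ℕ) (w : Mass) : Prop := bits w.uA ≤ s ∧ bits w.uP ≤ s ∧ bits w.prob ≤ s

/-- At most `s` mass points, all of whose numbers have at most `s` bits. -/
def SizedDist (s : ℕ) (d : Dist) : Prop := d.length ≤ s ∧ ∀ w ∈ d, SizedMass s w

/-- At most `s` actions with at most `s` configurations of size at most `s`. -/
def SizedInst (s : ℕ) (I : Inst) : Prop :=
  I.length ≤ s ∧ ∀ cfgs ∈ I, cfgs.length ≤ s ∧ ∀ d ∈ cfgs, SizedDist s d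

/-- All numbers of the tagged mass point have at most `s` bits, and its tags are at most `s`. -/
def SizedTagged (s : ℕ) (t : Tagged) : Prop := t.act ≤ s ∧ t.conf ≤ s ∧ SizedMass s t.mass

theorem SizedMass.mono {s s' : ℕ} (h : s ≤ s') {w : Mass} (hw : SizedMass s w) :
    SizedMass s' w := ⟨hw.1.trans h, hw.2.1.trans h, hw.2.2.trans h⟩

theorem SizedDist.mono {s s' : ℕ} (h : s ≤ s') {d : Dist} (hd : SizedDist s d) :
    SizedDist s' d := ⟨hd.1.trans h, fun w hw => (hd.2 w hw).mono h⟩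

theorem SizedInst.mono {s s' : ℕ} (h : s ≤ s') {I : Inst} (hI : SizedInst s I) :
    SizedInst s' I :=
  ⟨hI.1.trans h, fun c hc => ⟨(hI.2 c hc).1.trans h, fun d hd => ((hI.2 c hc).2 d hd).mono h⟩⟩

theorem SizedTagged.mono {s s' : ℕ} (h : s ≤ s') {t : Tagged} (ht : SizedTagged s t) :
    SizedTagged s' t := ⟨ht.1.trans h, ht.2.1.trans h, ht.2.2.mono h⟩

theorem length_flatMap_le {α β : Type} {f : α → List β} {l : List α} {L : ℕ}
    (h : ∀ a ∈ l, (f a).length ≤ L) : (l.flatMap f).length ≤ l.length * L := by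
  induction l with
  | nil => simp
  | cons a l ih =>
    simp only [List.mem_cons, forall_eq_or_imp] at h
    rw [List.flatMap_cons, List.length_append, List.length_cons, add_mul, one_mul, add_comm]
    exact add_le_add (ih h.2) h.1

theorem bindC_pure_steps_le {α : Type} {l : List (List α)} {L : ℕ} (h : ∀ a ∈ l, a.length ≤ L) :
    (bindC pure l).steps ≤ l.length * (L + 2) + 1 := by
  have := bindC_steps_le (f := fun a : List α => pure a) (l := l) (B := 0) (L := L)
    fun a ha => ⟨by simp, h a ha⟩
  simpa using this

theorem collect_steps : ∃ p, PolyB p ∧ ∀ (I : Inst) (s : ℕ), SizedInst s I →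
    (collect I).steps ≤ p s ∧ (collect I).val.length ≤ p s ∧
      ∀ t ∈ (collect I).val, SizedTagged s t := by
  refine ⟨fun s => (s * ((s * ((s + 1) + s + 3) + 1) + (s * (s + 2) + 1) + s + 3) + 1) +
    (s * (s * s + 2) + 1), by fun_prop, fun I s hI => ⟨?_, ?_, fun t ht => ?_⟩⟩
  · have h1 : ∀ k, ∀ cfgs ∈ I, k < 0 + I.length → ((do
        let perConf ← mapIdxC (fun j d => mapC (fun w => pure (Tagged.mk k j w)) d) 0 cfgs
        bindC pure perConf : Cost (List Tagged))).steps ≤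
        (s * ((s + 1) + s + 3) + 1) + (s * (s + 2) + 1) := by
      intro k cfgs hc _
      obtain ⟨hlen, hd⟩ := hI.2 cfgs hc
      rw [Cost.bind_steps]
      refine add_le_add ?_ ?_
      · refine (mapIdxC_steps_le (B := s + 1) fun j d hd' _ => ?_).trans (by gcongr; omega)
        refine (mapC_steps_le (B := 0) fun _ _ => by simp).trans ?_
        have := (hd d hd').1
        omega
      · refine (bindC_pure_steps_le (L := s) fun a ha => ?_).trans ?_
        · simp only [mapIdxC_val, mapC_val, List.mem_mapIdx] at ha
          obtain ⟨j, hj, rfl⟩ := ha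
          simpa using (hd _ (List.getElem_mem hj)).1
        · simp only [mapIdxC_val, List.length_mapIdx]
          gcongr
    unfold collect
    rw [Cost.bind_steps]
    refine add_le_add ?_ ?_
    · refine (mapIdxC_steps_le h1).trans ?_
      have := hI.1
      gcongr
      omega
    · refine (bindC_pure_steps_le (L := s * s) fun a ha => ?_).trans ?_
      · simp only [mapIdxC_val, List.mem_mapIdx] at ha
        obtain ⟨k, hk, rfl⟩ := ha
        obtain ⟨hlen, hd⟩ := hI.2 _ (List.getElem_mem hk)
        simp only [Cost.bind_val, mapIdxC_val, bindC_val, Cost.pure_val, mapC_val]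
        refine (length_flatMap_le (L := s) fun b hb => ?_).trans ?_
        · obtain ⟨j, hj, rfl⟩ := List.mem_mapIdx.1 hb
          simpa using (hd _ (List.getElem_mem hj)).1
        · rw [List.length_mapIdx]; gcongr
      · simp only [mapIdxC_val, List.length_mapIdx]
        have := hI.1
        gcongr
  · refine le_trans (b := s * (s * s)) ?_ (by beta_reduce; nlinarith)
    simp only [collect, Cost.bind_val, mapIdxC_val, bindC_val, Cost.pure_val, mapC_val]
    refine (length_flatMap_le (L := s * s) fun a ha => ?_).trans ?_
    · obtain ⟨k, hk, rfl⟩ := List.mem_mapIdx.1 ha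
      obtain ⟨hlen, hd⟩ := hI.2 _ (List.getElem_mem hk)
      refine (length_flatMap_le (L := s) fun b hb => ?_).trans ?_
      · obtain ⟨j, hj, rfl⟩ := List.mem_mapIdx.1 hb
        simpa using (hd _ (List.getElem_mem hj)).1
      · rw [List.length_mapIdx]; gcongr
    · rw [List.length_mapIdx]
      have := hI.1
      gcongr
  · obtain ⟨cfgs, h1, d, h2, h3⟩ := mem_collect.1 ht
    obtain ⟨hi, rfl⟩ := List.getElem?_eq_some_iff.1 h1
    obtain ⟨hc, rfl⟩ := List.getElem?_eq_some_iff.1 h2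
    obtain ⟨h4, h5⟩ := hI.2 _ (List.getElem_mem hi)
    exact ⟨hi.le.trans hI.1, hc.le.trans h4, (h5 _ (List.getElem_mem hc)).2 _ h3⟩

theorem insertByUP_steps_le {t : Tagged} {l : List Tagged} {s : ℕ} (ht : SizedTagged s t)
    (hl : ∀ x ∈ l, SizedTagged s x) :
    (insertByUP t l).steps ≤ l.length * (1 + (2 * s) ^ 2) + 1 := by
  induction l with
  | nil => simp [insertByUP]
  | cons x l ih =>
    simp only [List.mem_cons, forall_eq_or_imp] at hl
    have h1 := ih hl.2
    have h2 := sq_bits_le ht.2.2.2.1 hl.1.2.2.2.1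
    simp only [insertByUP, Cost.bind_steps, tick_steps, leQ_steps, Cost.ite_steps, Cost.pure_steps,
      List.length_cons]
    split_ifs <;> nlinarith

theorem sortByUP_steps_le {l : List Tagged} {s : ℕ} (hl : ∀ x ∈ l, SizedTagged s x)
    (hlen : l.length ≤ s) :
    (sortByUP l).steps ≤ l.length * (1 + (s * (1 + (2 * s) ^ 2) + 1)) + 1 := by
  induction l with
  | nil => simp [sortByUP]
  | cons t l ih =>
    simp only [List.mem_cons, forall_eq_or_imp] at hl
    rw [List.length_cons] at hlen
    have h1 := ih hl.2 (by omega)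
    have h2 := insertByUP_steps_le (l := (sortByUP l).val) hl.1 fun x hx =>
      hl.2 x ((sortByUP_perm l).mem_iff.1 hx)
    rw [(sortByUP_perm l).length_eq] at h2
    have h3 : l.length * (1 + (2 * s) ^ 2) ≤ s * (1 + (2 * s) ^ 2) :=
      Nat.mul_le_mul_right _ (by omega)
    simp only [sortByUP, Cost.bind_steps, tick_steps, List.length_cons]
    linarith

theorem betterGap_steps {u v : ℚ} {best : Option ℚ} {s : ℕ} (hu : bits u ≤ s) (hv : bits v ≤ s)
    (hb : ∀ h ∈ best, bits h ≤ 4 * s + 1) :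
    (betterGap u v best).steps ≤ 2 * (2 * s) ^ 2 + (2 * (4 * s + 1)) ^ 2 ∧
      ∀ h ∈ (betterGap u v best).val, bits h ≤ 4 * s + 1 := by
  have h1 := sq_bits_le hu hv
  have h2 := sq_bits_le hv hu
  have h3 : bits (v - u) ≤ 4 * s + 1 := (bits_sub_le v u).trans (by omega)
  cases best with
  | none =>
    by_cases h : u < v
    · simp only [betterGap, Cost.bind_steps, ltQ_steps, ltQ_val, h, decide_true, if_true, subQ_steps,
        subQ_val, Cost.pure_steps, Cost.bind_val, Cost.pure_val, Option.mem_def, Option.some.injEq,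
        forall_eq']
      exact ⟨by nlinarith, h3⟩
    · simp only [betterGap, Cost.bind_steps, ltQ_steps, ltQ_val, h, decide_false, Cost.pure_steps,
        Cost.bind_val, Cost.pure_val, Bool.false_eq_true, if_false]
      exact ⟨by nlinarith, by simp⟩
  | some x =>
    have hx := hb x rfl
    have h4 := sq_bits_le h3 hx
    by_cases h : u < v
    · by_cases hc : v - u ≤ x
      · simp only [betterGap, Cost.bind_steps, ltQ_steps, ltQ_val, h, decide_true, if_true,
          subQ_steps, subQ_val, Cost.pure_steps, Cost.bind_val, Cost.pure_val, Option.mem_def,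
          Option.some.injEq, forall_eq', leQ_val, leQ_steps, hc]
        exact ⟨by linarith, h3⟩
      · simp only [betterGap, Cost.bind_steps, ltQ_steps, ltQ_val, h, decide_true, if_true,
          subQ_steps, subQ_val, Cost.pure_steps, Cost.bind_val, Cost.pure_val, Option.mem_def,
          Option.some.injEq, forall_eq', leQ_val, leQ_steps, hc, decide_false, Bool.false_eq_true,
          if_false]
        exact ⟨by linarith, hx⟩
    · simp only [betterGap, Cost.bind_steps, ltQ_steps, ltQ_val, h, decide_false, Cost.pure_steps,
        Cost.bind_val, Cost.pure_val, Bool.false_eq_true, if_false]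
      exact ⟨by nlinarith, hb⟩

theorem minGapFrom_steps {u : ℚ} {l : List Tagged} {best : Option ℚ} {s : ℕ} (hu : bits u ≤ s)
    (hl : ∀ x ∈ l, SizedTagged s x) (hb : ∀ h ∈ best, bits h ≤ 4 * s + 1) :
    (minGapFrom u l best).steps ≤
      l.length * (1 + (2 * (2 * s) ^ 2 + (2 * (4 * s + 1)) ^ 2)) + 1 ∧
      ∀ h ∈ (minGapFrom u l best).val, bits h ≤ 4 * s + 1 := by
  induction l generalizing best with
  | nil => simpa [minGapFrom] using hb
  | cons t l ih =>
    simp only [List.mem_cons, forall_eq_or_imp] at hl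
    obtain ⟨h1, h2⟩ := betterGap_steps hu hl.1.2.2.1 hb
    obtain ⟨h3, h4⟩ := ih hl.2 h2
    simp only [minGapFrom, Cost.bind_steps, tick_steps, Cost.bind_val, List.length_cons]
    exact ⟨by linarith, h4⟩

theorem minGap_steps {k l : List Tagged} {best : Option ℚ} {s : ℕ}
    (hk : ∀ x ∈ k, SizedTagged s x) (hl : ∀ x ∈ l, SizedTagged s x) (hlen : l.length ≤ s)
    (hb : ∀ h ∈ best, bits h ≤ 4 * s + 1) :
    (minGap k l best).steps ≤
      k.length * (1 + (s * (1 + (2 * (2 * s) ^ 2 + (2 * (4 * s + 1)) ^ 2)) + 1)) + 1 ∧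
      ∀ h ∈ (minGap k l best).val, bits h ≤ 4 * s + 1 := by
  induction k generalizing best with
  | nil => simpa [minGap] using hb
  | cons t k ih =>
    simp only [List.mem_cons, forall_eq_or_imp] at hk
    obtain ⟨h1, h2⟩ := minGapFrom_steps hk.1.2.2.1 hl hb
    obtain ⟨h3, h4⟩ := ih hk.2 h2
    have h5 := Nat.mul_le_mul_right (1 + (2 * (2 * s) ^ 2 + (2 * (4 * s + 1)) ^ 2)) hlen
    simp only [minGap, Cost.bind_steps, tick_steps, Cost.bind_val, List.length_cons]
    exact ⟨by linarith, h4⟩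

theorem chooseDelta_steps (M : ℕ) : ∃ p, PolyB p ∧ ∀ (L : List Tagged) (s : ℕ), L.length ≤ s →
    (∀ x ∈ L, SizedTagged s x) →
    (chooseDelta M L).steps ≤ p s ∧ bits (chooseDelta M L).val ≤ p s := by
  refine ⟨fun s => (s * (1 + (s * (1 + (2 * (2 * s) ^ 2 + (2 * (4 * s + 1)) ^ 2)) + 1)) + 1) +
    (s * (s + 3) + 1) + (s + (M ^ 2 + 1) + 1) ^ 2 +
    ((4 * s + 2) + (s * (M ^ 2 + 1) + 1)) ^ 2 + ((4 * s + 2) + (s * (M ^ 2 + 1) + 1)),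
    by fun_prop, fun L s hlen hL => ?_⟩
  obtain ⟨h1, h2⟩ := minGap_steps (best := none) hL hL hlen (by simp)
  have h3 := lengthC_steps_le L
  have h4 : (Nat.size L.length + Nat.size (M ^ 2 + 1) + 1) ^ 2 ≤ (s + (M ^ 2 + 1) + 1) ^ 2 := by
    have e1 := size_le_self L.length
    have e2 := size_le_self (M ^ 2 + 1)
    exact Nat.pow_le_pow_left (by omega) 2
  have h5 : bits ((L.length * (M ^ 2 + 1) : ℕ) : ℚ) ≤ s * (M ^ 2 + 1) + 1 := by
    rw [bits_natCast]
    have e1 := size_le_self (L.length * (M ^ 2 + 1))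
    have e2 := Nat.mul_le_mul_right (M ^ 2 + 1) hlen
    omega
  have h6 : L.length * (L.length + 3) ≤ s * (s + 3) := by gcongr
  have h7 : L.length * (1 + (s * (1 + (2 * (2 * s) ^ 2 + (2 * (4 * s + 1)) ^ 2)) + 1)) ≤
      s * (1 + (s * (1 + (2 * (2 * s) ^ 2 + (2 * (4 * s + 1)) ^ 2)) + 1)) :=
    Nat.mul_le_mul_right _ hlen
  have hfin : ∀ g : ℚ, bits g ≤ 4 * s + 2 →
      (bits g + bits ((L.length * (M ^ 2 + 1) : ℕ) : ℚ)) ^ 2 ≤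
        ((4 * s + 2) + (s * (M ^ 2 + 1) + 1)) ^ 2 ∧
      bits (g / ((L.length * (M ^ 2 + 1) : ℕ) : ℚ)) ≤ (4 * s + 2) + (s * (M ^ 2 + 1) + 1) :=
    fun g hg => ⟨Nat.pow_le_pow_left (add_le_add hg h5) 2, (bits_div_le _ _).trans (add_le_add hg h5)⟩
  cases hg : (minGap L L none).val with
  | none =>
    have hone : bits 1 = 2 := by simp [bits]
    obtain ⟨h8, h9⟩ := hfin 1 (by omega)
    simp only [chooseDelta, Cost.bind_steps, Cost.bind_val, hg, lengthC_val, mulN_val, mulN_steps,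
      divQ_steps, divQ_val]
    exact ⟨by omega, by omega⟩
  | some g =>
    obtain ⟨h8, h9⟩ := hfin g ((h2 g (by simp [hg])).trans (by omega))
    simp only [chooseDelta, Cost.bind_steps, Cost.bind_val, hg, lengthC_val, mulN_val, mulN_steps,
      divQ_steps, divQ_val]
    exact ⟨by omega, by omega⟩


theorem emit_steps_le {δ : ℚ} {t : Tagged} {ℓ s : ℕ} (p : ℚ) (hδ : bits δ ≤ s)
    (ht : SizedTagged s t) (hℓ : ℓ ≤ s) :
    (emit δ t ℓ p).steps ≤ (s + (s + 1)) ^ 2 + (s + (s + (s + 1))) ^ 2 := by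
  have h1 : bits (ℓ : ℚ) ≤ s + 1 := by
    rw [bits_natCast]; have := size_le_self ℓ; omega
  have h2 := Nat.pow_le_pow_left (add_le_add hδ h1) 2
  have h3 := Nat.pow_le_pow_left
    (add_le_add ht.2.2.1 ((bits_mul_le δ ℓ).trans (add_le_add hδ h1))) 2
  simp only [emit, Cost.bind_steps, mulQ_steps, mulQ_val, addQ_steps, Cost.pure_steps]
  omega

theorem splitWhole_steps_le (M : ℕ) {δ : ℚ} {t : Tagged} (rem : ℚ) {k ℓ s : ℕ} (hδ : bits δ ≤ s)
    (ht : SizedTagged s t) (hℓ : ℓ + k ≤ s) :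
    (splitWhole M δ t rem k ℓ).steps ≤
      (k + 1) * ((s + (s + 1)) ^ 2 + (s + (s + (s + 1))) ^ 2 + s + 3) := by
  induction k generalizing ℓ with
  | zero =>
    have h1 := emit_steps_le rem hδ ht (by omega : ℓ ≤ s)
    have h2 := size_le_self ℓ
    simp only [splitWhole, Cost.bind_steps, tick_steps, addN_steps, Nat.size_one, Cost.pure_steps]
    omega
  | succ k ih =>
    have h1 := emit_steps_le (1 / (M : ℚ) ^ 2) hδ ht (by omega : ℓ ≤ s)
    have h2 := size_le_self ℓ
    have h3 := ih (ℓ := ℓ + 1) (by omega)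
    simp only [splitWhole, Cost.bind_steps, tick_steps, addN_steps, addN_val, Nat.size_one,
      Cost.pure_steps]
    rw [add_mul (k + 1), one_mul]
    omega

/-- The number of whole pieces of a mass point, and the bit length of the remainder. -/
theorem bits_rem {M : ℕ} {p : ℚ} {s : ℕ} (hp : bits p ≤ s) (h1 : p ≤ 1) :
    ⌊p * (M : ℚ) ^ 2⌋₊ ≤ M ^ 2 ∧ bits (⌊p * (M : ℚ) ^ 2⌋₊ : ℚ) ≤ M ^ 2 + 1 ∧
      bits (p - ⌊p * (M : ℚ) ^ 2⌋₊ * (1 / (M : ℚ) ^ 2)) ≤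
        2 * (s + ((M ^ 2 + 1) + bits (1 / (M : ℚ) ^ 2))) + 1 := by
  have hf : ⌊p * (M : ℚ) ^ 2⌋₊ ≤ M ^ 2 := by
    refine Nat.floor_le_of_le ?_
    push_cast
    exact mul_le_of_le_one_left (by positivity) h1
  have hb : bits (⌊p * (M : ℚ) ^ 2⌋₊ : ℚ) ≤ M ^ 2 + 1 := by
    rw [bits_natCast]
    have := size_le_self ⌊p * (M : ℚ) ^ 2⌋₊
    omega
  refine ⟨hf, hb, (bits_sub_le _ _).trans ?_⟩
  have := (bits_mul_le (⌊p * (M : ℚ) ^ 2⌋₊ : ℚ) (1 / (M : ℚ) ^ 2)).trans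
    (Nat.add_le_add_right hb _)
  omega

theorem splitAll_steps (M : ℕ) : ∃ P, PolyB P ∧ ∀ (δ : ℚ) (l : List Tagged) (ℓ s : ℕ),
    bits δ ≤ s → (∀ t ∈ l, SizedTagged s t ∧ t.mass.prob ≤ 1) → ℓ + l.length * (M ^ 2 + 1) ≤ s →
    (splitAll M δ l ℓ).steps ≤ l.length * P s + 1 := by
  refine ⟨fun s => (s + bits ((M : ℚ) ^ 2)) ^ 2 + (s + bits ((M : ℚ) ^ 2)) ^ 2 +
    ((M ^ 2 + 1) + bits (1 / (M : ℚ) ^ 2)) ^ 2 +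
    (s + ((M ^ 2 + 1) + bits (1 / (M : ℚ) ^ 2))) ^ 2 +
    (M ^ 2 + 1) * ((s + (s + 1)) ^ 2 + (s + (s + (s + 1))) ^ 2 + s + 3) + (M ^ 2 + 1) + 2,
    by fun_prop, fun δ l ℓ s hδ hl hℓ => ?_⟩
  induction l generalizing ℓ with
  | nil => simp [splitAll]
  | cons t l ih =>
    simp only [List.mem_cons, forall_eq_or_imp] at hl
    obtain ⟨ht, hl⟩ := hl
    have hp := ht.1.2.2.2.2
    obtain ⟨hf, hb, -⟩ := bits_rem (M := M) hp ht.2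
    rw [List.length_cons, add_mul, one_mul] at hℓ
    have h1 := Nat.pow_le_pow_left (Nat.add_le_add_right hp (bits ((M : ℚ) ^ 2))) 2
    have h2 := Nat.pow_le_pow_left ((bits_mul_le t.mass.prob ((M : ℚ) ^ 2)).trans
      (Nat.add_le_add_right hp _)) 2
    have h3 := Nat.pow_le_pow_left (Nat.add_le_add_right hb (bits (1 / (M : ℚ) ^ 2))) 2
    have h4 := Nat.pow_le_pow_left (add_le_add hp
      ((bits_mul_le (⌊t.mass.prob * (M : ℚ) ^ 2⌋₊ : ℚ) (1 / (M : ℚ) ^ 2)).trans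
        (Nat.add_le_add_right hb _))) 2
    have h5 := splitWhole_steps_le M (t.mass.prob - ⌊t.mass.prob * (M : ℚ) ^ 2⌋₊ * (1 / (M : ℚ) ^ 2))
      (k := ⌊t.mass.prob * (M : ℚ) ^ 2⌋₊) (ℓ := ℓ) hδ ht.1 (by omega)
    have h6 : (⌊t.mass.prob * (M : ℚ) ^ 2⌋₊ + 1) *
        ((s + (s + 1)) ^ 2 + (s + (s + (s + 1))) ^ 2 + s + 3) ≤
        (M ^ 2 + 1) * ((s + (s + 1)) ^ 2 + (s + (s + (s + 1))) ^ 2 + s + 3) := by gcongr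
    have h7 := ih (ℓ + ⌊t.mass.prob * (M : ℚ) ^ 2⌋₊ + 1) hl (by omega)
    simp only [splitAll, Cost.bind_steps, tick_steps, mulQ_steps, mulQ_val, floorQ_steps, floorQ_val,
      subQ_steps, subQ_val, appendC_steps, splitWhole_val, List.length_map, length_cuts,
      List.length_cons]
    rw [add_mul, one_mul]
    beta_reduce at h7
    omega

/-- The preprocessing takes polynomially many steps, and the preprocessed instance has polynomial
size. -/
theorem preprocess_steps {M : ℕ} (hM : 0 < M) : ∃ p, PolyB p ∧ ∀ (I : Inst) (s : ℕ), Valid I →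
    SizedInst s I → (preprocess M I).steps ≤ p s ∧ SizedInst (p s) (preprocess M I).val := by
  obtain ⟨p1, hp1, H1⟩ := collect_steps
  obtain ⟨p2, hp2, H2⟩ := chooseDelta_steps M
  obtain ⟨p3, hp3, H3⟩ := splitAll_steps M
  -- A common bound on the list of mass points and on the perturbation.
  obtain ⟨a, ha⟩ : ∃ a : ℕ → ℕ, a = fun s => s + p1 s := ⟨_, rfl⟩
  have hpa : PolyB a := by rw [ha]; fun_prop
  obtain ⟨c, hc⟩ : ∃ c : ℕ → ℕ, c = fun s => a s + p2 (a s) + a s * (M ^ 2 + 1) := ⟨_, rfl⟩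
  have hpc : PolyB c := by rw [hc]; fun_prop
  -- A bound on the size of the pieces.
  obtain ⟨e, he⟩ : ∃ e : ℕ → ℕ, e = fun s => c s + (2 * (c s + (c s + (c s + 1))) + 1) +
    (2 * (c s + ((M ^ 2 + 1) + bits (1 / (M : ℚ) ^ 2))) + 1) + bits (1 / (M : ℚ) ^ 2) := ⟨_, rfl⟩
  have hpe : PolyB e := by rw [he]; fun_prop
  refine ⟨fun s => p1 s + (a s * (1 + (a s * (1 + (2 * a s) ^ 2) + 1)) + 1) + p2 (a s) +
    (c s * p3 (c s) + 1) +
    (s * ((s * (((c s * ((c s + s + 1) + (c s + s + 1) + 1) + 1) + (c s + 1)) + s + 3) + 1) +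
      s + 3) + 1) + (s + c s + e s), by fun_prop, fun I s hI hs => ?_⟩
  obtain ⟨h1, hlen, htag⟩ := H1 I s hs
  have hsa : s ≤ a s := by rw [ha]; exact Nat.le_add_right _ _
  have hac : a s ≤ c s := by rw [hc]; beta_reduce; omega
  have hlena : (collect I).val.length ≤ a s := by rw [ha]; beta_reduce; omega
  have htaga : ∀ t ∈ (collect I).val, SizedTagged (a s) t := fun t ht => (htag t ht).mono hsa
  have hperm := sortByUP_perm (collect I).val
  obtain ⟨h2, hδ⟩ := H2 _ (a s) hlena htaga
  have hδc : bits (delta M I) ≤ c s := hδ.trans (by rw [hc]; beta_reduce; omega)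
  have hlenc : (collect I).val.length * (M ^ 2 + 1) ≤ c s := by
    have := Nat.mul_le_mul_right (M ^ 2 + 1) hlena
    rw [hc]; beta_reduce; omega
  have h3 := sortByUP_steps_le htaga hlena
  have h4 := H3 (delta M I) (sortByUP (collect I).val).val 0 (c s) hδc
    (fun t ht => ⟨(htaga t (hperm.mem_iff.1 ht)).mono hac,
      (hI.collect_spec (hperm.mem_iff.1 ht)).2.1⟩)
    (by rw [hperm.length_eq, zero_add]; exact hlenc)
  rw [hperm.length_eq] at h4
  -- The pieces.
  obtain ⟨L, hL⟩ : ∃ L, L = (allPieces M I).map (shifted (delta M I)) := ⟨_, rfl⟩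
  have hLval : (splitAll M (delta M I) (sortByUP (collect I).val).val 0).val = L := by
    rw [splitAll_val, hL]; rfl
  have hLlen : L.length ≤ c s := by
    have := labeled_length hM (l := (sortByUP (collect I).val).val)
      (fun t ht => (hI.collect_spec (hperm.mem_iff.1 ht)).2.1) 0
    rw [hperm.length_eq] at this
    rw [hL, List.length_map]
    exact this.trans hlenc
  have hLsize : ∀ t ∈ L, t.act ≤ c s ∧ t.conf ≤ c s ∧ SizedMass (e s) t.mass := by
    intro t ht
    rw [hL] at ht
    obtain ⟨x, hx, rfl⟩ := List.mem_map.1 ht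
    obtain ⟨hx1, -, -, hx2⟩ := hI.mem_allPieces hM hx
    obtain ⟨k1, k2, k3, k4, k5⟩ := (htaga _ hx1).mono hac
    have hx3 : bits (x.2.1 : ℚ) ≤ c s + 1 := by
      rw [bits_natCast]; have := size_le_self x.2.1; omega
    refine ⟨k1, k2, ?_, ?_, ?_⟩
    · have e1 := bits_mul_le (delta M I) x.2.1
      have e2 := bits_add_le x.1.mass.uA (delta M I * x.2.1)
      simp only [shifted]
      rw [he]; beta_reduce
      omega
    · simp only [shifted]
      rw [he]; beta_reduce
      omega
    · simp only [shifted]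
      have hprob : ∀ (l : List Tagged) (ℓ : ℕ), ∀ x ∈ labeled M l ℓ, x.2.2 = x.1.mass.prob -
          ⌊x.1.mass.prob * (M : ℚ) ^ 2⌋₊ * (1 / (M : ℚ) ^ 2) ∨ x.2.2 = 1 / (M : ℚ) ^ 2 := by
        intro l
        induction l with
        | nil => simp [labeled]
        | cons t l ih =>
          intro ℓ x hx
          rcases List.mem_append.1 hx with hx | hx
          · obtain ⟨y, hy, rfl⟩ := List.mem_map.1 hx
            exact cuts_prob hy
          · exact ih _ x hx
      have e1 := (bits_rem (M := M) k5 (hI.collect_spec hx1).2.1).2.2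
      rw [he]; beta_reduce
      rcases hprob _ _ x hx with h | h <;> rw [h] <;> omega
  -- Distributing the pieces over the configurations.
  have h5 : (mapIdxC (fun i cfgs => mapIdxC (fun j (_ : Dist) => do
      let mine ← filterC (fun t => do
        let a ← eqN t.act i
        let b ← eqN t.conf j
        pure (a && b)) L
      mapC (fun t => pure t.mass) mine) 0 cfgs) 0 I).steps ≤
      s * ((s * (((c s * ((c s + s + 1) + (c s + s + 1) + 1) + 1) + (c s + 1)) + s + 3) + 1) +
        s + 3) + 1 := by
    refine (mapIdxC_steps_le (B := s * (((c s * ((c s + s + 1) + (c s + s + 1) + 1) + 1) +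
      (c s + 1)) + s + 3) + 1) fun i cfgs hcfgs hi => ?_).trans ?_
    · have hci := (hs.2 cfgs hcfgs).1
      refine (mapIdxC_steps_le (B := ((c s * ((c s + s + 1) + (c s + s + 1) + 1) + 1) +
        (c s + 1))) fun j d hd hj => ?_).trans ?_
      · rw [Cost.bind_steps]
        refine add_le_add ?_ ?_
        · refine (filterC_steps_le (B := (c s + s + 1) + (c s + s + 1)) fun t ht => ?_).trans
            (by gcongr)
          obtain ⟨k1, k2, -⟩ := hLsize t ht
          have e1 := size_le_self t.act
          have e2 := size_le_self t.conf
          have e3 := size_le_self i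
          have e4 := size_le_self j
          have e5 := hs.1
          simp only [Cost.bind_steps, eqN_steps, Cost.pure_steps]
          omega
        · refine (mapC_steps_le (B := 0) fun _ _ => by simp).trans ?_
          have := List.length_filter_le (fun t : Tagged => ((do
            let a ← eqN t.act i
            let b ← eqN t.conf j
            pure (a && b) : Cost Bool)).val) L
          rw [filterC_val]
          omega
      · gcongr
        omega
    · have := hs.1
      gcongr
      omega
  have h6 : (collect I).val.length * p3 (c s) ≤ c s * p3 (c s) :=
    Nat.mul_le_mul_right _ (hlena.trans hac)
  have h7 : (collect I).val.length * (1 + (a s * (1 + (2 * a s) ^ 2) + 1)) ≤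
      a s * (1 + (a s * (1 + (2 * a s) ^ 2) + 1)) := Nat.mul_le_mul_right _ hlena
  constructor
  · unfold preprocess
    simp only [Cost.bind_steps]
    change _ + (_ + (_ + ((splitAll M (delta M I) (sortByUP (collect I).val).val 0).steps + _))) ≤ _
    rw [show (chooseDelta M (collect I).val).val = delta M I from rfl, hLval]
    linarith [Nat.zero_le (s + c s + e s)]
  · refine SizedInst.mono (s := s + c s + e s) (Nat.le_add_left _ _) ?_
    rw [preprocess_val]
    refine ⟨by rw [List.length_mapIdx]; have := hs.1; omega, fun cfgs hcfgs => ?_⟩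
    obtain ⟨i, hi, rfl⟩ := List.mem_mapIdx.1 hcfgs
    refine ⟨by rw [List.length_mapIdx]; have := (hs.2 _ (List.getElem_mem hi)).1; omega,
      fun d hd => ?_⟩
    obtain ⟨j, hj, rfl⟩ := List.mem_mapIdx.1 hd
    constructor
    · rw [List.length_map]
      have e1 := List.length_filter_le (fun x => hasTag i j x.1) (allPieces M I)
      rw [hL, List.length_map] at hLlen
      unfold piecesAt
      omega
    · intro w hw
      obtain ⟨x, hx, rfl⟩ := List.mem_map.1 hw
      have e1 := (hLsize (shifted (delta M I) x)
        (by rw [hL]; exact List.mem_map_of_mem (List.mem_filter.1 hx).1)).2.2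
      exact e1.mono (Nat.le_add_left _ _)


/-! ### Step count of the estimates -/

/-- The numbers of the bin, and the constants of the program that belong to it, have at most `s`
bits. -/
structure SizedBin (M s : ℕ) (b : Bin) : Prop where
  idx : Nat.size b.idx ≤ s
  hi : bits b.hi ≤ s
  lo : ∀ l ∈ b.lo, bits l ≤ s
  weight : bits (weight M b.idx) ≤ s
  lower : bits (lowerBound M b.idx) ≤ s
  upper : bits (upperBound M b.idx) ≤ s

theorem SizedBin.mono {M s s' : ℕ} (h : s ≤ s') {b : Bin} (hb : SizedBin M s b) :
    SizedBin M s' b :=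
  ⟨hb.idx.trans h, hb.hi.trans h, fun l hl => (hb.lo l hl).trans h, hb.weight.trans h,
    hb.lower.trans h, hb.upper.trans h⟩

theorem memCum_steps_le {M s : ℕ} {b : Bin} (hb : SizedBin M s b) {u : ℚ} (hu : bits u ≤ s) :
    (b.memCum u).steps ≤ (2 * s) ^ 2 := by
  have h := sq_bits_le hu hb.hi
  unfold Bin.memCum
  split_ifs <;> simpa using h

theorem mem_steps_le {M s : ℕ} {b : Bin} (hb : SizedBin M s b) {u : ℚ} (hu : bits u ≤ s) :
    (b.mem u).steps ≤ 2 * (2 * s) ^ 2 := by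
  have h := memCum_steps_le hb hu
  unfold Bin.mem
  cases hlo : b.lo with
  | none => simp only; omega
  | some l =>
    have h1 := sq_bits_le (hb.lo l (by simp [hlo])) hu
    simp only [Cost.bind_steps, leQ_steps, Cost.ite_steps, Cost.pure_steps]
    split_ifs <;> omega

theorem condProb_steps : ∃ p, PolyB p ∧ ∀ (M : ℕ) (d : Dist) (b : Bin) (s : ℕ), SizedDist s d →
    SizedBin M s b → (condProb d b).steps ≤ p s ∧ bits (condProb d b).val ≤ p s ∧
      (condUtil d b).steps ≤ p s ∧ bits (condUtil d b).val ≤ p s := by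
  obtain ⟨P, hP, H⟩ := sumMassC_steps
  obtain ⟨a, ha⟩ : ∃ a : ℕ → ℕ, a = fun s => 2 * s + 2 * (2 * s) ^ 2 := ⟨_, rfl⟩
  have hpa : PolyB a := by rw [ha]; fun_prop
  refine ⟨fun s => 2 * P (a s) + (2 * (2 * a s * a s + a s + 2)) ^ 2 +
    2 * (2 * a s * a s + a s + 2), by fun_prop, fun M d b s hd hb => ?_⟩
  have hlen : d.length ≤ a s := by have := hd.1; rw [ha]; beta_reduce; omega
  have hg1 : ∀ w ∈ d, bits (pure w.prob : Cost ℚ).val ≤ a s ∧ (pure w.prob : Cost ℚ).steps ≤ a s :=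
    fun w hw => ⟨by have := (hd.2 w hw).2.2; rw [Cost.pure_val, ha]; beta_reduce; omega, by simp⟩
  have hg2 : ∀ w ∈ d, bits (mulQ w.prob w.uP).val ≤ a s ∧ (mulQ w.prob w.uP).steps ≤ a s :=
    fun w hw => by
      obtain ⟨-, h1, h2⟩ := hd.2 w hw
      have h3 := sq_bits_le h2 h1
      have h4 := bits_mul_le w.prob w.uP
      rw [mulQ_val, mulQ_steps, ha]; beta_reduce
      constructor <;> omega
  have hp1 : ∀ w ∈ d, (b.mem w.uA).steps ≤ a s := fun w hw => by
    have := mem_steps_le hb (hd.2 w hw).1; rw [ha]; beta_reduce; omega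
  have hp2 : ∀ w ∈ d, (b.memCum w.uA).steps ≤ a s := fun w hw => by
    have := memCum_steps_le hb (hd.2 w hw).1; rw [ha]; beta_reduce; omega
  have s1 := H _ b.mem d _ hlen fun w hw => ⟨(hg1 w hw).1, (hg1 w hw).2, hp1 w hw⟩
  have s2 := H _ b.memCum d _ hlen fun w hw => ⟨(hg1 w hw).1, (hg1 w hw).2, hp2 w hw⟩
  have s3 := H _ b.mem d _ hlen fun w hw => ⟨(hg2 w hw).1, (hg2 w hw).2, hp1 w hw⟩
  have b1 := sumMassC_bits (p := b.mem) hlen fun w hw => (hg1 w hw).1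
  have b2 := sumMassC_bits (p := b.memCum) hlen fun w hw => (hg1 w hw).1
  have b3 := sumMassC_bits (p := b.mem) hlen fun w hw => (hg2 w hw).1
  have q1 := sq_bits_le b1 b2
  have q2 := sq_bits_le b3 b2
  have r1 := bits_div_le (sumMassC (fun w => pure w.prob) b.mem d).val
    (sumMassC (fun w => pure w.prob) b.memCum d).val
  have r2 := bits_div_le (sumMassC (fun w => mulQ w.prob w.uP) b.mem d).val
    (sumMassC (fun w => pure w.prob) b.memCum d).val
  simp only [condProb, condUtil, Cost.bind_steps, Cost.bind_val, divQ_steps, divQ_val]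
  refine ⟨?_, ?_, ?_, ?_⟩ <;> omega

theorem psi_steps : ∃ p, PolyB p ∧ ∀ (M : ℕ) (d : Dist) (bins : List Bin) (s : ℕ), SizedDist s d →
    bins.length ≤ s → (∀ b ∈ bins, SizedBin M s b) →
    (psi M d bins).steps ≤ p s ∧ bits (psi M d bins).val ≤ p s := by
  obtain ⟨P, hP, H⟩ := condProb_steps
  obtain ⟨v, hv⟩ : ∃ v : ℕ → ℕ, v = fun s => 2 * (s + P s) * s + s + 2 := ⟨_, rfl⟩
  have hpv : PolyB v := by rw [hv]; fun_prop
  refine ⟨fun s => s * (1 + (3 + s + 1) + P s + (s + P s) ^ 2 + ((s + P s) + v s) ^ 2) + 1 + v s,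
    by fun_prop, fun M d bins s hd hlen hb => ?_⟩
  have hval : ∀ bins : List Bin, bins.length ≤ s → (∀ b ∈ bins, SizedBin M s b) →
      bits (psi M d bins).val ≤ v s := by
    intro bins hlen hb
    have h : (psi M d bins).val = ((bins.filter fun b => decide (6 ≤ b.idx)).map fun b =>
        weight M b.idx * (condUtil d b).val).sum := by
      clear hlen hb
      induction bins with
      | nil => simp [psi]
      | cons b bins ih => by_cases h6 : 6 ≤ b.idx <;> simp [psi, ih, h6]
    rw [h]
    refine (bits_sum_le (B := s + P s) fun q hq => ?_).trans ?_
    · obtain ⟨b, hb', rfl⟩ := List.mem_map.1 hq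
      have hb' := hb b (List.mem_filter.1 hb').1
      have h1 := (H M d b s hd hb').2.2.2
      have h2 := hb'.weight
      exact (bits_mul_le _ _).trans (add_le_add h2 h1)
    · rw [List.length_map, hv]
      have := (List.length_filter_le (fun b : Bin => decide (6 ≤ b.idx)) bins).trans hlen
      beta_reduce
      gcongr
  refine ⟨?_, (hval bins hlen hb).trans (Nat.le_add_left _ _)⟩
  have main : ∀ bins : List Bin, bins.length ≤ s → (∀ b ∈ bins, SizedBin M s b) →
      (psi M d bins).steps ≤
        bins.length * (1 + (3 + s + 1) + P s + (s + P s) ^ 2 + ((s + P s) + v s) ^ 2) + 1 := by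
    intro bins hlen hb
    induction bins with
    | nil => simp [psi]
    | cons b bins ih =>
      rw [List.length_cons] at hlen
      simp only [List.mem_cons, forall_eq_or_imp] at hb
      have h1 := ih (by omega) hb.2
      have h2 := hval bins (by omega) hb.2
      obtain ⟨-, -, h3, h4⟩ := H M d b s hd hb.1
      have h5 := hb.1.weight
      have h6 := hb.1.idx
      have h7 := Nat.pow_le_pow_left (add_le_add h5 h4) 2
      have h8 := Nat.pow_le_pow_left
        (add_le_add ((bits_mul_le (weight M b.idx) (condUtil d b).val).trans (add_le_add h5 h4)) h2) 2
      have h9 : Nat.size 6 = 3 := by decide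
      rw [List.length_cons, add_mul, one_mul]
      by_cases hj : 6 ≤ b.idx
      · simp only [psi, Cost.bind_steps, tick_steps, leN_steps, leN_val, hj, decide_true, if_true,
          mulQ_steps, mulQ_val, addQ_steps, h9]
        omega
      · simp only [psi, Cost.bind_steps, tick_steps, leN_steps, leN_val, hj, decide_false,
          Bool.false_eq_true, if_false, Cost.pure_steps, h9]
        omega
  have h := Nat.mul_le_mul_right
    (1 + (3 + s + 1) + P s + (s + P s) ^ 2 + ((s + P s) + v s) ^ 2) hlen
  have := main bins hlen hb
  beta_reduce
  omega

theorem stat_steps : ∃ p, PolyB p ∧ ∀ (M D : ℕ) (d : Dist) (bins : List Bin) (s : ℕ),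
    SizedDist s d → bins.length ≤ s → (∀ b ∈ bins, SizedBin M s b) → Nat.size D ≤ s →
    (stat M D bins d).steps ≤ p s ∧ bits (stat M D bins d).val.1 ≤ p s ∧
      (stat M D bins d).val.2.length = bins.length ∧
      ∀ x ∈ (stat M D bins d).val.2, Nat.size x ≤ p s := by
  obtain ⟨P, hP, H⟩ := condProb_steps
  obtain ⟨R, hR, HR⟩ := psi_steps
  refine ⟨fun s => R s + (s * (P s + (P s + (s + 1)) ^ 2 + (P s + (s + 1)) ^ 2 + 1) + 1) +
    (P s + (s + 1)), by fun_prop, fun M D d bins s hd hlen hb hD => ?_⟩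
  obtain ⟨h1, h2⟩ := HR M d bins s hd hlen hb
  have hD' : bits (D : ℚ) ≤ s + 1 := by rw [bits_natCast]; omega
  have h3 : (counts D d bins).steps ≤
      s * (P s + (P s + (s + 1)) ^ 2 + (P s + (s + 1)) ^ 2 + 1) + 1 := by
    refine (mapC_steps_le (B := P s + (P s + (s + 1)) ^ 2 + (P s + (s + 1)) ^ 2)
      fun b hb' => ?_).trans (by gcongr)
    obtain ⟨h4, h5, -, -⟩ := H M d b s hd (hb b hb')
    have h6 := Nat.pow_le_pow_left (add_le_add h5 hD') 2
    have h7 := Nat.pow_le_pow_left ((bits_mul_le (condProb d b).val D).trans (add_le_add h5 hD')) 2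
    simp only [Cost.bind_steps, mulQ_steps, mulQ_val, floorQ_steps]
    omega
  refine ⟨?_, ?_, ?_, ?_⟩
  · simp only [stat, Cost.bind_steps, Cost.pure_steps]
    omega
  · simp only [stat, Cost.bind_val, Cost.pure_val]
    omega
  · simp [stat, counts]
  · intro x hx
    simp only [stat, Cost.bind_val, Cost.pure_val, counts, mapC_val, mulQ_val, floorQ_val] at hx
    obtain ⟨b, hb', rfl⟩ := List.mem_map.1 hx
    obtain ⟨-, h5, -, -⟩ := H M d b s hd (hb b hb')
    have h6 := (size_floor_le ((condProb d b).val * D)).trans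
      ((bits_mul_le _ _).trans (add_le_add h5 hD'))
    beta_reduce
    omega

/-! ### Step count of the dynamic program -/

theorem feasible_steps_le {M D s : ℕ} {bins : List Bin} {ks : List ℕ}
    (hb : ∀ b ∈ bins, SizedBin M s b) (hks : ∀ x ∈ ks, Nat.size x ≤ s) (hD : Nat.size D ≤ s) :
    (feasible M D bins ks).steps ≤
      bins.length * (1 + (2 * (s + 1)) ^ 2 + 2 * (2 * (2 * (s + 1))) ^ 2 + (s + 2)) + 1 := by
  induction bins generalizing ks with
  | nil => simp [feasible]
  | cons b bins ih =>
    cases ks with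
    | nil => simp [feasible]
    | cons k ks =>
      simp only [List.mem_cons, forall_eq_or_imp] at hb hks
      have h1 := ih hb.2 hks.2
      have hk' : bits (k : ℚ) ≤ s + 1 := by rw [bits_natCast]; omega
      have hD' : bits (D : ℚ) ≤ s + 1 := by rw [bits_natCast]; omega
      have h2 := sq_bits_le hk' hD'
      have h3 : bits ((k : ℚ) / D) ≤ 2 * (s + 1) := (bits_div_le _ _).trans (by omega)
      have h4 := sq_bits_le (hb.1.lower.trans (by omega)) h3
      have h5 := sq_bits_le h3 (hb.1.upper.trans (by omega))
      have h6 := hb.1.idx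
      simp only [feasible, Cost.bind_steps, tick_steps, divQ_steps, divQ_val, leQ_steps, leN_steps,
        Cost.ite_steps, Cost.pure_steps, List.length_cons, Nat.size_one]
      rw [add_mul, one_mul]
      split_ifs <;> omega

theorem lookup_steps_le {k : List ℕ} {T : Table} {s : ℕ} (hlen : k.length ≤ s)
    (hk : ∀ x ∈ k, Nat.size x ≤ s) (hT : ∀ e ∈ T, ∀ x ∈ e.1, Nat.size x ≤ s) :
    (lookup k T).steps ≤ T.length * (1 + (s * (2 * s + 1) + 1)) + 1 := by
  induction T with
  | nil => simp [lookup]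
  | cons e T ih =>
    simp only [List.mem_cons, forall_eq_or_imp] at hT
    have h1 := ih hT.2
    have h2 := eqVecC_steps_le hk hT.1
    have h3 := Nat.mul_le_mul_right (2 * s + 1) hlen
    simp only [lookup, Cost.bind_steps, tick_steps, Cost.ite_steps, Cost.pure_steps,
      List.length_cons]
    rw [add_mul, one_mul]
    split_ifs <;> omega

theorem size_zipWith_add {k l : List ℕ} {s : ℕ} (hk : ∀ x ∈ k, Nat.size x ≤ s)
    (hl : ∀ x ∈ l, Nat.size x ≤ s) : ∀ x ∈ List.zipWith (· + ·) k l, Nat.size x ≤ s + 1 := by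
  induction k generalizing l with
  | nil => simp
  | cons a k ih =>
    cases l with
    | nil => simp
    | cons b l =>
      simp only [List.mem_cons, forall_eq_or_imp] at hk hl
      simp only [List.zipWith_cons_cons, List.mem_cons, forall_eq_or_imp]
      exact ⟨size_add_le hk.1 hl.1, ih hk.2 hl.2⟩

/-- A bound on the number of steps for one configuration in the recurrence of the dynamic program. -/
def choiceBound (s : ℕ) : ℕ :=
  1 + (s + 2) + (s * (2 * s + 1) + 1) + (s * (1 + ((s + 1) * (2 * (s + 1) + 1) + 1)) + 1) +
    (2 * s) ^ 2 + (2 * (4 * s + 1)) ^ 2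

theorem polyB_choiceBound : PolyB choiceBound := by unfold choiceBound; fun_prop

theorem bestChoice_steps_le {T : Table} {k : List ℕ} {c : ℕ} {ss : List (ℚ × List ℕ)} {s : ℕ}
    (hc : c + ss.length ≤ s) (hlen : k.length ≤ s) (hk : ∀ x ∈ k, Nat.size x ≤ s)
    (hss : ∀ e ∈ ss, bits e.1 ≤ s ∧ ∀ x ∈ e.2, Nat.size x ≤ s) (hTlen : T.length ≤ s)
    (hT : ∀ e ∈ T, ∀ x ∈ e.1, Nat.size x ≤ s)
    (hv : ∀ k v C, (lookup k T).val = some (v, C) → bits v ≤ s) :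
    (bestChoice T k c ss).steps ≤ ss.length * choiceBound s + 1 := by
  induction ss generalizing c with
  | nil => simp [bestChoice]
  | cons e ss ih =>
    rw [List.length_cons] at hc
    simp only [List.mem_cons, forall_eq_or_imp] at hss
    have h1 := ih (c := c + 1) (by omega) hss.2
    have h2 := size_le_self c
    have h3 := (addVecC_steps_le hk hss.1.2).trans
      (Nat.add_le_add_right (Nat.mul_le_mul_right _ hlen) 1)
    have h4 : (lookup (List.zipWith (· + ·) k e.2) T).steps ≤
        s * (1 + ((s + 1) * (2 * (s + 1) + 1) + 1)) + 1 := by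
      refine (lookup_steps_le (s := s + 1) ?_ (size_zipWith_add hk hss.1.2)
        fun e he x hx => (hT e he x hx).trans (by omega)).trans (by gcongr)
      rw [List.length_zipWith]
      omega
    have hother : ∀ x X, (bestChoice T k (c + 1) ss).val = some (x, X) → bits x ≤ 4 * s + 1 := by
      intro x X h
      obtain ⟨j, e', v', C', hj, -, rfl, hl⟩ := bestChoice_sound h
      have e1 := (hss.2 e' (List.mem_of_getElem? hj)).1
      have e2 := hv _ _ _ hl
      exact (bits_add_le _ _).trans (by omega)
    rw [List.length_cons, add_mul, one_mul]
    have hcb : choiceBound s = 1 + (s + 2) + (s * (2 * s + 1) + 1) +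
      (s * (1 + ((s + 1) * (2 * (s + 1) + 1) + 1)) + 1) + (2 * s) ^ 2 + (2 * (4 * s + 1)) ^ 2 := rfl
    simp only [bestChoice, Cost.bind_steps, tick_steps, addN_steps, addN_val, Nat.size_one,
      addVecC_val]
    cases hl : (lookup (List.zipWith (· + ·) k e.2) T).val with
    | none =>
      simp only [Cost.pure_steps]
      omega
    | some o =>
      obtain ⟨v, C⟩ := o
      have h5 := hv _ _ _ hl
      have h6 := sq_bits_le hss.1.1 h5
      have h7 : bits (e.1 + v) ≤ 4 * s + 1 := by
        refine (bits_add_le _ _).trans ?_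
        have := hss.1.1
        omega
      simp only [Cost.bind_steps, addQ_steps, addQ_val]
      cases ho : (bestChoice T k (c + 1) ss).val with
      | none =>
        simp only [Cost.pure_steps]
        omega
      | some o =>
        obtain ⟨x, X⟩ := o
        have h8 := sq_bits_le (hother x X ho) h7
        simp only [Cost.bind_steps, leQ_steps, leQ_val]
        by_cases hx : x ≤ e.1 + v
        · simp only [hx, decide_true, if_true, Cost.pure_steps]
          omega
        · simp only [hx, decide_false, Bool.false_eq_true, if_false, Cost.pure_steps]
          omega

theorem table_length (M D : ℕ) (bins : List Bin) (keys : List (List ℕ))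
    (ss : List (List (ℚ × List ℕ))) : (table M D bins keys ss).val.length = keys.length ∧
      ∀ e ∈ (table M D bins keys ss).val, e.1 ∈ keys := by
  cases ss with
  | nil =>
    rw [table_nil_val]
    refine ⟨by simp, fun e he => ?_⟩
    obtain ⟨k, hk, rfl⟩ := List.mem_map.1 he
    exact hk
  | cons s ss =>
    rw [table_cons_val]
    refine ⟨by simp, fun e he => ?_⟩
    obtain ⟨k, hk, rfl⟩ := List.mem_map.1 he
    exact hk

theorem Picks.spec {ss : List (List (ℚ × List ℕ))} {C : List ℕ} {es : List (ℚ × List ℕ)}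
    (h : Picks ss C es) : es.length = ss.length ∧ ∀ e ∈ es, ∃ s ∈ ss, e ∈ s := by
  induction h with
  | nil => simp
  | @cons s ss c C e es hc _ ih =>
    refine ⟨by simp [ih.1], ?_⟩
    simp only [List.mem_cons, forall_eq_or_imp, exists_eq_or_imp]
    exact ⟨Or.inl (List.mem_of_getElem? hc), fun e he => Or.inr (ih.2 e he)⟩

theorem table_steps : ∃ p, PolyB p ∧ ∀ (M D : ℕ) (bins : List Bin) (keys : List (List ℕ))
    (ss : List (List (ℚ × List ℕ))) (s : ℕ), bins.length ≤ s → (∀ b ∈ bins, SizedBin M s b) →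
    Nat.size D ≤ s → keys.length ≤ s →
    (∀ k ∈ keys, k.length ≤ s ∧ ∀ x ∈ k, Nat.size x ≤ s) → ss.length ≤ s →
    (∀ l ∈ ss, l.length ≤ s ∧ ∀ e ∈ l, bits e.1 ≤ s ∧ ∀ x ∈ e.2, Nat.size x ≤ s) →
    (table M D bins keys ss).steps ≤ p s := by
  obtain ⟨v, hv⟩ : ∃ v : ℕ → ℕ, v = fun s => s + (2 * s * s + s + 2) := ⟨_, rfl⟩
  have hpv : PolyB v := by rw [hv]; fun_prop
  have hcb := polyB_choiceBound
  refine ⟨fun s => s * (1 + (s * ((v s * choiceBound (v s) + 1) + 1) + 1)) +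
    (1 + (s * ((s * (1 + (2 * (s + 1)) ^ 2 + 2 * (2 * (2 * (s + 1))) ^ 2 + (s + 2)) + 1) + 1) + 1)),
    by fun_prop, fun M D bins keys ss s hbl hb hD hkl hk hsl hss => ?_⟩
  have hsv : s ≤ v s := by rw [hv]; beta_reduce; omega
  have main : ∀ ss : List (List (ℚ × List ℕ)), ss.length ≤ s →
      (∀ l ∈ ss, l.length ≤ s ∧ ∀ e ∈ l, bits e.1 ≤ s ∧ ∀ x ∈ e.2, Nat.size x ≤ s) →
      (table M D bins keys ss).steps ≤
      ss.length * (1 + (s * ((v s * choiceBound (v s) + 1) + 1) + 1)) + (1 + (s * ((s * (1 +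
        (2 * (s + 1)) ^ 2 + 2 * (2 * (2 * (s + 1))) ^ 2 + (s + 2)) + 1) + 1) + 1)) := by
    intro ss hsl hss
    induction ss with
    | nil =>
      simp only [table, Cost.bind_steps, tick_steps, List.length_nil, zero_mul, zero_add]
      refine Nat.add_le_add_left ?_ 1
      refine (mapC_steps_le (B := s * (1 + (2 * (s + 1)) ^ 2 + 2 * (2 * (2 * (s + 1))) ^ 2 +
        (s + 2)) + 1) fun k hk' => ?_).trans (by gcongr)
      have h1 := feasible_steps_le (M := M) (D := D) hb (hk k hk').2 hD
      simp only [Cost.bind_steps, Cost.ite_steps, Cost.pure_steps, ite_self, add_zero]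
      exact h1.trans (by gcongr)
    | cons l ss ih =>
      rw [List.length_cons] at hsl
      simp only [List.mem_cons, forall_eq_or_imp] at hss
      have h1 := ih (by omega) hss.2
      have hval : ∀ k w C, (lookup k (table M D bins keys ss).val).val = some (w, C) →
          bits w ≤ v s := by
        intro k w C h
        obtain ⟨es, hp, rfl, -⟩ := table_sound h
        obtain ⟨hel, hes⟩ := hp.spec
        refine (bits_sum_le (B := s) fun q hq => ?_).trans ?_
        · obtain ⟨e, he, rfl⟩ := List.mem_map.1 hq
          obtain ⟨l, hl, hel'⟩ := hes e he
          exact ((hss.2 l hl).2 e hel').1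
        · rw [List.length_map, hel, hv]
          beta_reduce
          have h2 : 2 * s * ss.length ≤ 2 * s * s := Nat.mul_le_mul_left _ (by omega)
          omega
      have h2 : (mapC (fun k => do
          let e ← bestChoice (table M D bins keys ss).val k 0 l
          pure (k, e)) keys).steps ≤ s * ((v s * choiceBound (v s) + 1) + 1) + 1 := by
        refine (mapC_steps_le (B := v s * choiceBound (v s) + 1) fun k hk' => ?_).trans (by gcongr)
        obtain ⟨t1, t2⟩ := table_length M D bins keys ss
        have h3 := bestChoice_steps_le (T := (table M D bins keys ss).val) (k := k) (c := 0)
          (ss := l) (s := v s) (by have := hss.1.1; omega) ((hk k hk').1.trans hsv)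
          (fun x hx => ((hk k hk').2 x hx).trans hsv)
          (fun e he => ⟨(hss.1.2 e he).1.trans hsv, fun x hx => ((hss.1.2 e he).2 x hx).trans hsv⟩)
          (by omega) (fun e he x hx => ((hk _ (t2 e he)).2 x hx).trans hsv) hval
        simp only [Cost.bind_steps, Cost.pure_steps, add_zero]
        refine h3.trans ?_
        have := hss.1.1.trans hsv
        gcongr
      simp only [table, Cost.bind_steps, tick_steps, List.length_cons]
      rw [add_mul, one_mul]
      omega
  exact (main ss hsl hss).trans (by beta_reduce; gcongr)

theorem solve_steps (M : ℕ) : ∃ p, PolyB p ∧ ∀ (n : ℕ) (keys : List (List ℕ)) (I : Inst)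
    (bins : List Bin) (s : ℕ), n ≤ s → SizedInst s I → bins.length ≤ s →
    (∀ b ∈ bins, SizedBin M s b) → keys.length ≤ s →
    (∀ k ∈ keys, k.length ≤ s ∧ ∀ x ∈ k, Nat.size x ≤ s) →
    (solve M n keys I bins).steps ≤ p s := by
  obtain ⟨P, hP, H⟩ := stat_steps
  obtain ⟨R, hR, HR⟩ := table_steps
  obtain ⟨a, ha⟩ : ∃ a : ℕ → ℕ, a = fun s => s + M ^ 2 * s := ⟨_, rfl⟩
  have hpa : PolyB a := by rw [ha]; fun_prop
  obtain ⟨c, hc⟩ : ∃ c : ℕ → ℕ, c = fun s => a s + P (a s) := ⟨_, rfl⟩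
  have hpc : PolyB c := by rw [hc]; fun_prop
  refine ⟨fun s => (M ^ 2 + s + 1) ^ 2 + (s * ((s * (P (a s) + 1) + 1) + 1) + 1) + R (c s) +
    (s + 1) + (s * (1 + (s * (2 * s + 1) + 1)) + 1), by fun_prop,
    fun n keys I bins s hn hI hbl hb hkl hk => ?_⟩
  have hsa : s ≤ a s := by rw [ha]; beta_reduce; omega
  have hac : a s ≤ c s := by rw [hc]; beta_reduce; omega
  have hPc : P (a s) ≤ c s := by rw [hc]; beta_reduce; omega
  have hD : Nat.size (M ^ 2 * n) ≤ a s := by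
    have h1 := size_le_self (M ^ 2 * n)
    have h2 : M ^ 2 * n ≤ M ^ 2 * s := Nat.mul_le_mul_left _ hn
    rw [ha]; beta_reduce; omega
  have hba : ∀ b ∈ bins, SizedBin M (a s) b := fun b hb' => (hb b hb').mono hsa
  have hbc : ∀ b ∈ bins, SizedBin M (c s) b := fun b hb' => (hba b hb').mono hac
  have hstat : ∀ cfgs ∈ I, ∀ d ∈ cfgs, _ := fun cfgs hcfgs d hd =>
    H M (M ^ 2 * n) d bins (a s) (((hI.2 cfgs hcfgs).2 d hd).mono hsa) (hbl.trans hsa) hba hD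
  have h1 : (mulN (M ^ 2) n).steps ≤ (M ^ 2 + s + 1) ^ 2 := by
    have e1 := size_le_self (M ^ 2)
    have e2 := size_le_self n
    rw [mulN_steps]
    exact Nat.pow_le_pow_left (by omega) 2
  have h2 : (mapC (mapC (stat M (M ^ 2 * n) bins)) I).steps ≤
      s * ((s * (P (a s) + 1) + 1) + 1) + 1 := by
    refine (mapC_steps_le (B := s * (P (a s) + 1) + 1) fun cfgs hcfgs => ?_).trans
      (by have := hI.1; gcongr)
    refine (mapC_steps_le (B := P (a s)) fun d hd => (hstat cfgs hcfgs d hd).1).trans ?_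
    have := (hI.2 cfgs hcfgs).1
    gcongr
  have h3 := HR M (M ^ 2 * n) bins keys (mapC (mapC (stat M (M ^ 2 * n) bins)) I).val (c s)
    (hbl.trans (hsa.trans hac)) hbc (hD.trans hac) (hkl.trans (hsa.trans hac))
    (fun k hk' => ⟨(hk k hk').1.trans (hsa.trans hac),
      fun x hx => ((hk k hk').2 x hx).trans (hsa.trans hac)⟩)
    (by rw [mapC_val, List.length_map]; exact hI.1.trans (hsa.trans hac))
    (fun l hl => by
      rw [mapC_val] at hl
      obtain ⟨cfgs, hcfgs, rfl⟩ := List.mem_map.1 hl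
      rw [mapC_val]
      refine ⟨by rw [List.length_map]; exact (hI.2 cfgs hcfgs).1.trans (hsa.trans hac),
        fun e he => ?_⟩
      obtain ⟨d, hd, rfl⟩ := List.mem_map.1 he
      obtain ⟨-, e1, -, e2⟩ := hstat cfgs hcfgs d hd
      exact ⟨e1.trans hPc, fun x hx => (e2 x hx).trans hPc⟩)
  have h4 : (mapC (fun _ => (pure 0 : Cost ℕ)) bins).steps ≤ s + 1 := by
    refine (mapC_steps_le (B := 0) fun _ _ => by simp).trans ?_
    omega
  obtain ⟨t1, t2⟩ := table_length M (M ^ 2 * n) bins keys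
    (mapC (mapC (stat M (M ^ 2 * n) bins)) I).val
  have h5 := lookup_steps_le (k := (mapC (fun _ => (pure 0 : Cost ℕ)) bins).val) (s := s)
    (T := (table M (M ^ 2 * n) bins keys (mapC (mapC (stat M (M ^ 2 * n) bins)) I).val).val)
    (by rw [mapC_val, List.length_map]; exact hbl)
    (fun x hx => by
      rw [mapC_val] at hx
      obtain ⟨b, -, rfl⟩ := List.mem_map.1 hx
      simp)
    (fun e he x hx => (hk _ (t2 e he)).2 x hx)
  rw [t1] at h5
  have h6 : keys.length * (1 + (s * (2 * s + 1) + 1)) ≤ s * (1 + (s * (2 * s + 1) + 1)) :=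
    Nat.mul_le_mul_right _ hkl
  simp only [solve, Cost.bind_steps, mulN_val]
  split
  · rw [Cost.pure_steps]; omega
  · rw [Cost.pure_steps]; omega


/-! ### Step count of the evaluation of a configuration -/

/-- The masses of `d` have a common denominator of at most `k + 1` bits, over which the numerators
have at most `k + 1` bits. Combining two distributions then adds up these bounds, whereas the general
bounds on the bit lengths of sums would grow exponentially in the number of actions. -/
def OnGrid (k : ℕ) (d : Dist) : Prop :=
  ∃ E : ℕ, E ≠ 0 ∧ E ≤ 2 ^ k ∧ ∀ w ∈ d, ∃ z : ℤ, w.prob = z / E ∧ z.natAbs ≤ 2 ^ k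

theorem OnGrid.bits_le {k : ℕ} {d : Dist} (h : OnGrid k d) {w : Mass} (hw : w ∈ d) :
    bits w.prob ≤ 2 * k + 2 := by
  obtain ⟨E, hE, hEk, H⟩ := h
  obtain ⟨z, hz, hzk⟩ := H w hw
  have h1 : Nat.size (2 ^ k) = k + 1 := Nat.size_pow
  have h2 := Nat.size_le_size hEk
  have h3 := Nat.size_le_size hzk
  exact (bits_le_of_eq hE hz).trans (by omega)

theorem OnGrid.mono {k l : ℕ} (h : k ≤ l) {d : Dist} (hd : OnGrid k d) : OnGrid l d := by
  obtain ⟨E, hE, hEk, H⟩ := hd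
  have h' : 2 ^ k ≤ 2 ^ l := Nat.pow_le_pow_right (by norm_num) h
  refine ⟨E, hE, hEk.trans h', fun w hw => ?_⟩
  obtain ⟨z, hz, hzk⟩ := H w hw
  exact ⟨z, hz, hzk.trans h'⟩

theorem SizedDist.onGrid {s : ℕ} {d : Dist} (h : SizedDist s d) : OnGrid (s * s + s) d := by
  have hE : (d.map fun w => w.prob.den).prod ≤ 2 ^ (s * s) := by
    refine (List.prod_le_pow_card _ (2 ^ s) fun x hx => ?_).trans ?_
    · obtain ⟨w, hw, rfl⟩ := List.mem_map.1 hx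
      exact (Nat.size_le.1 ((size_den_le _).trans (h.2 w hw).2.2)).le
    · rw [List.length_map, ← pow_mul]
      exact Nat.pow_le_pow_right (by norm_num) (Nat.mul_le_mul_left _ h.1)
  refine ⟨(d.map fun w => w.prob.den).prod, ?_, ?_, fun w hw => ?_⟩
  · rw [Ne, List.prod_eq_zero_iff, List.mem_map]
    rintro ⟨w, -, hw⟩
    exact w.prob.den_nz hw
  · exact hE.trans (Nat.pow_le_pow_right (by norm_num) (Nat.le_add_right _ _))
  · obtain ⟨c, hc⟩ := List.dvd_prod (List.mem_map_of_mem (f := fun w : Mass => w.prob.den) hw)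
    rw [hc] at hE ⊢
    have hden : (w.prob.den : ℚ) ≠ 0 := by exact_mod_cast w.prob.den_nz
    rcases Nat.eq_zero_or_pos c with rfl | hcpos
    · -- The product of the denominators is not zero.
      rw [mul_zero, List.prod_eq_zero_iff, List.mem_map] at hc
      obtain ⟨v, -, hv⟩ := hc
      exact absurd hv v.prob.den_nz
    have hcq : (c : ℚ) ≠ 0 := by exact_mod_cast hcpos.ne'
    refine ⟨w.prob.num * c, ?_, ?_⟩
    · conv_lhs => rw [← Rat.num_div_den w.prob]
      push_cast
      field_simp
    · rw [Int.natAbs_mul, Int.natAbs_natCast, add_comm, pow_add]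
      refine Nat.mul_le_mul
        (Nat.size_le.1 ((size_num_le _).trans (h.2 w hw).2.2)).le (le_trans ?_ hE)
      exact Nat.le_mul_of_pos_left _ w.prob.den_pos

theorem sumMassC_eq_div {E k : ℕ} {d : Dist} (p : ℚ → Cost Bool)
    (h : ∀ w ∈ d, ∃ z : ℤ, w.prob = z / E ∧ z.natAbs ≤ 2 ^ k) :
    ∃ z : ℤ, (sumMassC (fun w => pure w.prob) p d).val = z / E ∧
      z.natAbs ≤ d.length * 2 ^ k := by
  induction d with
  | nil => exact ⟨0, by simp [sumMassC]⟩
  | cons w d ih =>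
    simp only [List.mem_cons, forall_eq_or_imp] at h
    obtain ⟨z, hz, hzk⟩ := ih h.2
    obtain ⟨y, hy, hyk⟩ := h.1
    rw [List.length_cons, add_mul, one_mul]
    by_cases hp : (p w.uA).val
    · refine ⟨y + z, ?_, (Int.natAbs_add_le _ _).trans (by omega)⟩
      simp only [sumMassC, Cost.bind_val, hp, if_true, addQ_val, Cost.pure_val, hz, hy]
      push_cast
      rw [add_div]
    · exact ⟨z, by simp [sumMassC, hp, hz], by omega⟩

theorem restrict_eq_div {E F k l t : ℕ} {d e : Dist}
    (hd : ∀ w ∈ d, ∃ z : ℤ, w.prob = z / E ∧ z.natAbs ≤ 2 ^ k)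
    (he : ∀ w ∈ e, ∃ z : ℤ, w.prob = z / F ∧ z.natAbs ≤ 2 ^ l) (ht : e.length ≤ 2 ^ t) :
    ∀ w ∈ (restrict d e).val, ∃ z : ℤ, w.prob = z / (E * F : ℕ) ∧
      z.natAbs ≤ 2 ^ (k + l + t) := by
  intro w hw
  simp only [restrict, mapC_val, Cost.bind_val, mulQ_val, Cost.pure_val] at hw
  obtain ⟨v, hv, rfl⟩ := List.mem_map.1 hw
  obtain ⟨y, hy, hyk⟩ := hd v hv
  obtain ⟨z, hz, hzk⟩ := sumMassC_eq_div (fun u => ltQ u v.uA) he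
  refine ⟨y * z, ?_, ?_⟩
  · dsimp only
    rw [hy, hz]
    push_cast
    rw [div_mul_div_comm]
  · rw [Int.natAbs_mul, add_assoc, pow_add, add_comm l, pow_add]
    exact Nat.mul_le_mul hyk (hzk.trans (Nat.mul_le_mul_right _ ht))

theorem OnGrid.combine {k l t : ℕ} {acc d : Dist} (ha : OnGrid k acc) (hd : OnGrid l d)
    (hat : acc.length ≤ 2 ^ t) (hdt : d.length ≤ 2 ^ t) :
    OnGrid (k + l + t) (combine acc d).val := by
  obtain ⟨E, hE, hEk, HE⟩ := ha
  obtain ⟨F, hF, hFl, HF⟩ := hd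
  refine ⟨E * F, Nat.mul_ne_zero hE hF, ?_, fun w hw => ?_⟩
  · calc E * F ≤ 2 ^ k * 2 ^ l := Nat.mul_le_mul hEk hFl
      _ = 2 ^ (k + l) := (pow_add _ _ _).symm
      _ ≤ _ := Nat.pow_le_pow_right (by norm_num) (Nat.le_add_right _ _)
  · rw [combine_val, List.mem_append] at hw
    rcases hw with hw | hw
    · exact restrict_eq_div HE HF hdt w hw
    · rw [mul_comm, add_comm k]
      exact restrict_eq_div HF HE hat w hw

theorem restrict_steps : ∃ p, PolyB p ∧ ∀ (d e : Dist) (s : ℕ), SizedDist s d → SizedDist s e →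
    (restrict d e).steps ≤ p s := by
  obtain ⟨P, hP, H⟩ := sumMassC_steps
  obtain ⟨a, ha⟩ : ∃ a : ℕ → ℕ, a = fun s => s + (2 * s) ^ 2 := ⟨_, rfl⟩
  have hpa : PolyB a := by rw [ha]; fun_prop
  refine ⟨fun s => s * (P (a s) + (s + (2 * s * s + s + 2)) ^ 2 + 1) + 1, by fun_prop,
    fun d e s hd he => ?_⟩
  refine (mapC_steps_le (B := P (a s) + (s + (2 * s * s + s + 2)) ^ 2) fun w hw => ?_).trans
    (by have := hd.1; beta_reduce; gcongr)
  have h1 := H (fun v => pure v.prob) (fun u => ltQ u w.uA) e (a s)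
    (he.1.trans (by rw [ha]; beta_reduce; omega)) fun v hv => by
      have h2 := (he.2 v hv).2.2
      have h3 := sq_bits_le (he.2 v hv).1 (hd.2 w hw).1
      rw [Cost.pure_val, Cost.pure_steps, ltQ_steps, ha]
      beta_reduce
      exact ⟨by omega, by omega, by omega⟩
  have h2 := sumMassC_bits (g := fun v => pure v.prob) (p := fun u => ltQ u w.uA) he.1
    fun v hv => (he.2 v hv).2.2
  have h3 := Nat.pow_le_pow_left (add_le_add (hd.2 w hw).2.2 h2) 2
  simp only [Cost.bind_steps, mulQ_steps, Cost.pure_steps]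
  omega

theorem combine_length (acc d : Dist) :
    (combine acc d).val.length = acc.length + d.length := by
  simp [combine_val, restrict]

theorem combine_steps : ∃ p, PolyB p ∧ ∀ (acc d : Dist) (s : ℕ), SizedDist s acc →
    SizedDist s d → (combine acc d).steps ≤ p s := by
  obtain ⟨P, hP, H⟩ := restrict_steps
  refine ⟨fun s => 2 * P s + (s + 1), by fun_prop, fun acc d s ha hd => ?_⟩
  have h1 := H acc d s ha hd
  have h2 := H d acc s hd ha
  have h3 : (restrict acc d).val.length = acc.length := by simp [restrict]
  have h4 := ha.1
  simp only [combine, Cost.bind_steps, appendC_steps, h3]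
  omega

/-- A bound on the size of the distributions of the favorite among some of the actions. -/
def favoriteBound (s : ℕ) : ℕ := s * s + s + (2 * (s * (2 * (s * s) + s)) + 2)

theorem polyB_favoriteBound : PolyB favoriteBound := by unfold favoriteBound; fun_prop

/-- The hypotheses on `acc` are an invariant of the distribution of the favorite among `i` actions. -/
theorem favorite_steps_le {p : ℕ → ℕ} (H : ∀ (acc d : Dist) (s : ℕ), SizedDist s acc →
      SizedDist s d → (combine acc d).steps ≤ p s) {s i : ℕ} {acc : Dist} {ds : List Dist}
    (hds : ∀ d ∈ ds, SizedDist s d) (hi : i + ds.length ≤ s) (hlen : acc.length ≤ i * s)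
    (hu : ∀ w ∈ acc, bits w.uA ≤ s ∧ bits w.uP ≤ s) (hg : OnGrid (i * (2 * (s * s) + s)) acc) :
    (favorite acc ds).steps ≤ ds.length * (1 + p (favoriteBound s)) + 1 ∧
      SizedDist (favoriteBound s) (favorite acc ds).val := by
  have hacc : SizedDist (favoriteBound s) acc := by
    have h1 : i * s ≤ s * s := Nat.mul_le_mul_right _ (by omega)
    have h2 : i * (2 * (s * s) + s) ≤ s * (2 * (s * s) + s) := Nat.mul_le_mul_right _ (by omega)
    unfold favoriteBound
    refine ⟨by omega, fun w hw => ⟨(hu w hw).1.trans (by omega), (hu w hw).2.trans (by omega),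
      (hg.bits_le hw).trans (by omega)⟩⟩
  induction ds generalizing acc i with
  | nil => simpa [favorite] using hacc
  | cons d ds ih =>
    simp only [List.mem_cons, forall_eq_or_imp] at hds
    rw [List.length_cons] at hi
    have hss : s ≤ s * s := Nat.le_mul_self s
    have hpow : s * s ≤ 2 ^ (s * s) := Nat.lt_two_pow_self.le
    have h1 := H acc d (favoriteBound s) hacc
      (hds.1.mono (by unfold favoriteBound; omega))
    have hlen' : (combine acc d).val.length ≤ (i + 1) * s := by
      have := hds.1.1
      rw [combine_length, add_mul, one_mul]; omega
    have hu' : ∀ w ∈ (combine acc d).val, bits w.uA ≤ s ∧ bits w.uP ≤ s := fun w hw => by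
      obtain ⟨v, hv, e1, e2⟩ := mem_combine hw
      rw [e1, e2]
      rcases hv with hv | hv
      · exact hu v hv
      · exact ⟨(hds.1.2 v hv).1, (hds.1.2 v hv).2.1⟩
    have hg' : OnGrid ((i + 1) * (2 * (s * s) + s)) (combine acc d).val := by
      have h2 : i * s ≤ s * s := Nat.mul_le_mul_right _ (by omega)
      refine (hg.combine hds.1.onGrid (t := s * s) (by omega)
        (hds.1.1.trans (by omega))).mono (le_of_eq (by ring))
    have hacc' : SizedDist (favoriteBound s) (combine acc d).val := by
      have h1 : (i + 1) * s ≤ s * s := Nat.mul_le_mul_right _ (by omega)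
      have h2 : (i + 1) * (2 * (s * s) + s) ≤ s * (2 * (s * s) + s) :=
        Nat.mul_le_mul_right _ (by omega)
      unfold favoriteBound
      exact ⟨by omega, fun w hw => ⟨(hu' w hw).1.trans (by omega), (hu' w hw).2.trans (by omega),
        (hg'.bits_le hw).trans (by omega)⟩⟩
    obtain ⟨h2, h3⟩ := ih hds.2 (by omega) hlen' hu' hg' hacc'
    refine ⟨?_, by simpa [favorite] using h3⟩
    simp only [favorite, Cost.bind_steps, tick_steps, List.length_cons]
    rw [add_mul, one_mul]
    omega

theorem evaluate_steps : ∃ p, PolyB p ∧ ∀ (ds : List Dist) (s : ℕ), ds.length ≤ s →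
    (∀ d ∈ ds, SizedDist s d) → (evaluate ds).steps ≤ p s ∧ bits (evaluate ds).val ≤ p s := by
  obtain ⟨P, hP, H⟩ := combine_steps
  obtain ⟨R, hR, HR⟩ := sumMassC_steps
  have hF := polyB_favoriteBound
  obtain ⟨a, ha⟩ : ∃ a : ℕ → ℕ, a = fun s => 2 * favoriteBound s + (2 * favoriteBound s) ^ 2 :=
    ⟨_, rfl⟩
  have hpa : PolyB a := by rw [ha]; fun_prop
  refine ⟨fun s => s * (1 + P (favoriteBound s)) + 1 + R (a s) + (2 * a s * a s + a s + 2),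
    by fun_prop, fun ds s hlen hds => ?_⟩
  cases ds with
  | nil =>
    simp only [evaluate, Cost.bind_steps, Cost.bind_val, tick_steps, Cost.pure_steps,
      Cost.pure_val, bits_zero]
    omega
  | cons d ds =>
    simp only [List.mem_cons, forall_eq_or_imp] at hds
    rw [List.length_cons] at hlen
    obtain ⟨h1, h2⟩ := favorite_steps_le H (i := 1) hds.2 (by omega) (by simpa using hds.1.1)
      (fun w hw => ⟨(hds.1.2 w hw).1, (hds.1.2 w hw).2.1⟩)
      (hds.1.onGrid.mono (by have := Nat.zero_le (s * s); omega))
    have h3 : ∀ w ∈ (favorite d ds).val, bits (mulQ w.prob w.uP).val ≤ a s ∧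
        (mulQ w.prob w.uP).steps ≤ a s := fun w hw => by
      obtain ⟨-, e1, e2⟩ := h2.2 w hw
      have e3 := sq_bits_le e2 e1
      have e4 := bits_mul_le w.prob w.uP
      rw [mulQ_val, mulQ_steps, ha]; beta_reduce
      constructor <;> omega
    have h4 : (favorite d ds).val.length ≤ a s := by
      have := h2.1; rw [ha]; beta_reduce; omega
    have h5 := HR (fun w => mulQ w.prob w.uP) (fun _ => pure true) _ _ h4
      fun w hw => ⟨(h3 w hw).1, (h3 w hw).2, by simp⟩
    have h6 := sumMassC_bits (p := fun _ => pure true) h4 fun w hw => (h3 w hw).1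
    have h7 : ds.length * (1 + P (favoriteBound s)) ≤ s * (1 + P (favoriteBound s)) :=
      Nat.mul_le_mul_right _ (by omega)
    simp only [evaluate, Cost.bind_steps, Cost.bind_val]
    constructor <;> omega


/-! ### Step count of the scheme -/

theorem mkBins_steps (j : ℕ) (lo : Option ℚ) (u : List ℚ) :
    (mkBins j lo u).steps ≤ u.length * (j + u.length + 3) + 1 ∧
      (mkBins j lo u).val.length = u.length ∧
      ∀ b ∈ (mkBins j lo u).val, b.idx < j + u.length ∧ b.hi ∈ u ∧
        ∀ l ∈ b.lo, l ∈ lo ∨ l ∈ u := by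
  induction u generalizing j lo with
  | nil => simp [mkBins]
  | cons a u ih =>
    cases u with
    | nil =>
      refine ⟨?_, by simp [mkBins], ?_⟩
      · simp only [mkBins, Cost.bind_steps, tick_steps, Cost.pure_steps, List.length_singleton]
        omega
      · simp only [mkBins, Cost.bind_val, Cost.pure_val, List.mem_singleton, forall_eq,
          List.length_singleton]
        exact ⟨by omega, trivial, fun l hl => Or.inl hl⟩
    | cons v u =>
      obtain ⟨h1, h2, h3⟩ := ih (j + 1) (some a)
      refine ⟨?_, by simp [mkBins, h2], ?_⟩
      · have h4 := size_le_self j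
        have h5 : j + 1 + (v :: u).length = j + (a :: v :: u).length := by
          simp only [List.length_cons]; omega
        rw [h5] at h1
        simp only [mkBins, Cost.bind_steps, tick_steps, addN_steps, addN_val, Nat.size_one,
          Cost.pure_steps]
        rw [List.length_cons (a := a), add_mul _ 1, one_mul]
        rw [List.length_cons (a := a)] at h1
        omega
      · simp only [mkBins, Cost.bind_val, Cost.pure_val, addN_val, List.mem_cons (a := _)
          (b := Bin.mk j lo a false), forall_eq_or_imp]
        refine ⟨⟨by simp, by simp, fun l hl => Or.inl hl⟩, fun b hb => ?_⟩
        obtain ⟨e1, e2, e3⟩ := h3 b hb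
        refine ⟨by simp only [List.length_cons] at e1 ⊢; omega, List.mem_cons_of_mem _ e2,
          fun l hl => Or.inr ?_⟩
        rcases e3 l hl with h | h
        · simp only [Option.mem_def, Option.some.injEq] at h
          simp [h]
        · exact List.mem_cons_of_mem _ h

/-- A bound on the bit lengths of the constants of the program. -/
def constBound (M : ℕ) : ℕ := M + ∑ j ∈ Finset.range (M + 1),
  (bits (weight M j) + bits (lowerBound M j) + bits (upperBound M j))

theorem sizedBin_mkBins {M s : ℕ} {u : List ℚ} (hlen : u.length = M)
    (hu : ∀ x ∈ u, bits x ≤ s) {b : Bin} (hb : b ∈ (mkBins 1 none u).val) :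
    SizedBin M (constBound M + s) b := by
  obtain ⟨h1, h2, h3⟩ := (mkBins_steps 1 none u).2.2 b hb
  have h4 := Finset.single_le_sum (f := fun j =>
      bits (weight M j) + bits (lowerBound M j) + bits (upperBound M j))
    (fun _ _ => Nat.zero_le _) (Finset.mem_range.2 (show b.idx < M + 1 by omega))
  have h5 := size_le_self b.idx
  have h6 := hu _ h2
  unfold constBound
  beta_reduce at h4
  refine ⟨by omega, by omega, fun l hl => ?_, by omega, by omega, by omega⟩
  rcases h3 l hl with h | h
  · simp at h
  · have := hu l h; omega

theorem chosenC_steps_le {s : ℕ} {I : Inst} (hI : ∀ cfgs ∈ I, cfgs.length ≤ s) (C : List ℕ) :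
    (chosenC I C).steps ≤ I.length * (1 + (s + 1)) + 1 := by
  induction I generalizing C with
  | nil => simp [chosenC]
  | cons cfgs I ih =>
    simp only [List.mem_cons, forall_eq_or_imp] at hI
    cases C with
    | nil => simp [chosenC]
    | cons c C =>
      have h1 := ih hI.2 C
      have h2 := nthC_steps_le [] cfgs c
      have h3 := hI.1
      simp only [chosenC, Cost.bind_steps, tick_steps, Cost.pure_steps, List.length_cons]
      rw [add_mul, one_mul]
      omega

theorem SizedInst.chosen {s : ℕ} {I : Inst} (hI : SizedInst s I) (C : List ℕ) :
    (chosen I C).length ≤ s ∧ ∀ d ∈ chosen I C, SizedDist s d := by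
  unfold UC.chosen
  refine ⟨by rw [List.length_zipWith]; exact (Nat.min_le_left _ _).trans hI.1, fun d hd => ?_⟩
  obtain ⟨i, hi, rfl⟩ := List.getElem_of_mem hd
  rw [List.getElem_zipWith]
  rw [List.length_zipWith] at hi
  by_cases h : C[i] < I[i].length
  · rw [List.getD_eq_getElem _ _ h]
    exact (hI.2 _ (List.getElem_mem _)).2 _ (List.getElem_mem h)
  · rw [List.getD_eq_default _ _ (by omega)]
    exact ⟨Nat.zero_le _, by simp⟩

theorem mainLoop_steps (M : ℕ) : ∃ p, PolyB p ∧ ∀ (n : ℕ) (keys : List (List ℕ)) (I : Inst)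
    (us : List (List ℚ)) (s : ℕ), n ≤ s → SizedInst s I → keys.length ≤ s →
    (∀ k ∈ keys, k.length ≤ s ∧ ∀ x ∈ k, Nat.size x ≤ s) →
    (∀ u ∈ us, u.length = M ∧ ∀ x ∈ u, bits x ≤ s) →
    (mainLoop M n keys I us none).steps ≤ us.length * p s + 1 := by
  obtain ⟨P, hP, H⟩ := solve_steps M
  obtain ⟨R, hR, HR⟩ := evaluate_steps
  obtain ⟨a, ha⟩ : ∃ a : ℕ → ℕ, a = fun s => M + constBound M + s := ⟨_, rfl⟩
  have hpa : PolyB a := by rw [ha]; fun_prop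
  refine ⟨fun s => 1 + (M * (2 * s) ^ 2 + 1) + (M * (1 + M + 3) + 1) + P (a s) +
    (s * (1 + (s + 1)) + 1) + R s + (2 * R s) ^ 2, by fun_prop,
    fun n keys I us s hn hI hkl hk hus => ?_⟩
  have hsa : s ≤ a s := by rw [ha]; beta_reduce; omega
  -- The utility kept so far is the output of an earlier evaluation.
  suffices main : ∀ best : Option (ℚ × List ℕ), (∀ x ∈ best, bits x.1 ≤ R s) →
      (mainLoop M n keys I us best).steps ≤ us.length * (1 + (M * (2 * s) ^ 2 + 1) +
        (M * (1 + M + 3) + 1) + P (a s) + (s * (1 + (s + 1)) + 1) + R s + (2 * R s) ^ 2) + 1 from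
    main none (by simp)
  intro best hbest
  induction us generalizing best with
  | nil => simp [mainLoop]
  | cons u us ih =>
    simp only [List.mem_cons, forall_eq_or_imp] at hus
    obtain ⟨hlen, hu⟩ := hus.1
    have ih := ih hus.2
    have h1 := sortedC_steps_le hu
    obtain ⟨h2, h3, -⟩ := mkBins_steps 1 none u
    rw [hlen] at h1 h2 h3
    have h4 := H n keys I (mkBins 1 none u).val (a s) (hn.trans hsa) (hI.mono hsa)
      (by rw [h3, ha]; beta_reduce; omega)
      (fun b hb => (sizedBin_mkBins hlen hu hb).mono (by rw [ha]; beta_reduce; omega))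
      (hkl.trans hsa)
      (fun k hk' => ⟨(hk k hk').1.trans hsa, fun x hx => ((hk k hk').2 x hx).trans hsa⟩)
    rw [List.length_cons, add_mul, one_mul]
    have h0 := ih best hbest
    by_cases hs : (sortedC u).val = true
    · simp only [mainLoop, Cost.bind_steps, tick_steps, hs, if_true]
      cases hsol : (solve M n keys I (mkBins 1 none u).val).val with
      | none => simp only; omega
      | some C =>
        have h5 := chosenC_steps_le (fun cfgs hc => (hI.2 cfgs hc).1) C
        have h5' := Nat.mul_le_mul_right (1 + (s + 1)) hI.1
        obtain ⟨h6, h7⟩ := HR _ _ (hI.chosen C).1 (hI.chosen C).2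
        have h8 := ih (some ((evaluate (chosen I C)).val, C)) (by simpa using h7)
        simp only [Cost.bind_steps, chosenC_val]
        cases best with
        | none => simp only; omega
        | some x =>
          obtain ⟨x, X⟩ := x
          have h9 : (bits x + _) ^ 2 ≤ _ := sq_bits_le (hbest _ rfl) h7
          simp only [Cost.bind_steps, leQ_steps, leQ_val]
          by_cases hx : x ≤ (evaluate (chosen I C)).val
          · simp only [hx, decide_true, if_true]
            omega
          · simp only [hx, decide_false, Bool.false_eq_true, if_false]
            omega
    · simp only [mainLoop, Cost.bind_steps, tick_steps, hs, Bool.false_eq_true, if_false]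
      omega

theorem utilities_steps {I : Inst} {s : ℕ} (hI : SizedInst s I) :
    (bindC (fun cfgs => bindC (fun d => mapC (fun w => pure w.uA) d) cfgs) I :
        Cost (List ℚ)).steps ≤ s * ((s * ((s + 1) + s + 2) + 1) + s * s + 2) + 1 ∧
      (bindC (fun cfgs => bindC (fun d => mapC (fun w => pure w.uA) d) cfgs) I :
        Cost (List ℚ)).val.length ≤ s * (s * s) ∧
      ∀ x ∈ (bindC (fun cfgs => bindC (fun d => mapC (fun w => pure w.uA) d) cfgs) I :
        Cost (List ℚ)).val, bits x ≤ s := by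
  have h1 : ∀ cfgs ∈ I, ∀ d ∈ cfgs, (mapC (fun w => (pure w.uA : Cost ℚ)) d).steps ≤ s + 1 ∧
      (mapC (fun w => (pure w.uA : Cost ℚ)) d).val.length ≤ s := fun cfgs hc d hd => by
    have h2 := ((hI.2 cfgs hc).2 d hd).1
    refine ⟨(mapC_steps_le (B := 0) fun _ _ => by simp).trans (by omega), ?_⟩
    rwa [mapC_val, List.length_map]
  have h2 : ∀ cfgs ∈ I, (bindC (fun d => mapC (fun w => (pure w.uA : Cost ℚ)) d) cfgs).steps ≤
        s * ((s + 1) + s + 2) + 1 ∧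
      (bindC (fun d => mapC (fun w => (pure w.uA : Cost ℚ)) d) cfgs).val.length ≤ s * s :=
    fun cfgs hc => by
      have hl := (hI.2 cfgs hc).1
      refine ⟨(bindC_steps_le (h1 cfgs hc)).trans (by gcongr), ?_⟩
      rw [bindC_val]
      exact (length_flatMap_le fun d hd => (h1 cfgs hc d hd).2).trans (by gcongr)
  have hl := hI.1
  refine ⟨(bindC_steps_le h2).trans (by gcongr), ?_, fun x hx => ?_⟩
  · rw [bindC_val]
    exact (length_flatMap_le fun c hc => (h2 c hc).2).trans (by gcongr)
  · simp only [bindC_val, mapC_val, List.mem_flatMap, List.mem_map, Cost.pure_val] at hx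
    obtain ⟨cfgs, hc, d, hd, w, hw, rfl⟩ := hx
    exact (((hI.2 cfgs hc).2 d hd).2 w hw).1

theorem scheme_steps {M : ℕ} (hM : 0 < M) : ∃ p, PolyB p ∧ ∀ (I : Inst) (s : ℕ), Valid I →
    SizedInst s I → (scheme M I).steps ≤ p s := by
  obtain ⟨P, hP, HP⟩ := preprocess_steps hM
  obtain ⟨T, hT, HT⟩ := tuplesC_steps (α := ℕ) M
  obtain ⟨T', hT', HT'⟩ := tuplesC_steps (α := ℚ) M
  obtain ⟨R, hR, HR⟩ := mainLoop_steps M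
  -- The largest entry of a vector of the dynamic program.
  obtain ⟨N, hN⟩ : ∃ N : ℕ → ℕ, N = fun t => M ^ 2 * t * t := ⟨_, rfl⟩
  have hpN : PolyB N := by rw [hN]; fun_prop
  obtain ⟨a, ha⟩ : ∃ a : ℕ → ℕ, a = fun t => t + (N t + 1) ^ M + M + N t := ⟨_, rfl⟩
  have hpa : PolyB a := by rw [ha]; fun_prop
  suffices h : ∃ q, PolyB q ∧ ∀ (I : Inst) (t : ℕ), (preprocess M I).steps ≤ t →
      SizedInst t (preprocess M I).val → (scheme M I).steps ≤ q t by
    obtain ⟨q, hq, Hq⟩ := h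
    exact ⟨fun s => q (P s), by fun_prop, fun I s hv hs =>
      Hq I (P s) (HP I s hv hs).1 (HP I s hv hs).2⟩
  refine ⟨fun t => t + (t * (t + 3) + 1) + (M ^ 2 + t + 1) ^ 2 + (M ^ 2 * t + t + 1) ^ 2 +
    (N t * (N t + 3) + 1) + T (N t + 1) + (t * ((t * ((t + 1) + t + 2) + 1) + t * t + 2) + 1) +
    T' (t * (t * t)) + ((t * (t * t)) ^ M * R (a t) + 1) + (t + 1), by fun_prop,
    fun I t hst hJ => ?_⟩
  obtain ⟨J, hJ'⟩ : ∃ J, J = (preprocess M I).val := ⟨_, rfl⟩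
  rw [← hJ'] at hJ
  obtain ⟨K, hK⟩ : ∃ K, K = M ^ 2 * J.length * J.length := ⟨_, rfl⟩
  have hl := hJ.1
  have hKN : K ≤ N t := by rw [hK, hN]; beta_reduce; gcongr
  have hta : t ≤ a t := by rw [ha]; beta_reduce; omega
  have h1 : (lengthC J).steps ≤ t * (t + 3) + 1 := (lengthC_steps_le J).trans (by gcongr)
  have h2 : (mulN (M ^ 2) J.length).steps ≤ (M ^ 2 + t + 1) ^ 2 := by
    have e1 := size_le_self (M ^ 2)
    have e2 := size_le_self J.length
    rw [mulN_steps]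
    exact Nat.pow_le_pow_left (by omega) 2
  have h3 : (mulN (M ^ 2 * J.length) J.length).steps ≤ (M ^ 2 * t + t + 1) ^ 2 := by
    have e1 := size_le_self (M ^ 2 * J.length)
    have e2 := size_le_self J.length
    have e3 : M ^ 2 * J.length ≤ M ^ 2 * t := Nat.mul_le_mul_left _ hl
    rw [mulN_steps]
    exact Nat.pow_le_pow_left (by omega) 2
  have h4 : (downFromC K).steps ≤ N t * (N t + 3) + 1 := (downFromC_steps_le K).trans (by gcongr)
  have h5 := HT (downFromC K).val (N t + 1) (by rw [downFromC_length]; omega)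
  obtain ⟨h6, h7, h8⟩ := utilities_steps hJ
  obtain ⟨us, hus⟩ : ∃ us, us = (bindC (fun cfgs => bindC (fun d =>
    mapC (fun w => pure w.uA) d) cfgs) J : Cost (List ℚ)).val := ⟨_, rfl⟩
  rw [← hus] at h7 h8
  have h9 := HT' us _ h7
  have h10 := HR J.length (tuplesC (downFromC K).val M).val J (tuplesC us M).val (a t)
    (hl.trans hta) (hJ.mono hta)
    (by
      rw [tuplesC_length, downFromC_length]
      have : (K + 1) ^ M ≤ (N t + 1) ^ M := by gcongr
      rw [ha]; beta_reduce; omega)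
    (fun k hk => by
      obtain ⟨e1, e2⟩ := mem_tuplesC.1 hk
      refine ⟨by rw [e1, ha]; beta_reduce; omega, fun x hx => ?_⟩
      have e3 := mem_downFromC.1 (e2 x hx)
      have e4 := size_le_self x
      rw [ha]; beta_reduce; omega)
    (fun u hu => by
      obtain ⟨e1, e2⟩ := mem_tuplesC.1 hu
      exact ⟨e1, fun x hx => (h8 x (e2 x hx)).trans hta⟩)
  rw [tuplesC_length] at h10
  have h11 : us.length ^ M * R (a t) ≤ (t * (t * t)) ^ M * R (a t) := by gcongr
  have h12 : (mapC (fun _ => (pure 0 : Cost ℕ)) J).steps ≤ t + 1 :=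
    (mapC_steps_le (B := 0) fun _ _ => by simp).trans (by omega)
  simp only [scheme, Cost.bind_steps, ← hJ', lengthC_val, mulN_val, ← hK, ← hus]
  split
  · omega
  · rw [Cost.pure_steps]; omega

theorem SizeBound.sizedInst {I : Inst} {n m K b : ℕ} (h : SizeBound I n m K b) :
    SizedInst (n + m + K + b) I := by
  refine ⟨by have := h.1; omega, fun cfgs hc => ?_⟩
  obtain ⟨h1, h2⟩ := h.2 cfgs hc
  refine ⟨by omega, fun d hd => ?_⟩
  obtain ⟨h3, h4⟩ := h2 d hd
  refine ⟨by omega, fun w hw => ?_⟩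
  obtain ⟨h5, h6, h7⟩ := h4 w hw
  exact ⟨by omega, by omega, by omega⟩

end UC

theorem theorem3p1 (M : ℕ) (hM : 5 ≤ M) :
    (∀ I : UC.Inst, UC.Valid I →
      UC.IsConfig I (UC.scheme M I).val ∧
      ∀ f : ℝ → ℝ, AntitoneOn f (Set.Ioc 0 1) → UC.Aligned (UC.preprocess M I).val f →
        ∀ C, UC.IsOptimal I C →
          UC.ratio M (fun j => f ((j : ℝ) / (M : ℝ))) * (UC.value I C : ℝ) ≤
            (UC.value I (UC.scheme M I).val : ℝ)) ∧
    ∃ P : MvPolynomial (Fin 4) ℕ, ∀ I : UC.Inst, UC.Valid I →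
      ∀ n m K b : ℕ, UC.SizeBound I n m K b →
        (UC.scheme M I).steps ≤ MvPolynomial.eval ![n, m, K, b] P := by
  refine ⟨fun I hI => ⟨hI.isConfig_scheme M, fun f hf hal C hC => hI.ratio_mul_le hM hf hal hC⟩, ?_⟩
  obtain ⟨p, ⟨P, hP⟩, H⟩ := UC.scheme_steps (M := M) (by omega)
  refine ⟨P.eval₂ MvPolynomial.C (.X 0 + .X 1 + .X 2 + .X 3), fun I hI n m K b hs => ?_⟩
  refine (H I _ hI hs.sizedInst).trans_eq ?_
  have hC : (MvPolynomial.eval ![n, m, K, b]).comp MvPolynomial.C = RingHom.id ℕ :=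
    RingHom.ext fun x => by simp
  rw [hP, Polynomial.hom_eval₂, hC]
  simp
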